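/- Theorem (ZF; the Axiom of Choice is not assumed). Call an ordinal $\epsilon$ even if $\epsilon=\lambda+2n$ for some limit ordinal $\lambda$ (with $0$ counted as a limit ordinal) and some natural number $n$. For an ordinal $\alpha$ let $\theta_\alpha$ denote the least ordinal that is not the surjective image of any set $S\in V_\alpha$. Let $\epsilon$ be an even ordinal and let $j:V_{\epsilon+3}\to V_{\epsilon+3}$ be an elementary embedding (of $(V_{\epsilon+3},\in)$ into itself) with critical point $\kappa$, i.e. $\kappa$ is the least ordinal moved by $j$. Then the open interval $(\theta_{\epsilon+2},\theta_{\epsilon+3})$ contains fewer than $\kappa$ regular cardinals, i.e. the set of (infinite, wellordered) regular cardinals $\delta$ with $\theta_{\epsilon+2}<\delta<\theta_{\epsilon+3}$ has cardinality strictly less than $\kappa$. As this is a theorem of ZF alone, it is stated as: in every model $M$ of ZF (an arbitrary, possibly ill-founded, first-order structure for the language of set theory satisfying the ZF axioms) the above assertion holds, with all its notions interpreted in $M$. -/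

import Mathlib

open FirstOrder

/-- The relation symbols of the language of set theory: one binary symbol. -/
inductive MembershipSymbol : ℕ → Type
  | mem : MembershipSymbol 2

/-- The first-order language of set theory. -/
def Lset : FirstOrder.Language.{0, 0} := ⟨fun _ => Empty, MembershipSymbol⟩

namespace ZFModel

/-- The membership relation of an arbitrary structure for the language of set theory. -/
def MemIn {M : Type*} [Lset.Structure M] (x y : M) : Prop :=
  FirstOrder.Language.Structure.RelMap (L := Lset) MembershipSymbol.mem ![x, y]

infix:50 " ∈ₘ " => MemIn

/-! All notions below are evaluated inside a structure `M`: every quantifier ranges over `M`. -/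

section Basic

variable {M : Type*} [Lset.Structure M]

def IsSubset (x y : M) : Prop := ∀ z, z ∈ₘ x → z ∈ₘ y

def IsEmptySet (x : M) : Prop := ∀ z, ¬ z ∈ₘ x

/-- `z = {x, y}`. -/
def IsUPair (x y z : M) : Prop := ∀ w, w ∈ₘ z ↔ w = x ∨ w = y

/-- `p = (x, y) = {{x}, {x, y}}`. -/
def IsPair (x y p : M) : Prop := ∀ z, z ∈ₘ p ↔ IsUPair x x z ∨ IsUPair x y z

/-- `y = x ∪ {x}`. -/
def IsSucc (x y : M) : Prop := ∀ z, z ∈ₘ y ↔ z ∈ₘ x ∨ z = x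

end Basic

/-- `M` is a model of ZF (no choice). Separation and Replacement are the full first-order schemes:
they are required for all classes that are definable over `M` from parameters. -/
structure IsModelZF (M : Type*) [Lset.Structure M] : Prop where
  extensionality : ∀ x y : M, (∀ z, z ∈ₘ x ↔ z ∈ₘ y) → x = y
  foundation : ∀ a : M, (∃ x, x ∈ₘ a) → ∃ x, x ∈ₘ a ∧ ∀ y, y ∈ₘ x → ¬ y ∈ₘ a
  pairing : ∀ x y : M, ∃ z, IsUPair x y z
  union : ∀ a : M, ∃ b, ∀ x, x ∈ₘ b ↔ ∃ y, y ∈ₘ a ∧ x ∈ₘ y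
  power : ∀ a : M, ∃ b, ∀ x, x ∈ₘ b ↔ IsSubset x a
  infinity : ∃ w : M, (∃ e, IsEmptySet e ∧ e ∈ₘ w) ∧
    ∀ x, x ∈ₘ w → ∃ y, IsSucc x y ∧ y ∈ₘ w
  separation : ∀ P : Set M, (Set.univ : Set M).Definable₁ Lset P →
    ∀ a : M, ∃ b, ∀ x, x ∈ₘ b ↔ x ∈ₘ a ∧ x ∈ P
  replacement : ∀ F : Set (M × M), (Set.univ : Set M).Definable₂ Lset F →
    ∀ a : M, (∀ x, x ∈ₘ a → ∀ y y', (x, y) ∈ F → (x, y') ∈ F → y = y') →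
      ∃ b, ∀ y, y ∈ₘ b ↔ ∃ x, x ∈ₘ a ∧ (x, y) ∈ F

section Notions

variable {M : Type*} [Lset.Structure M]

/-! ### Functions -/

/-- `f(x) = y`, that is, `(x, y) ∈ f`. -/
def App (f x y : M) : Prop := ∃ p, IsPair x y p ∧ p ∈ₘ f

/-- `f` is a function from `a` to `b`. -/
def IsFun (f a b : M) : Prop :=
  (∀ p, p ∈ₘ f → ∃ x y, x ∈ₘ a ∧ y ∈ₘ b ∧ IsPair x y p) ∧ ∀ x, x ∈ₘ a → ∃! y, App f x y

def IsSurjection (f a b : M) : Prop :=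
  IsFun f a b ∧ ∀ y, y ∈ₘ b → ∃ x, x ∈ₘ a ∧ App f x y

def IsInjection (f a b : M) : Prop :=
  IsFun f a b ∧ ∀ x x' y, App f x y → App f x' y → x = x'

/-- `a` has strictly smaller cardinality than `b`: `a` injects into `b`, but not conversely. -/
def CardLT (a b : M) : Prop :=
  (∃ f, IsInjection f a b) ∧ ¬ ∃ f, IsInjection f b a

/-! ### Ordinals -/

def IsTransitive (x : M) : Prop := ∀ y, y ∈ₘ x → IsSubset y x

/-- Von Neumann ordinals. -/
def IsOrdinal (x : M) : Prop := IsTransitive x ∧ ∀ y, y ∈ₘ x → IsTransitive y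

/-- `β = α + n` for a standard natural number `n`. -/
def IsPlus (α : M) : ℕ → M → Prop
  | 0, β => β = α
  | n + 1, β => ∃ γ, IsPlus α n γ ∧ IsSucc γ β

/-- `x` is a natural number of `M`. -/
def IsNat (x : M) : Prop :=
  IsOrdinal x ∧ ∀ y, y = x ∨ y ∈ₘ x → IsEmptySet y ∨ ∃ z, IsSucc z y

/-- `w` is the set of all natural numbers of `M`. -/
def IsOmega (w : M) : Prop := ∀ x, x ∈ₘ w ↔ IsNat x

/-- An ordinal that is not a successor (so `0` is included). -/
def IsLimit (x : M) : Prop := IsOrdinal x ∧ ∀ y, ¬ IsSucc y x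

/-- `ε = λ + 2n` for a limit ordinal `λ` and a natural number `n` of `M`; here
`f = ⟨λ, λ + 2, λ + 4, …, λ + 2n⟩`. -/
def IsEven (ε : M) : Prop :=
  ∃ l n n' b f z, IsLimit l ∧ IsNat n ∧ IsSucc n n' ∧ IsFun f n' b ∧
    IsEmptySet z ∧ App f z l ∧ App f n ε ∧
    ∀ k k' x y, k ∈ₘ n → IsSucc k k' → App f k x → App f k' y → IsPlus x 2 y

/-- `v = V_α`; here `f = ⟨V_β : β ≤ α⟩`, where `V_β = ⋃_{γ < β} P(V_γ)`. -/
def IsVLevel (α v : M) : Prop :=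
  IsOrdinal α ∧ ∃ α' b f, IsSucc α α' ∧ IsFun f α' b ∧ App f α v ∧
    ∀ β u, App f β u → ∀ x, x ∈ₘ u ↔ ∃ γ w, γ ∈ₘ β ∧ App f γ w ∧ IsSubset x w

/-- `θ = θ_α`, the least ordinal that is not the surjective image of any set `S ∈ V_α`. -/
def IsTheta (α θ : M) : Prop :=
  ∃ v, IsVLevel α v ∧ IsOrdinal θ ∧
    (¬ ∃ S f, S ∈ₘ v ∧ IsSurjection f S θ) ∧
    ∀ ξ, ξ ∈ₘ θ → ∃ S f, S ∈ₘ v ∧ IsSurjection f S ξ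

/-- `δ` is a (wellordered) cardinal: an ordinal that does not inject into a smaller ordinal. -/
def IsCardinal (δ : M) : Prop :=
  IsOrdinal δ ∧ ∀ α, α ∈ₘ δ → ¬ ∃ f, IsInjection f δ α

/-- `δ` is an infinite regular cardinal: every function from a smaller ordinal to `δ` is bounded. -/
def IsRegularCardinal (δ : M) : Prop :=
  IsCardinal δ ∧ (∀ n, IsNat n → n ∈ₘ δ) ∧
    ∀ α f, α ∈ₘ δ → IsFun f α δ → ∃ ρ, ρ ∈ₘ δ ∧ ∀ x y, App f x y → y ∈ₘ ρ

/-! ### Formulas and satisfaction, formalized inside `M` -/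

/-- `c = (k, (a, b))`, for a standard natural number `k`. -/
def IsCode (k : ℕ) (a b c : M) : Prop :=
  ∃ z t q, IsEmptySet z ∧ IsPlus z k t ∧ IsPair a b q ∧ IsPair t q c

/-- `c` codes `v_i ∈ v_j`. -/
def IsMemCode (i j c : M) : Prop := IsCode 0 i j c

/-- `c` codes `v_i = v_j`. -/
def IsEqCode (i j c : M) : Prop := IsCode 1 i j c

/-- `c` codes `¬ φ`. -/
def IsNotCode (φ c : M) : Prop := IsCode 2 φ φ c

/-- `c` codes `φ ∧ ψ`. -/
def IsAndCode (φ ψ c : M) : Prop := IsCode 3 φ ψ c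

/-- `c` codes `∃ v_i, φ`. -/
def IsExCode (i φ c : M) : Prop := IsCode 4 i φ c

/-- The set `C` contains the atomic formulas and is closed under `¬`, `∧` and `∃ v_i`. -/
def IsFormulaClosed (C : M) : Prop :=
  (∀ i j c, IsNat i → IsNat j → IsMemCode i j c → c ∈ₘ C) ∧
  (∀ i j c, IsNat i → IsNat j → IsEqCode i j c → c ∈ₘ C) ∧
  (∀ φ c, φ ∈ₘ C → IsNotCode φ c → c ∈ₘ C) ∧
  (∀ φ ψ c, φ ∈ₘ C → ψ ∈ₘ C → IsAndCode φ ψ c → c ∈ₘ C) ∧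
  (∀ i φ c, IsNat i → φ ∈ₘ C → IsExCode i φ c → c ∈ₘ C)

/-- `φ` is (the code of) a formula of the language of set theory, in the sense of `M`. -/
def IsFormula (φ : M) : Prop := ∀ C, IsFormulaClosed C → φ ∈ₘ C

/-- `s` is an assignment of elements of `A` to the variables `v_0, v_1, …`. -/
def IsAssignment (A s : M) : Prop := ∃ w, IsOmega w ∧ IsFun s w A

/-- `S` is a satisfaction relation (Tarski's clauses) for the structure `(A, ∈)`; the pair
`(φ, s)` belongs to `S` when `φ` is true in `(A, ∈)` under the assignment `s`. -/
def IsSatRelation (A S : M) : Prop :=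
  ∀ s, IsAssignment A s →
    (∀ i j c x y, IsNat i → IsNat j → IsMemCode i j c → App s i x → App s j y →
      (App S c s ↔ x ∈ₘ y)) ∧
    (∀ i j c x y, IsNat i → IsNat j → IsEqCode i j c → App s i x → App s j y →
      (App S c s ↔ x = y)) ∧
    (∀ φ c, IsFormula φ → IsNotCode φ c → (App S c s ↔ ¬ App S φ s)) ∧
    (∀ φ ψ c, IsFormula φ → IsFormula ψ → IsAndCode φ ψ c →
      (App S c s ↔ App S φ s ∧ App S ψ s)) ∧
    (∀ i φ c, IsNat i → IsFormula φ → IsExCode i φ c →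
      (App S c s ↔ ∃ t, IsAssignment A t ∧
        (∀ k x, IsNat k → k ≠ i → (App s k x ↔ App t k x)) ∧ App S φ t))

/-- `(A, ∈) ⊨ φ[s]`. -/
def Sat (A φ s : M) : Prop := ∃ S, IsSatRelation A S ∧ App S φ s

/-- `j` is an elementary embedding from `(A, ∈)` to `(B, ∈)`: for all formulas `φ` and all
assignments `s` in `A`, `(A, ∈) ⊨ φ[s]` if and only if `(B, ∈) ⊨ φ[j ∘ s]`. -/
def IsElementaryEmbedding (j A B : M) : Prop :=
  IsFun j A B ∧
  ∀ φ s t, IsFormula φ → IsAssignment A s → IsAssignment B t →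
    (∀ i x y, App s i x → App j x y → App t i y) →
    (Sat A φ s ↔ Sat B φ t)

/-- `κ` is the critical point of the function `j` with domain `A`: the least ordinal in `A`
moved by `j`. -/
def IsCriticalPoint (j A κ : M) : Prop :=
  IsOrdinal κ ∧ κ ∈ₘ A ∧ ¬ App j κ κ ∧ ∀ β, β ∈ₘ κ → β ∈ₘ A → App j β β

end Notions

end ZFModel

open ZFModel

/-!
The proof has two halves. Write `A = V_{ε+3}` and `j` for the embedding.

*Representation.* Because `ε` is even, there is one seed `s ∈ V_{ε+1}` such that every
`x ∈ V_{ε+2}` has the form `j(g)(s)` for a function `g` on `V_{ε+1}` coded in `V_{ε+2}`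
(`IsEvenEmbedding.seed`). This is an induction in steps of two power sets, `Represents`. At a limit
level `V_l` the seed is the graph of `j` on `V_l` (`represents_of_limit`), which determines `j` on
`V_{l+1}` by continuity. If `s` is a seed for `V_α`, then the graph of `j` on `V_{α+2}` together
with `s` is a seed for `V_{α+2}` (`Represents.pow_pow`).

*Counting.* An ordinal `δ < θ_{ε+3}` is the length of a prewellorder of a subset of `V_{ε+2}`, which
is coded by an element of `A`, so `j` induces a map from `δ` to the length `δ'` of the image of a
code. If `δ > θ_{ε+2}` is regular, then so is `δ'`, because `A` can recognize this
(`IsEvenEmbedding.isRegular_iff`). By the representation, each ordinal below `δ'` is the value at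
`s` of the image of a function from `V_{ε+1}` to `δ`. Such a function is bounded in `δ`, so the
induced map is cofinal and `δ' = δ` (`IsEvenEmbedding.collapse_ap_eq`). Now suppose that `κ` many
regular cardinals between `θ_{ε+2}` and `δ` were enumerated by a set coded in `A`. The `κ`-th member
of the image of the enumeration is one of these cardinals, hence fixed by the map induced by `j`. By
elementarity it occurs in the original enumeration at some `ξ < κ`, so in the image at `j(ξ) = ξ`,
which contradicts injectivity (`IsEvenEmbedding.not_isInjCode_crit`). A set of `κ` regular cardinals
in the interval need not have an upper bound there, but for every `α < κ` its first `α` members do,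
and elementarity turns this into an enumeration of length `κ` of the kind excluded
(`IsEvenEmbedding.cardLT_regular`).

All this takes place inside an arbitrary model `M` of ZF. Predicates and operations on `M` are shown
definable, so that separation and replacement apply to them, by instance resolution for the classes
`Dfn` and `DfnFun`. The class `DfnOver` does the same for definability over the structure `(A, ∈)`.
Elementarity in the sense of `M` refers to satisfaction for the formulas of `M`; it is used only for
standard formulas (`IsElementaryEmbedding.dfnOver_iff`), and rests on the existence of a satisfaction
relation in `M` (`exists_isSatRelation`). Pairs of elements of `V_{ε+2}` are Quine–Rosser pairs
`qpair`, which do not raise the rank at infinite levels.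
-/

namespace ZFModel

open FirstOrder FirstOrder.Language

section Definability

variable {M : Type*} [Lset.Structure M] {n m : ℕ}

/-! ### Definable predicates and operations -/

/-- The `n`-ary predicate `P` is first-order definable over `M` with parameters. -/
class Dfn (P : (Fin n → M) → Prop) : Prop where
  out : (Set.univ : Set M).Definable Lset {v | P v}

/-- The `n`-ary operation `f` has a graph that is definable over `M` with parameters. -/
class DfnFun (f : (Fin n → M) → M) : Prop where
  out : Dfn fun w : Fin (n + 1) → M => w (Fin.last n) = f fun i => w i.castSucc

theorem Dfn.congr {P Q : (Fin n → M) → Prop} (h : ∀ v, P v ↔ Q v) (hP : Dfn P) : Dfn Q := by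
  rwa [show Q = P from funext fun v => propext (h v).symm]

instance Dfn.and (P Q : (Fin n → M) → Prop) [hP : Dfn P] [hQ : Dfn Q] :
    Dfn fun v => P v ∧ Q v := ⟨hP.out.inter hQ.out⟩

instance Dfn.or (P Q : (Fin n → M) → Prop) [hP : Dfn P] [hQ : Dfn Q] :
    Dfn fun v => P v ∨ Q v := ⟨hP.out.union hQ.out⟩

instance Dfn.not (P : (Fin n → M) → Prop) [hP : Dfn P] : Dfn fun v => ¬ P v :=
  ⟨hP.out.compl⟩

instance Dfn.imp (P Q : (Fin n → M) → Prop) [hP : Dfn P] [hQ : Dfn Q] :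
    Dfn fun v => P v → Q v :=
  Dfn.congr (fun _ => imp_iff_not_or.symm) (Dfn.or (fun v => ¬ P v) Q)

instance Dfn.iff (P Q : (Fin n → M) → Prop) [hP : Dfn P] [hQ : Dfn Q] :
    Dfn fun v => P v ↔ Q v :=
  Dfn.congr (fun _ => iff_iff_implies_and_implies.symm)
    (Dfn.and (fun v => P v → Q v) (fun v => Q v → P v))

instance Dfn.ex (P : (Fin n → M) → M → Prop)
    [hP : Dfn fun w : Fin (n + 1) → M => P (fun i => w i.castSucc) (w (Fin.last n))] :
    Dfn fun v => ∃ x, P v x := by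
  constructor
  have := hP.out.image_comp (Fin.castSucc (n := n))
  convert this using 1
  ext v
  constructor
  · rintro ⟨x, hx⟩
    refine ⟨Fin.snoc (α := fun _ => M) v x, ?_, ?_⟩
    · simpa using hx
    · funext i; simp
  · rintro ⟨w, hw, rfl⟩
    exact ⟨_, hw⟩

instance Dfn.all (P : (Fin n → M) → M → Prop)
    [hP : Dfn fun w : Fin (n + 1) → M => P (fun i => w i.castSucc) (w (Fin.last n))] :
    Dfn fun v => ∀ x, P v x :=
  Dfn.congr (fun _ => not_exists_not) (Dfn.not fun v => ∃ x, ¬ P v x)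

instance Dfn.const (p : Prop) : Dfn fun _ : Fin n → M => p := by
  by_cases h : p
  · exact ⟨by simp [h]⟩
  · exact ⟨by simp [h]⟩

theorem Dfn.reindex (P : (Fin n → M) → Prop) (hP : Dfn P) (e : Fin n → Fin m) :
    Dfn fun w : Fin m → M => P fun i => w (e i) := ⟨hP.out.preimage_comp e⟩

theorem Dfn.eq_var (i k : Fin n) : Dfn fun v : Fin n → M => v i = v k := by
  refine ⟨⟨(Term.var i).equal (Term.var k), ?_⟩⟩
  ext v; simp

theorem Dfn.mem_var (i k : Fin n) : Dfn fun v : Fin n → M => v i ∈ₘ v k := by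
  have h : (∅ : Set M).Definable Lset {v : Fin n → M | v i ∈ₘ v k} := by
    rw [Set.empty_definable_iff]
    refine ⟨Relations.formula (L := Lset) (MembershipSymbol.mem : Lset.Relations 2)
      ![Term.var i, Term.var k], ?_⟩
    ext v
    refine Iff.trans ?_ (Formula.realize_rel (L := Lset)).symm
    refine iff_of_eq (congrArg (Structure.RelMap (L := Lset) _) ?_)
    funext l
    fin_cases l <;> rfl
  exact ⟨h.mono (Set.empty_subset _)⟩

instance DfnFun.var (i : Fin n) : DfnFun fun v : Fin n → M => v i := ⟨Dfn.eq_var _ _⟩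

instance DfnFun.const (c : M) : DfnFun fun _ : Fin n → M => c := by
  refine ⟨⟨?_⟩⟩
  have := (Set.Definable.singleton_of_mem Lset (Set.mem_univ c)).preimage_comp
    (fun _ : Fin 1 => Fin.last n)
  exact this

instance DfnFun.reindex (f : (Fin n → M) → M) [hf : DfnFun f] (e : Fin n → Fin m) :
    DfnFun fun w : Fin m → M => f fun i => w (e i) := by
  constructor
  have := Dfn.reindex _ hf.out (Fin.lastCases (Fin.last m) (fun i => (e i).castSucc))
  simpa using this

theorem Dfn.subst₁ (P : (Fin n → M) → M → Prop)
    (hP : Dfn fun w : Fin (n + 1) → M => P (fun i => w i.castSucc) (w (Fin.last n)))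
    (f : (Fin n → M) → M) [hf : DfnFun f] : Dfn fun v => P v (f v) := by
  have := hf.out
  exact Dfn.congr (P := fun v => ∃ x, x = f v ∧ P v x) (by simp) inferInstance

theorem Dfn.comp₂ {P : M → M → Prop} (hP : Dfn fun v : Fin 2 → M => P (v 0) (v 1))
    (f g : (Fin n → M) → M) [hf : DfnFun f] [DfnFun g] : Dfn fun v => P (f v) (g v) := by
  refine Dfn.subst₁ (fun v x => P x (g v)) ?_ f
  refine Dfn.subst₁ (fun v x => P (v (Fin.last n)) x) ?_ (fun w => g fun i => w i.castSucc)
  exact hP.reindex _ ![(Fin.last n).castSucc, Fin.last (n + 1)]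

theorem Dfn.comp₃ {P : M → M → M → Prop} (hP : Dfn fun v : Fin 3 → M => P (v 0) (v 1) (v 2))
    (f g h : (Fin n → M) → M) [hf : DfnFun f] [DfnFun g] [DfnFun h] :
    Dfn fun v => P (f v) (g v) (h v) := by
  refine Dfn.subst₁ (fun v x => P x (g v) (h v)) ?_ f
  refine Dfn.subst₁ (fun v x => P (v (Fin.last n)) x (h fun i => v i.castSucc)) ?_
    (fun w => g fun i => w i.castSucc)
  refine Dfn.subst₁ (fun v x => P (v (Fin.last n).castSucc) (v (Fin.last (n + 1))) x) ?_
    (fun w => h fun i => w i.castSucc.castSucc)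
  exact hP.reindex _ ![(Fin.last n).castSucc.castSucc, (Fin.last (n + 1)).castSucc, Fin.last _]

instance Dfn.eq (f g : (Fin n → M) → M) [DfnFun f] [DfnFun g] : Dfn fun v => f v = g v :=
  Dfn.comp₂ (Dfn.eq_var 0 1) f g

instance Dfn.ne (f g : (Fin n → M) → M) [DfnFun f] [DfnFun g] : Dfn fun v => f v ≠ g v :=
  Dfn.not fun v => f v = g v

instance Dfn.mem (f g : (Fin n → M) → M) [DfnFun f] [DfnFun g] : Dfn fun v => f v ∈ₘ g v :=
  Dfn.comp₂ (Dfn.mem_var 0 1) f g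

theorem DfnFun.comp₁ {F : M → M} (hF : DfnFun fun v : Fin 1 → M => F (v 0))
    (f : (Fin n → M) → M) [DfnFun f] : DfnFun fun v => F (f v) :=
  ⟨Dfn.comp₂ (P := fun x y => y = F x) hF.out (fun w => f fun i => w i.castSucc)
    (fun w => w (Fin.last n))⟩

theorem DfnFun.comp₂ {F : M → M → M} (hF : DfnFun fun v : Fin 2 → M => F (v 0) (v 1))
    (f g : (Fin n → M) → M) [DfnFun f] [DfnFun g] : DfnFun fun v => F (f v) (g v) :=
  ⟨Dfn.comp₃ (P := fun x y z => z = F x y) hF.out (fun w => f fun i => w i.castSucc)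
    (fun w => g fun i => w i.castSucc) (fun w => w (Fin.last n))⟩

/-- An operation with a definable membership predicate is definable, by extensionality. -/
theorem DfnFun.of_mem_iff {f : (Fin n → M) → M} {P : (Fin n → M) → M → Prop}
    (hext : ∀ x y : M, (∀ z, z ∈ₘ x ↔ z ∈ₘ y) → x = y)
    (h : ∀ v x, x ∈ₘ f v ↔ P v x)
    [Dfn fun w : Fin (n + 1) → M => P (fun i => w i.castSucc) (w (Fin.last n))] : DfnFun f := by
  have hr := fun e : Fin (n + 1) → Fin (n + 2) => Dfn.reindex _
    ‹Dfn fun w : Fin (n + 1) → M => P (fun i => w i.castSucc) (w (Fin.last n))› e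
  have h1 := hr (Fin.lastCases (Fin.last (n + 1)) (fun i => i.castSucc.castSucc))
  simp only [Fin.lastCases_castSucc, Fin.lastCases_last] at h1
  constructor
  refine Dfn.congr (P := fun w : Fin (n + 1) → M => ∀ x, x ∈ₘ w (Fin.last n) ↔
    P (fun i => w i.castSucc) x) ?_ inferInstance
  intro w
  constructor
  · intro H
    exact hext _ _ fun z => (H z).trans (h _ z).symm
  · intro H x
    rw [H]
    exact h _ x

instance Dfn.isPlus (f g : (Fin n → M) → M) [DfnFun f] [DfnFun g] (l : ℕ) :
    Dfn fun v => IsPlus (f v) l (g v) := by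
  induction l generalizing n with
  | zero => unfold IsPlus; infer_instance
  | succ l ih =>
    unfold IsPlus
    have := ih (fun w : Fin (n + 1) → M => f fun i => w i.castSucc) (fun w => w (Fin.last n))
    unfold IsSucc
    infer_instance

section Notions

variable (f g h k : (Fin n → M) → M) [DfnFun f] [DfnFun g] [DfnFun h] [DfnFun k]

instance : Dfn fun v => IsSubset (f v) (g v) := by unfold IsSubset; infer_instance
instance : Dfn fun v => IsEmptySet (f v) := by unfold IsEmptySet; infer_instance
instance : Dfn fun v => IsUPair (f v) (g v) (h v) := by unfold IsUPair; infer_instance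
instance : Dfn fun v => IsPair (f v) (g v) (h v) := by unfold IsPair; infer_instance
instance : Dfn fun v => IsSucc (f v) (g v) := by unfold IsSucc; infer_instance
instance : Dfn fun v => App (f v) (g v) (h v) := by unfold App; infer_instance
instance : Dfn fun v => IsFun (f v) (g v) (h v) := by unfold IsFun ExistsUnique; infer_instance
instance : Dfn fun v => IsInjection (f v) (g v) (h v) := by unfold IsInjection; infer_instance
instance : Dfn fun v => IsTransitive (f v) := by unfold IsTransitive; infer_instance
instance : Dfn fun v => IsOrdinal (f v) := by unfold IsOrdinal; infer_instance
instance : Dfn fun v => IsNat (f v) := by unfold IsNat; infer_instance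
instance : Dfn fun v => IsOmega (f v) := by unfold IsOmega; infer_instance
instance : Dfn fun v => IsCardinal (f v) := by unfold IsCardinal; infer_instance
instance : Dfn fun v => IsRegularCardinal (f v) := by unfold IsRegularCardinal; infer_instance
instance : Dfn fun v => IsAssignment (f v) (g v) := by unfold IsAssignment; infer_instance

instance (k : ℕ) (a b c : (Fin n → M) → M) [DfnFun a] [DfnFun b] [DfnFun c] :
    Dfn fun v => IsCode k (a v) (b v) (c v) := by unfold IsCode; infer_instance
instance : Dfn fun v => IsMemCode (f v) (g v) (h v) := by unfold IsMemCode; infer_instance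
instance : Dfn fun v => IsEqCode (f v) (g v) (h v) := by unfold IsEqCode; infer_instance
instance : Dfn fun v => IsNotCode (f v) (g v) := by unfold IsNotCode; infer_instance
instance : Dfn fun v => IsAndCode (f v) (g v) (h v) := by unfold IsAndCode; infer_instance
instance : Dfn fun v => IsExCode (f v) (g v) (h v) := by unfold IsExCode; infer_instance
instance : Dfn fun v => IsFormulaClosed (f v) := by unfold IsFormulaClosed; infer_instance
instance : Dfn fun v => IsFormula (f v) := by unfold IsFormula; infer_instance

end Notions

end Definability

section Comprehension

variable {M : Type*} [Lset.Structure M] {n m : ℕ}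

theorem Dfn.comp {P : (Fin n → M) → Prop} (hP : Dfn P) (t : Fin n → (Fin m → M) → M)
    (ht : ∀ i, DfnFun (t i)) : Dfn fun v => P fun i => t i v := by
  have h1 : (Set.univ : Set M).Definable Lset
      {w : Fin m ⊕ Fin n → M | P fun i => w (Sum.inr i)} := hP.out.preimage_comp Sum.inr
  have h2 : (Set.univ : Set M).Definable Lset
      (⋂ i, {w : Fin m ⊕ Fin n → M | w (Sum.inr i) = t i fun k => w (Sum.inl k)}) := by
    refine Set.definable_iInter_of_finite fun i => ?_
    have := (ht i).out.out.preimage_comp (β := Fin m ⊕ Fin n)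
      (Fin.lastCases (Sum.inr i) fun k => Sum.inl k)
    convert this using 1
    ext w
    simp
  constructor
  convert (h1.inter h2).exists_of_finite using 1
  ext v
  constructor
  · intro h
    exact ⟨fun i => t i v, h, by simp⟩
  · rintro ⟨u, hu, hu2⟩
    have : u = fun i => t i v := by
      funext i
      simpa using Set.mem_iInter.1 hu2 i
    subst this
    exact hu

/-- A parametrized definable predicate is definable at each value of the parameters. -/
theorem Dfn.fiber {P : (Fin n → M) → M → Prop}
    (hP : Dfn fun w : Fin (n + 1) → M => P (fun i => w i.castSucc) (w (Fin.last n)))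
    (u : Fin n → M) : Dfn fun v : Fin 1 → M => P u (v 0) := by
  have := hP.comp (m := 1) (Fin.lastCases (fun v => v 0) fun i _ => u i) (by
    intro i
    refine Fin.lastCases ?_ (fun i => ?_) i
    · simp only [Fin.lastCases_last]; infer_instance
    · simp only [Fin.lastCases_castSucc]; infer_instance)
  simpa using this

theorem DfnFun.comp {F : (Fin n → M) → M} (hF : DfnFun F) (t : Fin n → (Fin m → M) → M)
    (ht : ∀ i, DfnFun (t i)) : DfnFun fun v => F fun i => t i v := by
  constructor
  have := hF.out.comp (m := m + 1)
    (Fin.lastCases (fun v => v (Fin.last m)) fun i v => t i fun k => v k.castSucc) (by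
      intro i
      refine Fin.lastCases ?_ (fun i => ?_) i
      · simp only [Fin.lastCases_last]; infer_instance
      · simp only [Fin.lastCases_castSucc]; infer_instance)
  simpa using this

theorem DfnFun.fiber {F : (Fin n → M) → M → M}
    (hF : DfnFun fun w : Fin (n + 1) → M => F (fun i => w i.castSucc) (w (Fin.last n)))
    (u : Fin n → M) : DfnFun fun v : Fin 1 → M => F u (v 0) := by
  have := hF.comp (m := 1) (Fin.lastCases (fun v => v 0) fun i _ => u i) (by
    intro i
    refine Fin.lastCases ?_ (fun i => ?_) i
    · simp only [Fin.lastCases_last]; infer_instance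
    · simp only [Fin.lastCases_castSucc]; infer_instance)
  simpa using this

end Comprehension

section Sets

variable {M : Type*} [Lset.Structure M]

theorem IsSubset.refl (x : M) : IsSubset x x := fun _ h => h

theorem IsSubset.trans {x y z : M} (h : IsSubset x y) (h' : IsSubset y z) : IsSubset x z :=
  fun w hw => h' w (h w hw)

variable [hM : Fact (IsModelZF M)] {n : ℕ}

instance nonempty_of_isModelZF : Nonempty M := ⟨hM.out.infinity.choose⟩

theorem set_ext {x y : M} (h : ∀ z, z ∈ₘ x ↔ z ∈ₘ y) : x = y := hM.out.extensionality x y h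

/-- The set of all `x` with `P x`, a junk value if these do not form a set of `M`. -/
noncomputable def comprehend (P : M → Prop) : M :=
  Classical.epsilon fun b => ∀ x, x ∈ₘ b ↔ P x

theorem mem_comprehend {P : M → Prop} (h : ∃ b, ∀ x, x ∈ₘ b ↔ P x) (x : M) :
    x ∈ₘ comprehend P ↔ P x := Classical.epsilon_spec h x

theorem DfnFun.of_mem {f : (Fin n → M) → M} {P : (Fin n → M) → M → Prop}
    (h : ∀ v x, x ∈ₘ f v ↔ P v x)
    [Dfn fun w : Fin (n + 1) → M => P (fun i => w i.castSucc) (w (Fin.last n))] : DfnFun f :=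
  DfnFun.of_mem_iff hM.out.extensionality h

/-! ### Set operations -/

/-- `{x ∈ a | P x}`. -/
noncomputable def sep (a : M) (P : M → Prop) : M := comprehend fun x => x ∈ₘ a ∧ P x

theorem mem_sep' {a : M} {P : M → Prop} (hP : Dfn fun v : Fin 1 → M => P (v 0)) {x : M} :
    x ∈ₘ sep a P ↔ x ∈ₘ a ∧ P x :=
  mem_comprehend (hM.out.separation {x | P x} hP.out a) x

theorem mem_sep {a : M} {P : M → Prop} [hP : Dfn fun v : Fin 1 → M => P (v 0)] {x : M} :
    x ∈ₘ sep a P ↔ x ∈ₘ a ∧ P x := mem_sep' hP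

instance DfnFun.sep (f : (Fin n → M) → M) (P : (Fin n → M) → M → Prop) [DfnFun f]
    [hP : Dfn fun w : Fin (n + 1) → M => P (fun i => w i.castSucc) (w (Fin.last n))] :
    DfnFun fun v => sep (f v) (P v) :=
  DfnFun.of_mem (P := fun v x => x ∈ₘ f v ∧ P v x) fun v _ => mem_sep' (hP.fiber v)

/-- The empty set of `M`. -/
noncomputable def emp : M := sep (Classical.arbitrary M) fun _ => False

@[simp] theorem not_mem_emp (x : M) : ¬ x ∈ₘ (emp : M) := by simp [emp, mem_sep]

theorem isEmptySet_iff {x : M} : IsEmptySet x ↔ x = emp :=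
  ⟨fun h => set_ext fun z => iff_of_false (h z) (not_mem_emp z), fun h => h ▸ not_mem_emp⟩

theorem eq_emp_or_exists_mem (x : M) : x = emp ∨ ∃ y, y ∈ₘ x := by
  by_cases h : ∃ y, y ∈ₘ x
  · exact Or.inr h
  · exact Or.inl (isEmptySet_iff.1 fun z hz => h ⟨z, hz⟩)

/-- `{x, y}`. -/
noncomputable def upair (x y : M) : M := comprehend fun w => w = x ∨ w = y

@[simp] theorem mem_upair {x y w : M} : w ∈ₘ upair x y ↔ w = x ∨ w = y :=
  mem_comprehend (hM.out.pairing x y) w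

theorem isUPair_iff {x y z : M} : IsUPair x y z ↔ z = upair x y :=
  ⟨fun h => set_ext fun w => (h w).trans mem_upair.symm, fun h _ => h ▸ mem_upair⟩

/-- The Kuratowski pair `(x, y)`. -/
noncomputable def opair (x y : M) : M := upair (upair x x) (upair x y)

theorem isPair_iff {x y p : M} : IsPair x y p ↔ p = opair x y := by
  simp only [IsPair, isUPair_iff, opair]
  exact ⟨fun h => set_ext fun w => (h w).trans mem_upair.symm, fun h _ => h ▸ mem_upair⟩

theorem upair_inj_left {x y z : M} (h : upair x y = upair x z) : y = z := by
  have h1 : y ∈ₘ upair x z := h ▸ mem_upair.2 (Or.inr rfl)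
  have h2 : z ∈ₘ upair x y := h ▸ mem_upair.2 (Or.inr rfl)
  rw [mem_upair] at h1 h2
  rcases h1 with h1 | h1
  · rcases h2 with h2 | h2
    · rw [h1, h2]
    · exact h2.symm
  · exact h1

@[simp] theorem opair_inj {x y x' y' : M} : opair x y = opair x' y' ↔ x = x' ∧ y = y' := by
  refine ⟨fun h => ?_, fun h => by rw [h.1, h.2]⟩
  have hx : x = x' := by
    have h1 : upair x x ∈ₘ opair x' y' := h ▸ mem_upair.2 (Or.inl rfl)
    rcases mem_upair.1 h1 with h1 | h1
    · have : x ∈ₘ upair x' x' := h1 ▸ mem_upair.2 (Or.inl rfl)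
      simpa using this
    · have h2 : x' ∈ₘ upair x x := h1 ▸ mem_upair.2 (Or.inl rfl)
      simpa [eq_comm] using h2
  subst hx
  exact ⟨rfl, upair_inj_left (upair_inj_left h)⟩

theorem app_iff {f x y : M} : App f x y ↔ opair x y ∈ₘ f := by
  simp [App, isPair_iff]

/-- `⋃ a`. -/
noncomputable def sUnion (a : M) : M := comprehend fun x => ∃ y, y ∈ₘ a ∧ x ∈ₘ y

@[simp] theorem mem_sUnion {a x : M} : x ∈ₘ sUnion a ↔ ∃ y, y ∈ₘ a ∧ x ∈ₘ y :=
  mem_comprehend (hM.out.union a) x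

/-- `a ∪ b`. -/
noncomputable def union (a b : M) : M := sUnion (upair a b)

@[simp] theorem mem_union {a b x : M} : x ∈ₘ union a b ↔ x ∈ₘ a ∨ x ∈ₘ b := by
  simp [union]

/-- The power set of `a`. -/
noncomputable def pow (a : M) : M := comprehend fun x => IsSubset x a

@[simp] theorem mem_pow {a x : M} : x ∈ₘ pow a ↔ IsSubset x a :=
  mem_comprehend (hM.out.power a) x

/-- `a ∪ {a}`. -/
noncomputable def succ (a : M) : M := union a (upair a a)

@[simp] theorem mem_succ {a x : M} : x ∈ₘ succ a ↔ x ∈ₘ a ∨ x = a := by simp [succ]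

theorem isSucc_iff {x y : M} : IsSucc x y ↔ y = succ x :=
  ⟨fun h => set_ext fun w => (h w).trans mem_succ.symm, fun h _ => h ▸ mem_succ⟩

section Dfn

variable (f g : (Fin n → M) → M) [DfnFun f] [DfnFun g]

instance : DfnFun fun v => upair (f v) (g v) := DfnFun.of_mem fun _ _ => mem_upair
instance : DfnFun fun v => opair (f v) (g v) := by unfold opair; infer_instance
instance : DfnFun fun v => sUnion (f v) := DfnFun.of_mem fun _ _ => mem_sUnion
instance : DfnFun fun v => union (f v) (g v) := by unfold union; infer_instance
instance : DfnFun fun v => pow (f v) := DfnFun.of_mem fun _ _ => mem_pow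
instance : DfnFun fun v => succ (f v) := by unfold succ; infer_instance

end Dfn

/-- The image of the set `a` under a class relation. -/
noncomputable def relImage (a : M) (R : M → M → Prop) : M :=
  comprehend fun y => ∃ x, x ∈ₘ a ∧ R x y

theorem mem_relImage {a : M} {R : M → M → Prop} (hR : Dfn fun v : Fin 2 → M => R (v 0) (v 1))
    (h : ∀ x, x ∈ₘ a → ∀ y y', R x y → R x y' → y = y') {y : M} :
    y ∈ₘ relImage a R ↔ ∃ x, x ∈ₘ a ∧ R x y :=
  mem_comprehend (hM.out.replacement {p | R p.1 p.2} hR.out a h) y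

/-- `{F x | x ∈ a}`. -/
noncomputable def image (a : M) (F : M → M) : M := relImage a fun x y => y = F x

theorem mem_image' {a : M} {F : M → M} (hF : DfnFun fun v : Fin 1 → M => F (v 0)) {y : M} :
    y ∈ₘ image a F ↔ ∃ x, x ∈ₘ a ∧ y = F x :=
  mem_relImage hF.out fun _ _ _ _ h h' => h.trans h'.symm

theorem mem_image {a : M} {F : M → M} [hF : DfnFun fun v : Fin 1 → M => F (v 0)] {y : M} :
    y ∈ₘ image a F ↔ ∃ x, x ∈ₘ a ∧ y = F x := mem_image' hF

instance DfnFun.image (f : (Fin n → M) → M) (F : (Fin n → M) → M → M) [DfnFun f]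
    [hF : DfnFun fun w : Fin (n + 1) → M => F (fun i => w i.castSucc) (w (Fin.last n))] :
    DfnFun fun v => image (f v) (F v) := by
  have h1 := DfnFun.reindex (m := n + 2)
    (fun w : Fin (n + 1) → M => F (fun i => w i.castSucc) (w (Fin.last n)))
    (Fin.lastCases (Fin.last (n + 1)) fun i => i.castSucc.castSucc)
  simp only [Fin.lastCases_castSucc, Fin.lastCases_last] at h1
  exact DfnFun.of_mem (P := fun v y => ∃ x, x ∈ₘ f v ∧ y = F v x)
    fun v _ => mem_image' (hF.fiber v)

/-- `a × b`, with Kuratowski pairs. -/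
noncomputable def prod (a b : M) : M :=
  sep (pow (pow (union a b))) fun p => ∃ x y, x ∈ₘ a ∧ y ∈ₘ b ∧ p = opair x y

theorem mem_prod {a b p : M} : p ∈ₘ prod a b ↔ ∃ x y, x ∈ₘ a ∧ y ∈ₘ b ∧ p = opair x y := by
  rw [prod, mem_sep]
  refine ⟨fun h => h.2, fun h => ⟨?_, h⟩⟩
  obtain ⟨x, y, hx, hy, rfl⟩ := h
  rw [mem_pow]
  intro z hz
  rw [mem_pow]
  intro w hw
  rw [mem_union]
  rcases mem_upair.1 hz with rfl | rfl <;> rcases mem_upair.1 hw with rfl | rfl <;> tauto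

@[simp] theorem opair_mem_prod {a b x y : M} : opair x y ∈ₘ prod a b ↔ x ∈ₘ a ∧ y ∈ₘ b := by
  rw [mem_prod]
  constructor
  · rintro ⟨x', y', hx, hy, h⟩
    obtain ⟨rfl, rfl⟩ := opair_inj.1 h
    exact ⟨hx, hy⟩
  · rintro ⟨hx, hy⟩
    exact ⟨x, y, hx, hy, rfl⟩

/-- A set that contains the coordinates of all ordered pairs in `f`. -/
noncomputable def field (f : M) : M := sUnion (sUnion f)

theorem mem_field {f x y : M} (h : opair x y ∈ₘ f) : x ∈ₘ field f ∧ y ∈ₘ field f := by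
  have h1 : upair x y ∈ₘ sUnion f := mem_sUnion.2 ⟨_, h, mem_upair.2 (Or.inr rfl)⟩
  exact ⟨mem_sUnion.2 ⟨_, h1, mem_upair.2 (Or.inl rfl)⟩,
    mem_sUnion.2 ⟨_, h1, mem_upair.2 (Or.inr rfl)⟩⟩

instance (f : (Fin n → M) → M) [DfnFun f] : DfnFun fun v => field (f v) := by
  unfold field; infer_instance

/-- The value of the set function `f` at `x`, defined as a union of sets in order to be a definable
operation. -/
noncomputable def ap (f x : M) : M := sUnion (sep (field f) fun y => opair x y ∈ₘ f)

instance (f g : (Fin n → M) → M) [DfnFun f] [DfnFun g] : DfnFun fun v => ap (f v) (g v) := by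
  unfold ap; infer_instance

instance (f g : (Fin n → M) → M) [DfnFun f] [DfnFun g] : DfnFun fun v => prod (f v) (g v) := by
  unfold prod; infer_instance

theorem ap_eq {f x y : M} (h : opair x y ∈ₘ f) (hu : ∀ z, opair x z ∈ₘ f → z = y) :
    ap f x = y := by
  refine set_ext fun z => ?_
  simp only [ap, mem_sUnion, mem_sep]
  constructor
  · rintro ⟨w, ⟨_, hw⟩, hz⟩
    exact hu w hw ▸ hz
  · exact fun hz => ⟨y, ⟨(mem_field h).2, h⟩, hz⟩

/-- The second coordinates of the ordered pairs in `f`. -/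
noncomputable def ran (f : M) : M := sep (field f) fun y => ∃ x, opair x y ∈ₘ f

@[simp] theorem mem_ran {f y : M} : y ∈ₘ ran f ↔ ∃ x, opair x y ∈ₘ f := by
  rw [ran, mem_sep]
  exact ⟨fun h => h.2, fun h => ⟨(mem_field h.choose_spec).2, h⟩⟩

instance (f : (Fin n → M) → M) [DfnFun f] : DfnFun fun v => ran (f v) := by
  unfold ran; infer_instance

section Functions

variable {f a b : M}

theorem IsFun.mem_iff (h : IsFun f a b) {x y : M} :
    opair x y ∈ₘ f ↔ x ∈ₘ a ∧ y = ap f x := by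
  have key : ∀ {x}, x ∈ₘ a → ∀ {y}, opair x y ∈ₘ f ↔ y = ap f x := by
    intro x hx y
    obtain ⟨y', hy', hu⟩ := h.2 x hx
    simp only [app_iff] at hy' hu
    rw [ap_eq hy' hu]
    exact ⟨hu y, fun e => e ▸ hy'⟩
  constructor
  · intro hp
    obtain ⟨x', y', hx, _, e⟩ := h.1 _ hp
    obtain ⟨rfl, rfl⟩ := opair_inj.1 (isPair_iff.1 e)
    exact ⟨hx, (key hx).1 hp⟩
  · rintro ⟨hx, e⟩
    exact (key hx).2 e

theorem IsFun.app_iff (h : IsFun f a b) {x y : M} : App f x y ↔ x ∈ₘ a ∧ y = ap f x :=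
  ZFModel.app_iff.trans h.mem_iff

theorem IsFun.ap_mem (h : IsFun f a b) {x : M} (hx : x ∈ₘ a) : ap f x ∈ₘ b := by
  obtain ⟨x', y', _, hy, e⟩ := h.1 _ (h.mem_iff.2 ⟨hx, rfl⟩)
  rw [(opair_inj.1 (isPair_iff.1 e)).2]
  exact hy

theorem isFun_of (h1 : ∀ p, p ∈ₘ f → ∃ x y, x ∈ₘ a ∧ y ∈ₘ b ∧ p = opair x y)
    (h2 : ∀ x, x ∈ₘ a → ∃! y, opair x y ∈ₘ f) : IsFun f a b := by
  simp only [IsFun, isPair_iff, ZFModel.app_iff]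
  exact ⟨h1, h2⟩

/-- The set function on `a` with values `F x`. -/
noncomputable def lam (a : M) (F : M → M) : M := image a fun x => opair x (F x)

variable {F : M → M}

theorem mem_lam [DfnFun fun v : Fin 1 → M => F (v 0)] {x y : M} :
    opair x y ∈ₘ lam a F ↔ x ∈ₘ a ∧ y = F x := by
  rw [lam, mem_image]
  constructor
  · rintro ⟨x', hx, e⟩
    obtain ⟨rfl, rfl⟩ := opair_inj.1 e
    exact ⟨hx, rfl⟩
  · rintro ⟨hx, rfl⟩
    exact ⟨x, hx, rfl⟩

theorem isFun_lam [DfnFun fun v : Fin 1 → M => F (v 0)] (h : ∀ x, x ∈ₘ a → F x ∈ₘ b) :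
    IsFun (lam a F) a b := by
  refine isFun_of ?_ fun x hx => ⟨F x, mem_lam.2 ⟨hx, rfl⟩, fun y hy => (mem_lam.1 hy).2⟩
  intro p hp
  rw [lam, mem_image] at hp
  obtain ⟨x, hx, rfl⟩ := hp
  exact ⟨x, _, hx, h x hx, rfl⟩

theorem ap_lam [DfnFun fun v : Fin 1 → M => F (v 0)] {x : M} (hx : x ∈ₘ a) :
    ap (lam a F) x = F x :=
  ap_eq (mem_lam.2 ⟨hx, rfl⟩) fun _ h => (mem_lam.1 h).2

theorem IsFun.mono (h : IsFun f a b) {c : M} (hc : ∀ x, x ∈ₘ a → ap f x ∈ₘ c) : IsFun f a c := by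
  refine ⟨fun p hp => ?_, h.2⟩
  obtain ⟨x, y, hx, hy, e⟩ := h.1 p hp
  rw [isPair_iff] at e
  subst e
  exact ⟨x, y, hx, (h.mem_iff.1 hp).2 ▸ hc x hx, isPair_iff.2 rfl⟩

theorem isInjection_iff : IsInjection f a b ↔ IsFun f a b ∧
    ∀ x x', x ∈ₘ a → x' ∈ₘ a → ap f x = ap f x' → x = x' := by
  refine and_congr_right fun h => ?_
  simp only [h.app_iff]
  constructor
  · exact fun H x x' hx hx' e => H x x' _ ⟨hx, rfl⟩ ⟨hx', e⟩
  · rintro H x x' y ⟨hx, rfl⟩ ⟨hx', e⟩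
    exact H x x' hx hx' e

theorem isSurjection_iff : IsSurjection f a b ↔ IsFun f a b ∧
    ∀ y, y ∈ₘ b → ∃ x, x ∈ₘ a ∧ y = ap f x := by
  refine and_congr_right fun h => ?_
  simp only [h.app_iff]
  exact forall₂_congr fun y _ => exists_congr fun x => by tauto

end Functions

theorem IsSubset.antisymm {x y : M} (h : IsSubset x y) (h' : IsSubset y x) : x = y :=
  set_ext fun z => ⟨h z, h' z⟩

theorem sep_subset {a : M} {P : M → Prop} [Dfn fun v : Fin 1 → M => P (v 0)] :
    IsSubset (sep a P) a := fun _ h => (mem_sep.1 h).1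

end Sets

section Ordinals

variable {M : Type*} [Lset.Structure M] [hM : Fact (IsModelZF M)] {n : ℕ}

/-! ### Ordinals and natural numbers -/

theorem exists_minimal {P : M → Prop} [Dfn fun v : Fin 1 → M => P (v 0)] {a x : M}
    (hx : x ∈ₘ a) (h : P x) : ∃ x, x ∈ₘ a ∧ P x ∧ ∀ y, y ∈ₘ x → y ∈ₘ a → ¬ P y := by
  obtain ⟨z, hz, hm⟩ := hM.out.foundation (sep a P) ⟨x, mem_sep.2 ⟨hx, h⟩⟩
  rw [mem_sep] at hz
  exact ⟨z, hz.1, hz.2, fun y hy hya hP => hm y hy (mem_sep.2 ⟨hya, hP⟩)⟩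

theorem not_mem_self (x : M) : ¬ x ∈ₘ x := by
  intro h
  obtain ⟨z, hz, hm⟩ := hM.out.foundation (upair x x) ⟨x, by simp⟩
  obtain rfl : z = x := by simpa using hz
  exact hm _ h (by simp)

theorem not_mem_of_mem {x y : M} (h : x ∈ₘ y) : ¬ y ∈ₘ x := by
  intro h'
  obtain ⟨z, hz, hm⟩ := hM.out.foundation (upair x y) ⟨x, by simp⟩
  rcases mem_upair.1 hz with rfl | rfl
  · exact hm _ h' (by simp)
  · exact hm _ h (by simp)

section

omit hM

theorem IsOrdinal.mem {α β : M} (h : IsOrdinal α) (hβ : β ∈ₘ α) : IsOrdinal β :=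
  ⟨h.2 β hβ, fun γ hγ => h.2 γ (h.1 β hβ γ hγ)⟩

theorem IsOrdinal.trans {α β γ : M} (h : IsOrdinal α) (hβ : β ∈ₘ α) (hγ : γ ∈ₘ β) : γ ∈ₘ α :=
  h.1 β hβ γ hγ

theorem isOrdinal_of {α : M} (h : IsTransitive α) (h' : ∀ β, β ∈ₘ α → IsOrdinal β) :
    IsOrdinal α := ⟨h, fun β hβ => (h' β hβ).1⟩

end

theorem isOrdinal_succ {α : M} (h : IsOrdinal α) : IsOrdinal (succ α) := by
  refine isOrdinal_of (fun β hβ γ hγ => ?_) fun β hβ => ?_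
  · rw [mem_succ] at hβ ⊢
    rcases hβ with hβ | rfl
    · exact Or.inl (h.trans hβ hγ)
    · exact Or.inl hγ
  · rcases mem_succ.1 hβ with hβ | rfl
    · exact h.mem hβ
    · exact h

theorem isOrdinal_emp : IsOrdinal (emp : M) :=
  ⟨fun _ h => absurd h (not_mem_emp _), fun _ h => absurd h (not_mem_emp _)⟩

theorem ordinal_trichotomy {α β : M} (hα : IsOrdinal α) (hβ : IsOrdinal β) :
    α ∈ₘ β ∨ α = β ∨ β ∈ₘ α := by
  by_contra hc
  -- a minimal counterexample: first minimize `α`, then `β`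
  obtain ⟨a, ha, ⟨b, hb, hab⟩, hm⟩ := exists_minimal (a := succ α) (x := α)
    (P := fun a => ∃ b, b ∈ₘ succ β ∧ ¬ (a ∈ₘ b ∨ a = b ∨ b ∈ₘ a))
    (by simp) ⟨β, by simp, hc⟩
  obtain ⟨b, hb, hab, hm'⟩ := exists_minimal (a := succ β) (x := b)
    (P := fun b => ¬ (a ∈ₘ b ∨ a = b ∨ b ∈ₘ a)) hb hab
  have hsα := isOrdinal_succ hα
  have hsβ := isOrdinal_succ hβ
  refine hab (Or.inr (Or.inl (set_ext fun x => ⟨fun hx => ?_, fun hx => ?_⟩)))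
  · by_contra hxb
    have h1 := hm x hx (hsα.trans ha hx)
    push Not at h1
    rcases h1 b hb with h1 | rfl | h1
    · exact hxb h1
    · exact hab (Or.inr (Or.inr hx))
    · exact hab (Or.inr (Or.inr ((hsα.mem ha).trans hx h1)))
  · by_contra hxa
    have h1 := hm' x hx (hsβ.trans hb hx)
    rcases not_not.1 h1 with h1 | rfl | h1
    · exact hab (Or.inl ((hsβ.mem hb).trans hx h1))
    · exact hab (Or.inl hx)
    · exact hxa h1

theorem IsOrdinal.subset_iff {α β : M} (hα : IsOrdinal α) (hβ : IsOrdinal β) :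
    IsSubset α β ↔ ¬ β ∈ₘ α := by
  constructor
  · exact fun h h' => not_mem_self _ (h _ h')
  · intro h
    rcases ordinal_trichotomy hα hβ with h1 | rfl | h1
    · exact hβ.1 _ h1
    · exact IsSubset.refl _
    · exact absurd h1 h

theorem IsOrdinal.mem_or_subset {α β : M} (hα : IsOrdinal α) (hβ : IsOrdinal β) :
    β ∈ₘ α ∨ IsSubset α β := by
  rw [hα.subset_iff hβ]
  exact em _

theorem IsOrdinal.mem_of_subset_of_mem {α β γ : M} (hα : IsOrdinal α) (hγ : IsOrdinal γ)
    (h : IsSubset α β) (h' : β ∈ₘ γ) : α ∈ₘ γ := by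
  rcases ordinal_trichotomy hα hγ with h1 | rfl | h1
  · exact h1
  · exact absurd (h _ h') (not_mem_self _)
  · exact absurd (h _ (hα.trans h1 h')) (not_mem_self _)

theorem ordinal_induction {P : M → Prop} [Dfn fun v : Fin 1 → M => P (v 0)]
    (ih : ∀ α, IsOrdinal α → (∀ β, β ∈ₘ α → P β) → P α) {α : M} (hα : IsOrdinal α) : P α := by
  by_contra hP
  obtain ⟨β, hβ, h1, h2⟩ := exists_minimal (a := succ α) (x := α) (P := fun x => ¬ P x)
    (by simp) hP
  have hs := isOrdinal_succ hα
  exact h1 (ih β (hs.mem hβ) fun γ hγ => not_not.1 (h2 γ hγ (hs.trans hβ hγ)))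

theorem exists_least_ordinal {P : M → Prop} [Dfn fun v : Fin 1 → M => P (v 0)]
    {α : M} (hα : IsOrdinal α) (h : P α) :
    ∃ β, IsOrdinal β ∧ P β ∧ ∀ γ, γ ∈ₘ β → ¬ P γ := by
  by_contra hc
  push Not at hc
  refine ordinal_induction (P := fun x => ¬ P x) (fun β hβ ih hP => ?_) hα h
  obtain ⟨γ, hγ, hPγ⟩ := hc β hβ hP
  exact ih γ hγ hPγ

theorem succ_ne_emp (x : M) : succ x ≠ emp := fun h => not_mem_emp x (h ▸ mem_succ.2 (Or.inr rfl))

theorem succ_inj {x y : M} (h : succ x = succ y) : x = y := by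
  have h1 : x ∈ₘ succ y := h ▸ mem_succ.2 (Or.inr rfl)
  have h2 : y ∈ₘ succ x := h ▸ mem_succ.2 (Or.inr rfl)
  rcases mem_succ.1 h1 with h1 | h1
  · rcases mem_succ.1 h2 with h2 | h2
    · exact absurd h2 (not_mem_of_mem h1)
    · exact h2.symm
  · exact h1

theorem isNat_iff {x : M} : IsNat x ↔
    IsOrdinal x ∧ ∀ y, y ∈ₘ succ x → y = emp ∨ ∃ z, y = succ z := by
  simp only [IsNat, isEmptySet_iff, isSucc_iff, mem_succ, or_comm]

theorem isNat_emp : IsNat (emp : M) := by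
  rw [isNat_iff]
  exact ⟨isOrdinal_emp, fun y hy => Or.inl (by simpa using hy)⟩

theorem isNat_succ {k : M} (h : IsNat k) : IsNat (succ k) := by
  rw [isNat_iff] at *
  refine ⟨isOrdinal_succ h.1, fun y hy => ?_⟩
  rcases mem_succ.1 hy with hy | rfl
  · exact h.2 y hy
  · exact Or.inr ⟨k, rfl⟩

theorem IsNat.mem {k l : M} (h : IsNat k) (hl : l ∈ₘ k) : IsNat l := by
  rw [isNat_iff] at *
  refine ⟨h.1.mem hl, fun y hy => h.2 y (mem_succ.2 (Or.inl ?_))⟩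
  rcases mem_succ.1 hy with hy | rfl
  · exact h.1.trans hl hy
  · exact hl

theorem IsNat.cases {k : M} (h : IsNat k) : k = emp ∨ ∃ l, IsNat l ∧ k = succ l := by
  rcases (isNat_iff.1 h).2 k (mem_succ.2 (Or.inr rfl)) with h1 | ⟨l, rfl⟩
  · exact Or.inl h1
  · exact Or.inr ⟨l, h.mem (mem_succ.2 (Or.inr rfl)), rfl⟩

theorem nat_induction {P : M → Prop} [Dfn fun v : Fin 1 → M => P (v 0)]
    (h0 : P emp) (hs : ∀ k, IsNat k → P k → P (succ k)) {k : M} (hk : IsNat k) : P k := by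
  refine ordinal_induction (P := fun k => IsNat k → P k) (fun α _ ih hα => ?_) hk.1 hk
  rcases hα.cases with rfl | ⟨l, hl, rfl⟩
  · exact h0
  · exact hs l hl (ih l (mem_succ.2 (Or.inr rfl)) hl)

theorem exists_omega : ∃ w : M, ∀ x, x ∈ₘ w ↔ IsNat x := by
  obtain ⟨w, ⟨e, he, hew⟩, hs⟩ := hM.out.infinity
  rw [isEmptySet_iff] at he
  subst he
  refine ⟨sep w IsNat, fun x => ?_⟩
  rw [mem_sep, and_iff_right_iff_imp]
  refine nat_induction (P := fun x => x ∈ₘ w) hew fun k _ hk => ?_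
  obtain ⟨y, hy, hyw⟩ := hs k hk
  rw [isSucc_iff] at hy
  exact hy ▸ hyw

/-- The set of natural numbers of `M`, possibly with nonstandard members. -/
noncomputable def omega : M := comprehend IsNat

@[simp] theorem mem_omega {x : M} : x ∈ₘ omega ↔ IsNat x := mem_comprehend exists_omega x

theorem isOmega_iff {w : M} : IsOmega w ↔ w = omega :=
  ⟨fun h => set_ext fun x => (h x).trans mem_omega.symm, fun h _ => h ▸ mem_omega⟩

theorem isOrdinal_omega : IsOrdinal (omega : M) :=
  isOrdinal_of (fun _ hk _ hl => mem_omega.2 ((mem_omega.1 hk).mem hl))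
    fun _ hk => (mem_omega.1 hk).1

/-- The von Neumann numeral of a standard natural number. -/
noncomputable def numeral : ℕ → M
  | 0 => emp
  | k + 1 => succ (numeral k)

theorem isNat_numeral (k : ℕ) : IsNat (numeral k : M) := by
  induction k with
  | zero => exact isNat_emp
  | succ k ih => exact isNat_succ ih

theorem numeral_inj {k l : ℕ} (h : (numeral k : M) = numeral l) : k = l := by
  induction k generalizing l with
  | zero =>
    cases l with
    | zero => rfl
    | succ l => exact absurd h.symm (succ_ne_emp _)
  | succ k ih =>
    cases l with
    | zero => exact absurd h (succ_ne_emp _)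
    | succ l => rw [ih (succ_inj h)]

theorem isPlus_succ {α γ : M} {k : ℕ} : IsPlus α (k + 1) γ ↔ ∃ β, IsPlus α k β ∧ γ = succ β := by
  simp [IsPlus, isSucc_iff]

theorem isPlus_emp_iff {k : ℕ} {β : M} : IsPlus emp k β ↔ β = numeral k := by
  induction k generalizing β with
  | zero => exact Iff.rfl
  | succ k ih => simp [isPlus_succ, ih, numeral]

/-! ### Recursion along a well-founded relation -/

/-- The relation `r` is well-founded on the set `a`, with respect to subsets of `a` in `M`. -/
def WF (a : M) (r : M → M → Prop) : Prop :=
  ∀ b, IsSubset b a → (∃ x, x ∈ₘ b) → ∃ x, x ∈ₘ b ∧ ∀ y, y ∈ₘ b → ¬ r y x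

theorem WF.induction {a : M} {r : M → M → Prop} (hr : WF a r)
    {P : M → Prop} [Dfn fun v : Fin 1 → M => P (v 0)]
    (ih : ∀ x, x ∈ₘ a → (∀ y, y ∈ₘ a → r y x → P y) → P x) : ∀ x, x ∈ₘ a → P x := by
  by_contra hc
  push Not at hc
  obtain ⟨x, hx, hPx⟩ := hc
  obtain ⟨z, hz, hm⟩ := hr (sep a fun x => ¬ P x) sep_subset ⟨x, mem_sep.2 ⟨hx, hPx⟩⟩
  rw [mem_sep] at hz
  exact hz.2 (ih z hz.1 fun y hy hyz => by_contra fun h => hm y (mem_sep.2 ⟨hy, h⟩) hyz)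

/-- The part of the set function `f` above the `r`-predecessors of `x`. -/
noncomputable def restrict (r : M → M → Prop) (f x : M) : M :=
  sep f fun p => ∃ y z, p = opair y z ∧ r y x

/-- `f` is a function on a subset of `a` closed under `r`-predecessors, and satisfies there the
recursion `f x = G x (f ↾ x)`. -/
def IsApprox (a : M) (r : M → M → Prop) (G : M → M → M) (f : M) : Prop :=
  (∀ p, p ∈ₘ f → ∃ x y, x ∈ₘ a ∧ p = opair x y) ∧
  (∀ x y, opair x y ∈ₘ f → y = G x (restrict r f x)) ∧
  ∀ x y, opair x y ∈ₘ f → ∀ x', x' ∈ₘ a → r x' x → ∃ y', opair x' y' ∈ₘ f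

theorem mem_restrict {r : M → M → Prop} (hr : Dfn fun v : Fin 2 → M => r (v 0) (v 1))
    {f x y z : M} : opair y z ∈ₘ restrict r f x ↔ opair y z ∈ₘ f ∧ r y x := by
  have := fun {n} (f g : (Fin n → M) → M) [DfnFun f] [DfnFun g] => hr.comp₂ f g
  rw [restrict, mem_sep]
  refine and_congr_right fun _ => ⟨?_, fun h => ⟨y, z, rfl, h⟩⟩
  rintro ⟨y', z', e, h⟩
  rw [opair_inj] at e
  exact e.1 ▸ h

/-- Recursion along a definable well-founded relation on a set: the union of all approximations is
a total solution. -/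
theorem exists_recursion {a : M} {r : M → M → Prop} {G : M → M → M}
    (hr : Dfn fun v : Fin 2 → M => r (v 0) (v 1))
    (hG : DfnFun fun v : Fin 2 → M => G (v 0) (v 1)) (hwf : WF a r) :
    ∃ f, (∀ p, p ∈ₘ f → ∃ x y, x ∈ₘ a ∧ p = opair x y) ∧
      ∀ x, x ∈ₘ a → (∀ y, opair x y ∈ₘ f ↔ y = ap f x) ∧ ap f x = G x (restrict r f x) := by
  have ir := fun {n} (f g : (Fin n → M) → M) [DfnFun f] [DfnFun g] => hr.comp₂ f g
  have iG := fun {n} (f g : (Fin n → M) → M) [DfnFun f] [DfnFun g] => hG.comp₂ f g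
  have iR : ∀ {n} (f g : (Fin n → M) → M) [DfnFun f] [DfnFun g],
      DfnFun fun v => restrict r (f v) (g v) := by
    intro n f g _ _
    unfold restrict
    infer_instance
  have iA : ∀ {n} (f : (Fin n → M) → M) [DfnFun f], Dfn fun v => IsApprox a r G (f v) := by
    intro n f _
    unfold IsApprox
    infer_instance
  have ext_restrict : ∀ {f g x : M}, (∀ p, p ∈ₘ f → ∃ x y, x ∈ₘ a ∧ p = opair x y) →
      (∀ p, p ∈ₘ g → ∃ x y, x ∈ₘ a ∧ p = opair x y) →
      (∀ y z, y ∈ₘ a → r y x → (opair y z ∈ₘ f ↔ opair y z ∈ₘ g)) →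
      restrict r f x = restrict r g x := by
    intro f g x hf hg h
    refine set_ext fun p => ?_
    simp only [restrict, mem_sep]
    constructor
    · rintro ⟨hp, y, z, rfl, hyx⟩
      obtain ⟨y', z', hy, e⟩ := hf _ hp
      rw [opair_inj] at e
      exact ⟨(h y z (e.1 ▸ hy) hyx).1 hp, y, z, rfl, hyx⟩
    · rintro ⟨hp, y, z, rfl, hyx⟩
      obtain ⟨y', z', hy, e⟩ := hg _ hp
      rw [opair_inj] at e
      exact ⟨(h y z (e.1 ▸ hy) hyx).2 hp, y, z, rfl, hyx⟩
  -- two approximations agree on their common domain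
  have agree : ∀ f g, IsApprox a r G f → IsApprox a r G g → ∀ x, x ∈ₘ a → ∀ y z,
      opair x y ∈ₘ f → opair x z ∈ₘ g → y = z := by
    intro f g hf hg
    refine hwf.induction (P := fun x => ∀ y z, opair x y ∈ₘ f → opair x z ∈ₘ g → y = z) ?_
    intro x hx ih y z hy hz
    rw [hf.2.1 x y hy, hg.2.1 x z hz]
    congr 1
    refine ext_restrict hf.1 hg.1 fun x' w hx' hr' => ⟨fun h => ?_, fun h => ?_⟩
    · obtain ⟨w', hw'⟩ := hg.2.2 x z hz x' hx' hr'
      rwa [ih x' hx' hr' w w' h hw']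
    · obtain ⟨w', hw'⟩ := hf.2.2 x y hy x' hx' hr'
      rwa [← ih x' hx' hr' w' w hw' h]
  let F : M := relImage a fun x p => ∃ f y, IsApprox a r G f ∧ p = opair x y ∧ p ∈ₘ f
  have hF : ∀ x y, opair x y ∈ₘ F ↔ ∃ f, IsApprox a r G f ∧ opair x y ∈ₘ f := by
    intro x y
    rw [mem_relImage inferInstance]
    · constructor
      · rintro ⟨_, _, f, _, hf, _, h⟩
        exact ⟨f, hf, h⟩
      · rintro ⟨f, hf, h⟩
        obtain ⟨x', y', hx, e⟩ := hf.1 _ h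
        rw [opair_inj] at e
        exact ⟨x, e.1 ▸ hx, f, y, hf, rfl, h⟩
    · rintro x hx p p' ⟨f, y, hf, rfl, h⟩ ⟨f', y', hf', rfl, h'⟩
      rw [agree f f' hf hf' x hx y y' h h']
  have hFa : ∀ p, p ∈ₘ F → ∃ x y, x ∈ₘ a ∧ p = opair x y := by
    intro p hp
    rw [mem_relImage inferInstance] at hp
    · obtain ⟨x, hx, f, y, -, h, -⟩ := hp
      exact ⟨x, y, hx, h⟩
    · rintro x hx p p' ⟨f, y, hf, rfl, h⟩ ⟨f', y', hf', rfl, h'⟩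
      rw [agree f f' hf hf' x hx y y' h h']
  have hFG : IsApprox a r G F := by
    refine ⟨hFa, fun x y h => ?_, fun x y h x' hx' hr' => ?_⟩
    · obtain ⟨f, hf, h⟩ := (hF x y).1 h
      rw [hf.2.1 x y h]
      congr 1
      refine ext_restrict hf.1 hFa fun x' w hx' hr' =>
        ⟨fun h => (hF _ _).2 ⟨f, hf, h⟩, fun h' => ?_⟩
      obtain ⟨g, hg, hg'⟩ := (hF _ _).1 h'
      obtain ⟨w', hw'⟩ := hf.2.2 x y h x' hx' hr'
      rwa [agree g f hg hf x' hx' w w' hg' hw']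
    · obtain ⟨f, hf, h⟩ := (hF x y).1 h
      obtain ⟨w', hw'⟩ := hf.2.2 x y h x' hx' hr'
      exact ⟨w', (hF _ _).2 ⟨f, hf, hw'⟩⟩
  have total : ∀ x, x ∈ₘ a → ∃ y, opair x y ∈ₘ F := by
    refine hwf.induction (P := fun x => ∃ y, opair x y ∈ₘ F) ?_
    intro x hx ih
    by_contra hc
    -- otherwise `F` could be extended by one more value at `x`
    have hxx : ¬ r x x := fun h => hc (ih x hx h)
    let p := opair x (G x (restrict r F x))
    have hmem : ∀ q, q ∈ₘ union F (upair p p) ↔ q ∈ₘ F ∨ q = p := by simp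
    have hres : ∀ x', x' ∈ₘ a → ((∃ y, opair x' y ∈ₘ F) ∨ x' = x) →
        restrict r (union F (upair p p)) x' = restrict r F x' := by
      intro x' hx' h'
      refine set_ext fun q => ?_
      simp only [restrict, mem_sep, hmem]
      refine ⟨?_, fun h => ⟨Or.inl h.1, h.2⟩⟩
      rintro ⟨hq | hq, y, z, rfl, hyx⟩
      · exact ⟨hq, y, z, rfl, hyx⟩
      · obtain ⟨rfl, rfl⟩ := opair_inj.1 hq
        rcases h' with ⟨w, hw⟩ | rfl
        · exact absurd (hFG.2.2 x' w hw y hx hyx) hc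
        · exact absurd hyx hxx
    have hA : IsApprox a r G (union F (upair p p)) := by
      refine ⟨fun q hq => ?_, fun x' y h => ?_, fun x' y h y' hy' hr' => ?_⟩
      · rcases (hmem q).1 hq with hq | rfl
        · exact hFa q hq
        · exact ⟨x, _, hx, rfl⟩
      · rcases (hmem _).1 h with h | h
        · obtain ⟨x1, y1, hx1, e⟩ := hFa _ h
          rw [opair_inj] at e
          rw [hres x' (e.1 ▸ hx1) (Or.inl ⟨y, h⟩)]
          exact hFG.2.1 x' y h
        · obtain ⟨rfl, rfl⟩ := opair_inj.1 h
          rw [hres x' hx (Or.inr rfl)]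
      · rcases (hmem _).1 h with h | h
        · obtain ⟨w, hw⟩ := hFG.2.2 x' y h y' hy' hr'
          exact ⟨w, (hmem _).2 (Or.inl hw)⟩
        · obtain ⟨rfl, rfl⟩ := opair_inj.1 h
          obtain ⟨w, hw⟩ := ih y' hy' hr'
          exact ⟨w, (hmem _).2 (Or.inl hw)⟩
    exact hc ⟨_, (hF _ _).2 ⟨_, hA, (hmem _).2 (Or.inr rfl)⟩⟩
  refine ⟨F, hFa, fun x hx => ?_⟩
  obtain ⟨y, hy⟩ := total x hx
  have hap : ap F x = y := ap_eq hy fun z hz => agree F F hFG hFG x hx z y hz hy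
  rw [hap]
  exact ⟨fun z => ⟨fun hz => agree F F hFG hFG x hx z y hz hy, fun e => e ▸ hy⟩, hFG.2.1 x y hy⟩

/-! ### Order types of prewellorders -/

/-- The strict part of a prewellordering of the set `a`: a well-founded transitive relation whose
incomparability relation is an equivalence relation. -/
structure IsPWO (a : M) (r : M → M → Prop) : Prop where
  wf : WF a r
  trans : ∀ x y z, x ∈ₘ a → y ∈ₘ a → z ∈ₘ a → r x y → r y z → r x z
  conn : ∀ x y z, x ∈ₘ a → y ∈ₘ a → z ∈ₘ a → r x z → r x y ∨ r y z

/-- Every prewellordered set is mapped onto an ordinal by `x ↦ {f y | y < x}`. -/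
theorem IsPWO.exists_collapse {a : M} {r : M → M → Prop}
    (hr : Dfn fun v : Fin 2 → M => r (v 0) (v 1)) (h : IsPWO a r) :
    ∃ f δ, IsOrdinal δ ∧ IsSurjection f a δ ∧
      ∀ x y, x ∈ₘ a → y ∈ₘ a → (r x y ↔ ap f x ∈ₘ ap f y) := by
  obtain ⟨f, hfa, hf⟩ := exists_recursion (G := fun _ p => ran p) hr
    (inferInstanceAs (DfnFun fun v : Fin 2 → M => ran (v 1))) h.wf
  have hmem : ∀ x, x ∈ₘ a → ∀ z, z ∈ₘ ap f x ↔ ∃ y, y ∈ₘ a ∧ r y x ∧ z = ap f y := by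
    intro x hx z
    rw [(hf x hx).2, mem_ran]
    simp only [mem_restrict hr]
    constructor
    · rintro ⟨y, hy, hyx⟩
      obtain ⟨y', z', hy', e⟩ := hfa _ hy
      rw [opair_inj] at e
      have hya : y ∈ₘ a := e.1 ▸ hy'
      exact ⟨y, hya, hyx, ((hf y hya).1 z).1 hy⟩
    · rintro ⟨y, hy, hyx, rfl⟩
      exact ⟨y, ((hf y hy).1 _).2 rfl, hyx⟩
  have htr : ∀ x, x ∈ₘ a → IsTransitive (ap f x) := by
    intro x hx z hz w hw
    obtain ⟨y, hy, hyx, rfl⟩ := (hmem x hx z).1 hz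
    obtain ⟨u, hu, huy, rfl⟩ := (hmem y hy w).1 hw
    exact (hmem x hx _).2 ⟨u, hu, h.trans u y x hu hy hx huy hyx, rfl⟩
  have hord : ∀ x, x ∈ₘ a → IsOrdinal (ap f x) := by
    intro x hx
    refine ⟨htr x hx, fun z hz => ?_⟩
    obtain ⟨y, hy, _, rfl⟩ := (hmem x hx z).1 hz
    exact htr y hy
  have hran : ∀ z, z ∈ₘ ran f ↔ ∃ x, x ∈ₘ a ∧ z = ap f x := by
    intro z
    rw [mem_ran]
    constructor
    · rintro ⟨x, hxz⟩
      obtain ⟨x', z', hx', e⟩ := hfa _ hxz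
      rw [opair_inj] at e
      have hx : x ∈ₘ a := e.1 ▸ hx'
      exact ⟨x, hx, ((hf x hx).1 z).1 hxz⟩
    · rintro ⟨x, hx, rfl⟩
      exact ⟨x, ((hf x hx).1 _).2 rfl⟩
  have hfun : IsFun f a (ran f) := by
    refine isFun_of (fun p hp => ?_) fun x hx => ⟨ap f x, ((hf x hx).1 _).2 rfl, fun y hy =>
      ((hf x hx).1 y).1 hy⟩
    obtain ⟨x, y, hx, rfl⟩ := hfa p hp
    exact ⟨x, y, hx, mem_ran.2 ⟨x, hp⟩, rfl⟩
  refine ⟨f, ran f, isOrdinal_of ?_ ?_, isSurjection_iff.2 ⟨hfun, fun y hy => (hran y).1 hy⟩, ?_⟩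
  · intro z hz w hw
    obtain ⟨x, hx, rfl⟩ := (hran z).1 hz
    obtain ⟨y, hy, _, rfl⟩ := (hmem x hx w).1 hw
    exact (hran _).2 ⟨y, hy, rfl⟩
  · intro z hz
    obtain ⟨x, hx, rfl⟩ := (hran z).1 hz
    exact hord x hx
  · intro x y hx hy
    refine ⟨fun hxy => (hmem y hy _).2 ⟨x, hx, hxy, rfl⟩, fun hxy => ?_⟩
    obtain ⟨u, hu, huy, e⟩ := (hmem y hy _).1 hxy
    rcases h.conn u x y hu hx hy huy with hux | hxy'
    · have : ap f u ∈ₘ ap f x := (hmem x hx _).2 ⟨u, hu, hux, rfl⟩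
      exact absurd (e ▸ this) (not_mem_self _)
    · exact hxy'

theorem isPWO_mem {a : M} (h : ∀ x, x ∈ₘ a → IsOrdinal x) :
    IsPWO a fun x y : M => x ∈ₘ y where
  wf b _ hb := by
    obtain ⟨x, hx, hm⟩ := hM.out.foundation b hb
    exact ⟨x, hx, fun y hy hyx => hm y hyx hy⟩
  trans _ _ _ _ _ hz hxy hyz := (h _ hz).trans hyz hxy
  conn x y z hx hy hz hxz := by
    rcases ordinal_trichotomy (h x hx) (h y hy) with h1 | rfl | h1
    · exact Or.inl h1
    · exact Or.inr hxz
    · exact Or.inr ((h z hz).trans hxz h1)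

/-- An order-preserving map between ordinals does not decrease any ordinal. -/
theorem not_mem_of_strictMono {f α : M} (hα : IsOrdinal α)
    (h : ∀ x y, y ∈ₘ α → x ∈ₘ y → ap f x ∈ₘ ap f y) : ∀ x, x ∈ₘ α → ¬ ap f x ∈ₘ x := by
  intro x hx
  refine ordinal_induction (P := fun x => x ∈ₘ α → ¬ ap f x ∈ₘ x) ?_ (hα.mem hx) hx
  intro x _ ih hx hfx
  exact ih _ hfx (hα.trans hx hfx) (h _ x hx hfx)

end Ordinals

-- Definability of a nested formula is found as one large instance.
set_option synthInstance.maxSize 1000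

section Formulas

variable {M : Type*} [Lset.Structure M] {n : ℕ}

/-! ### Definability over a set -/

/-- Formulas of the language of set theory in the free variables `v_0, …, v_{n-1}`; the quantifier
of `ex φ` binds `v_n`. -/
inductive Fm : ℕ → Type
  | mem {n : ℕ} (i k : Fin n) : Fm n
  | eq {n : ℕ} (i k : Fin n) : Fm n
  | neg {n : ℕ} (φ : Fm n) : Fm n
  | and {n : ℕ} (φ ψ : Fm n) : Fm n
  | ex {n : ℕ} (φ : Fm (n + 1)) : Fm n

/-- Satisfaction of a formula in the structure `(A, ∈)`. -/
def Fm.Real (A : M) : {n : ℕ} → Fm n → (Fin n → M) → Prop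
  | _, .mem i k, v => v i ∈ₘ v k
  | _, .eq i k, v => v i = v k
  | _, .neg φ, v => ¬ φ.Real A v
  | _, .and φ ψ, v => φ.Real A v ∧ ψ.Real A v
  | _, .ex φ, v => ∃ x, x ∈ₘ A ∧ φ.Real A (Fin.snoc (α := fun _ => M) v x)

/-- On tuples from `A`, the predicate `P` is defined by a formula (without parameters) over the
structure `(A, ∈)`. -/
class DfnOver (A : M) (P : (Fin n → M) → Prop) : Prop where
  out : ∃ φ : Fm n, ∀ v, (∀ i, v i ∈ₘ A) → (φ.Real A v ↔ P v)

namespace DfnOver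

variable {A : M}

theorem congr {P Q : (Fin n → M) → Prop} (h : ∀ v, (∀ i, v i ∈ₘ A) → (P v ↔ Q v))
    (hP : DfnOver A P) : DfnOver A Q :=
  ⟨hP.out.choose, fun v hv => (hP.out.choose_spec v hv).trans (h v hv)⟩

instance mem (i k : Fin n) : DfnOver A fun v => v i ∈ₘ v k := ⟨.mem i k, fun _ _ => Iff.rfl⟩

instance eq (i k : Fin n) : DfnOver A fun v => v i = v k := ⟨.eq i k, fun _ _ => Iff.rfl⟩

instance not (P : (Fin n → M) → Prop) [hP : DfnOver A P] : DfnOver A fun v => ¬ P v :=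
  ⟨.neg hP.out.choose, fun v hv => not_congr (hP.out.choose_spec v hv)⟩

instance and (P Q : (Fin n → M) → Prop) [hP : DfnOver A P] [hQ : DfnOver A Q] :
    DfnOver A fun v => P v ∧ Q v :=
  ⟨.and hP.out.choose hQ.out.choose, fun v hv =>
    and_congr (hP.out.choose_spec v hv) (hQ.out.choose_spec v hv)⟩

instance or (P Q : (Fin n → M) → Prop) [DfnOver A P] [DfnOver A Q] :
    DfnOver A fun v => P v ∨ Q v :=
  congr (P := fun v => ¬ (¬ P v ∧ ¬ Q v)) (fun _ _ => by tauto) inferInstance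

instance imp (P Q : (Fin n → M) → Prop) [DfnOver A P] [DfnOver A Q] :
    DfnOver A fun v => P v → Q v :=
  congr (P := fun v => ¬ (P v ∧ ¬ Q v)) (fun _ _ => by tauto) inferInstance

instance iff (P Q : (Fin n → M) → Prop) [DfnOver A P] [DfnOver A Q] :
    DfnOver A fun v => P v ↔ Q v :=
  congr (P := fun v => (P v → Q v) ∧ (Q v → P v)) (fun _ _ => by tauto) inferInstance

instance ex (P : (Fin n → M) → M → Prop)
    [hP : DfnOver A fun w : Fin (n + 1) → M => P (fun i => w i.castSucc) (w (Fin.last n))] :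
    DfnOver A fun v => ∃ x, x ∈ₘ A ∧ P v x := by
  obtain ⟨φ, hφ⟩ := hP.out
  refine ⟨.ex φ, fun v hv => exists_congr fun x => and_congr_right fun hx => ?_⟩
  rw [hφ]
  · simp
  · intro i
    refine Fin.lastCases ?_ (fun i => ?_) i
    · simpa using hx
    · simpa using hv i

instance all (P : (Fin n → M) → M → Prop)
    [hP : DfnOver A fun w : Fin (n + 1) → M => P (fun i => w i.castSucc) (w (Fin.last n))] :
    DfnOver A fun v => ∀ x, x ∈ₘ A → P v x :=
  congr (P := fun v => ¬ ∃ x, x ∈ₘ A ∧ ¬ P v x) (fun _ _ => by simp) inferInstance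

variable [hA : Fact (IsTransitive A)]

instance exMem (P : (Fin n → M) → M → Prop) (k : Fin n)
    [hP : DfnOver A fun w : Fin (n + 1) → M => P (fun i => w i.castSucc) (w (Fin.last n))] :
    DfnOver A fun v => ∃ x, x ∈ₘ v k ∧ P v x :=
  congr (P := fun v => ∃ x, x ∈ₘ A ∧ x ∈ₘ v k ∧ P v x)
    (fun _ hv => exists_congr fun _ => ⟨fun h => h.2, fun h => ⟨hA.out _ (hv k) _ h.1, h⟩⟩)
    inferInstance

instance allMem (P : (Fin n → M) → M → Prop) (k : Fin n)
    [hP : DfnOver A fun w : Fin (n + 1) → M => P (fun i => w i.castSucc) (w (Fin.last n))] :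
    DfnOver A fun v => ∀ x, x ∈ₘ v k → P v x :=
  congr (P := fun v => ¬ ∃ x, x ∈ₘ v k ∧ ¬ P v x) (fun _ _ => by simp) inferInstance

end DfnOver

/-! ### Codes of formulas and the satisfaction relation -/

theorem isFormulaClosed_formulas {F : M} (hF : ∀ φ, φ ∈ₘ F ↔ IsFormula φ) :
    IsFormulaClosed F := by
  refine ⟨fun i k c hi hk h => (hF _).2 fun C hC => hC.1 i k c hi hk h,
    fun i k c hi hk h => (hF _).2 fun C hC => hC.2.1 i k c hi hk h,
    fun φ c hφ h => (hF _).2 fun C hC => hC.2.2.1 φ c ((hF _).1 hφ C hC) h,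
    fun φ ψ c hφ hψ h => (hF _).2 fun C hC =>
      hC.2.2.2.1 φ ψ c ((hF _).1 hφ C hC) ((hF _).1 hψ C hC) h,
    fun i φ c hi hφ h => (hF _).2 fun C hC => hC.2.2.2.2 i φ c hi ((hF _).1 hφ C hC) h⟩

variable [hM : Fact (IsModelZF M)]

theorem isCode_iff {k : ℕ} {a b c : M} : IsCode k a b c ↔ c = opair (numeral k) (opair a b) := by
  simp [IsCode, isEmptySet_iff, isPair_iff, isPlus_emp_iff]

/-- The code in `M` of a formula. -/
noncomputable def Fm.code : {n : ℕ} → Fm n → M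
  | _, .mem i k => opair (numeral 0) (opair (numeral i) (numeral k))
  | _, .eq i k => opair (numeral 1) (opair (numeral i) (numeral k))
  | _, .neg φ => opair (numeral 2) (opair φ.code φ.code)
  | _, .and φ ψ => opair (numeral 3) (opair φ.code ψ.code)
  | n, .ex φ => opair (numeral 4) (opair (numeral n) φ.code)

theorem isFormula_code (φ : Fm n) : IsFormula (φ.code : M) := by
  intro C hC
  induction φ with
  | mem i k => exact hC.1 _ _ _ (isNat_numeral i) (isNat_numeral k) (isCode_iff.2 rfl)
  | eq i k => exact hC.2.1 _ _ _ (isNat_numeral i) (isNat_numeral k) (isCode_iff.2 rfl)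
  | neg φ ih => exact hC.2.2.1 _ _ ih (isCode_iff.2 rfl)
  | and φ ψ ih ih' => exact hC.2.2.2.1 _ _ _ ih ih' (isCode_iff.2 rfl)
  | ex φ ih => exact hC.2.2.2.2 _ _ _ (isNat_numeral _) ih (isCode_iff.2 rfl)

/-- Some set contains the natural numbers and is closed under pairing. It bounds the class of codes
of formulas. -/
theorem exists_closed_opair : ∃ u : M, (∀ k, IsNat k → k ∈ₘ u) ∧
    ∀ x y, x ∈ₘ u → y ∈ₘ u → opair x y ∈ₘ u := by
  -- the union of the sets `f k = ω ∪ (⋃_{l < k} f l) × (⋃_{l < k} f l)`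
  have hwf : WF (omega : M) fun x y => x ∈ₘ y := (isPWO_mem fun x hx => (mem_omega.1 hx).1).wf
  have hr : Dfn fun v : Fin 2 → M => v 0 ∈ₘ v 1 := inferInstance
  obtain ⟨f, hfa, hf⟩ := exists_recursion
    (G := fun _ p => union omega (prod (sUnion (ran p)) (sUnion (ran p)))) hr
    (inferInstanceAs (DfnFun fun v : Fin 2 → M =>
      union omega (prod (sUnion (ran (v 1))) (sUnion (ran (v 1)))))) hwf
  have hmem : ∀ x, x ∈ₘ sUnion (ran f) ↔ ∃ k, IsNat k ∧ x ∈ₘ ap f k := by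
    intro x
    simp only [mem_sUnion, mem_ran]
    constructor
    · rintro ⟨y, ⟨k, hk⟩, hx⟩
      obtain ⟨k', _, hk', e⟩ := hfa _ hk
      rw [← (opair_inj.1 e).1] at hk'
      exact ⟨k, mem_omega.1 hk', ((hf k hk').1 y).1 hk ▸ hx⟩
    · rintro ⟨k, hk, hx⟩
      exact ⟨_, ⟨k, ((hf k (mem_omega.2 hk)).1 _).2 rfl⟩, hx⟩
  have hstep : ∀ k l x, IsNat k → l ∈ₘ k → x ∈ₘ ap f l →
      x ∈ₘ sUnion (ran (restrict (fun x y => x ∈ₘ y) f k)) := by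
    intro k l x hk hl hx
    exact mem_sUnion.2 ⟨_, mem_ran.2 ⟨l, (mem_restrict hr).2
      ⟨((hf l (mem_omega.2 (hk.mem hl))).1 _).2 rfl, hl⟩⟩, hx⟩
  refine ⟨sUnion (ran f), fun k hk => (hmem k).2 ⟨emp, isNat_emp, ?_⟩, fun x y hx hy => ?_⟩
  · rw [(hf _ (mem_omega.2 isNat_emp)).2]
    exact mem_union.2 (Or.inl (mem_omega.2 hk))
  · obtain ⟨k, hk, hx⟩ := (hmem x).1 hx
    obtain ⟨l, hl, hy⟩ := (hmem y).1 hy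
    have : ∃ m, IsNat m ∧ k ∈ₘ m ∧ l ∈ₘ m := by
      rcases ordinal_trichotomy hk.1 hl.1 with h | rfl | h
      · exact ⟨succ l, isNat_succ hl, mem_succ.2 (Or.inl h), mem_succ.2 (Or.inr rfl)⟩
      · exact ⟨succ k, isNat_succ hk, mem_succ.2 (Or.inr rfl), mem_succ.2 (Or.inr rfl)⟩
      · exact ⟨succ k, isNat_succ hk, mem_succ.2 (Or.inr rfl), mem_succ.2 (Or.inl h)⟩
    obtain ⟨m, hm, hkm, hlm⟩ := this
    refine (hmem _).2 ⟨m, hm, ?_⟩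
    rw [(hf _ (mem_omega.2 hm)).2]
    exact mem_union.2 (Or.inr (opair_mem_prod.2 ⟨hstep m k x hm hkm hx, hstep m l y hm hlm hy⟩))

theorem isFormulaClosed_iff {C : M} : IsFormulaClosed C ↔
    (∀ i k, IsNat i → IsNat k → opair (numeral 0) (opair i k) ∈ₘ C) ∧
    (∀ i k, IsNat i → IsNat k → opair (numeral 1) (opair i k) ∈ₘ C) ∧
    (∀ φ, φ ∈ₘ C → opair (numeral 2) (opair φ φ) ∈ₘ C) ∧
    (∀ φ ψ, φ ∈ₘ C → ψ ∈ₘ C → opair (numeral 3) (opair φ ψ) ∈ₘ C) ∧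
    (∀ i φ, IsNat i → φ ∈ₘ C → opair (numeral 4) (opair i φ) ∈ₘ C) := by
  simp only [IsFormulaClosed, IsMemCode, IsEqCode, IsNotCode, IsAndCode, IsExCode, isCode_iff]
  refine and_congr ?_ (and_congr ?_ (and_congr ?_ (and_congr ?_ ?_))) <;> aesop

/-- In `M` there is a set of all codes of formulas. -/
theorem exists_formulas : ∃ F : M, ∀ φ, φ ∈ₘ F ↔ IsFormula φ := by
  obtain ⟨u, hu, hu'⟩ := exists_closed_opair (M := M)
  have hc : IsFormulaClosed u := isFormulaClosed_iff.2
    ⟨fun i k hi hk => hu' _ _ (hu _ (isNat_numeral _)) (hu' _ _ (hu _ hi) (hu _ hk)),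
     fun i k hi hk => hu' _ _ (hu _ (isNat_numeral _)) (hu' _ _ (hu _ hi) (hu _ hk)),
     fun φ hφ => hu' _ _ (hu _ (isNat_numeral _)) (hu' _ _ hφ hφ),
     fun φ ψ hφ hψ => hu' _ _ (hu _ (isNat_numeral _)) (hu' _ _ hφ hψ),
     fun i φ hi hφ => hu' _ _ (hu _ (isNat_numeral _)) (hu' _ _ (hu _ hi) hφ)⟩
  exact ⟨sep u IsFormula, fun φ => mem_sep.trans ⟨fun h => h.2, fun h => ⟨h u hc, h⟩⟩⟩

/-- `ψ` is an immediate subformula of `φ`. -/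
def IsSubformula (ψ φ : M) : Prop :=
  φ = opair (numeral 2) (opair ψ ψ) ∨
  (∃ χ, φ = opair (numeral 3) (opair ψ χ) ∨ φ = opair (numeral 3) (opair χ ψ)) ∨
  ∃ i, φ = opair (numeral 4) (opair i ψ)

theorem numeral_eq_iff {k l : ℕ} : (numeral k : M) = numeral l ↔ k = l :=
  ⟨numeral_inj, fun h => by rw [h]⟩

theorem wf_isSubformula {F : M} (hF : ∀ φ, φ ∈ₘ F ↔ IsFormula φ) : WF F IsSubformula := by
  have hFc := isFormulaClosed_iff.1 (isFormulaClosed_formulas hF)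
  intro b hb ⟨x, hx⟩
  by_contra hc
  push Not at hc
  have hC : IsFormulaClosed (sep F fun φ => ¬ φ ∈ₘ b) := by
    refine isFormulaClosed_iff.2 ⟨fun i k hi hk => ?_, fun i k hi hk => ?_, fun φ hφ => ?_,
      fun φ ψ hφ hψ => ?_, fun i φ hi hφ => ?_⟩ <;> simp only [mem_sep] at *
    · refine ⟨hFc.1 i k hi hk, fun h => ?_⟩
      obtain ⟨y, _, hy⟩ := hc _ h
      simp [IsSubformula, numeral_eq_iff] at hy
    · refine ⟨hFc.2.1 i k hi hk, fun h => ?_⟩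
      obtain ⟨y, _, hy⟩ := hc _ h
      simp [IsSubformula, numeral_eq_iff] at hy
    · refine ⟨hFc.2.2.1 φ hφ.1, fun h => ?_⟩
      obtain ⟨y, hyb, hy⟩ := hc _ h
      simp only [IsSubformula, opair_inj, numeral_eq_iff] at hy
      simp at hy
      exact hφ.2 (hy ▸ hyb)
    · refine ⟨hFc.2.2.2.1 φ ψ hφ.1 hψ.1, fun h => ?_⟩
      obtain ⟨y, hyb, hy⟩ := hc _ h
      simp only [IsSubformula, opair_inj, numeral_eq_iff] at hy
      simp at hy
      rcases hy with ⟨_, hy | hy⟩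
      · exact hφ.2 (hy.1 ▸ hyb)
      · exact hψ.2 (hy.2 ▸ hyb)
    · refine ⟨hFc.2.2.2.2 i φ hi hφ.1, fun h => ?_⟩
      obtain ⟨y, hyb, hy⟩ := hc _ h
      simp only [IsSubformula, opair_inj, numeral_eq_iff] at hy
      simp at hy
      exact hφ.2 (hy ▸ hyb)
  exact (mem_sep.1 ((hF x).1 (hb x hx) _ hC)).2 hx

theorem isAssignment_iff {A s : M} : IsAssignment A s ↔ IsFun s omega A := by
  simp [IsAssignment, isOmega_iff]

/-- Tarski's clauses: `s` satisfies `φ` in `(A, ∈)`, provided that `p` is the function that maps the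
immediate subformulas of `φ` to the sets of assignments that satisfy them. -/
def TarskiStep (A φ p s : M) : Prop :=
  (∃ i k, IsNat i ∧ IsNat k ∧ φ = opair (numeral 0) (opair i k) ∧ ap s i ∈ₘ ap s k) ∨
  (∃ i k, IsNat i ∧ IsNat k ∧ φ = opair (numeral 1) (opair i k) ∧ ap s i = ap s k) ∨
  (∃ ψ, φ = opair (numeral 2) (opair ψ ψ) ∧ ¬ ∃ X, opair ψ X ∈ₘ p ∧ s ∈ₘ X) ∨
  (∃ ψ χ, φ = opair (numeral 3) (opair ψ χ) ∧ (∃ X, opair ψ X ∈ₘ p ∧ s ∈ₘ X) ∧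
    ∃ X, opair χ X ∈ₘ p ∧ s ∈ₘ X) ∨
  ∃ i ψ, φ = opair (numeral 4) (opair i ψ) ∧ ∃ t, IsAssignment A t ∧
    (∀ k x, IsNat k → k ≠ i → (App s k x ↔ App t k x)) ∧ ∃ X, opair ψ X ∈ₘ p ∧ t ∈ₘ X

/-- Every set has a satisfaction relation in `M`, by recursion along subformulas. -/
theorem exists_isSatRelation (A : M) : ∃ S, IsSatRelation A S := by
  obtain ⟨F, hF⟩ := exists_formulas (M := M)
  have hFc := isFormulaClosed_iff.1 (isFormulaClosed_formulas hF)
  let As : M := sep (pow (prod omega A)) fun s => IsFun s omega A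
  have hAs : ∀ s, s ∈ₘ As ↔ IsFun s omega A := by
    intro s
    rw [mem_sep, mem_pow, and_iff_right_iff_imp]
    intro h p hp
    obtain ⟨x, y, hx, hy, e⟩ := h.1 p hp
    rw [isPair_iff] at e
    exact e ▸ opair_mem_prod.2 ⟨hx, hy⟩
  have hr : Dfn fun v : Fin 2 → M => IsSubformula (v 0) (v 1) := by
    unfold IsSubformula; infer_instance
  have hT : ∀ {n} (a b c : (Fin n → M) → M) [DfnFun a] [DfnFun b] [DfnFun c],
      Dfn fun v => TarskiStep A (a v) (b v) (c v) := by
    intro n a b c _ _ _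
    unfold TarskiStep; infer_instance
  obtain ⟨f, hfa, hf⟩ := exists_recursion (G := fun φ p => sep As (TarskiStep A φ p)) hr
    (inferInstanceAs (DfnFun fun v : Fin 2 → M => sep As (TarskiStep A (v 0) (v 1))))
    (wf_isSubformula hF)
  have hfp : ∀ φ ψ, ψ ∈ₘ F → IsSubformula ψ φ → ∀ s,
      (∃ X, opair ψ X ∈ₘ restrict IsSubformula f φ ∧ s ∈ₘ X) ↔ s ∈ₘ ap f ψ := by
    intro φ ψ hψ h s
    simp only [mem_restrict hr, (hf ψ hψ).1]
    constructor
    · rintro ⟨X, ⟨rfl, _⟩, hs⟩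
      exact hs
    · exact fun hs => ⟨_, ⟨rfl, h⟩, hs⟩
  have hval : ∀ c s, c ∈ₘ F → IsFun s omega A →
      (s ∈ₘ ap f c ↔ TarskiStep A c (restrict IsSubformula f c) s) := by
    intro c s hc hs
    rw [(hf c hc).2, mem_sep, and_iff_right ((hAs s).2 hs)]
  let S : M := sep (prod F As) fun q => ∃ φ s, q = opair φ s ∧ s ∈ₘ ap f φ
  have hS : ∀ φ s, φ ∈ₘ F → IsFun s omega A → (App S φ s ↔ s ∈ₘ ap f φ) := by
    intro φ s hφ hs
    rw [app_iff, mem_sep, opair_mem_prod, and_iff_right ⟨hφ, (hAs s).2 hs⟩]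
    constructor
    · rintro ⟨φ', s', e, h⟩
      obtain ⟨rfl, rfl⟩ := opair_inj.1 e
      exact h
    · exact fun h => ⟨φ, s, rfl, h⟩
  refine ⟨S, fun s hs => ?_⟩
  rw [isAssignment_iff] at hs
  simp only [IsMemCode, IsEqCode, IsNotCode, IsAndCode, IsExCode, isCode_iff, ← hF,
    isAssignment_iff]
  refine ⟨?_, ?_, ?_, ?_, ?_⟩
  · rintro i k c x y hi hk rfl hx hy
    have hc := hFc.1 i k hi hk
    rw [hs.app_iff] at hx hy
    rw [hS _ s hc hs, hval _ s hc hs]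
    simp only [TarskiStep, opair_inj, numeral_eq_iff]
    simp only [hx.2, hy.2]
    simp [hi, hk]
  · rintro i k c x y hi hk rfl hx hy
    have hc := hFc.2.1 i k hi hk
    rw [hs.app_iff] at hx hy
    rw [hS _ s hc hs, hval _ s hc hs]
    simp only [TarskiStep, opair_inj, numeral_eq_iff]
    simp only [hx.2, hy.2]
    simp [hi, hk]
  · rintro φ c hφ rfl
    have hc := hFc.2.2.1 φ hφ
    rw [hS _ s hc hs, hS _ s hφ hs, hval _ s hc hs, ← hfp _ φ hφ (Or.inl rfl)]
    simp only [TarskiStep, opair_inj, numeral_eq_iff]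
    simp
  · rintro φ ψ c hφ hψ rfl
    have hc := hFc.2.2.2.1 φ ψ hφ hψ
    rw [hS _ s hc hs, hS _ s hφ hs, hS _ s hψ hs, hval _ s hc hs,
      ← hfp _ φ hφ (Or.inr (Or.inl ⟨ψ, Or.inl rfl⟩)),
      ← hfp _ ψ hψ (Or.inr (Or.inl ⟨φ, Or.inr rfl⟩))]
    simp only [TarskiStep, opair_inj, numeral_eq_iff]
    simp
  · rintro i φ c hi hφ rfl
    have hc := hFc.2.2.2.2 i φ hi hφ
    have h1 : ∀ t, IsFun t omega A ∧ (∀ k x, IsNat k → k ≠ i → (App s k x ↔ App t k x)) ∧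
        App S φ t ↔ IsFun t omega A ∧ (∀ k x, IsNat k → k ≠ i → (App s k x ↔ App t k x)) ∧
        ∃ X, opair φ X ∈ₘ restrict IsSubformula f (opair (numeral 4) (opair i φ)) ∧ t ∈ₘ X := by
      intro t
      refine and_congr_right fun ht => and_congr_right fun _ => ?_
      rw [hS _ t hφ ht, hfp _ φ hφ (Or.inr (Or.inr ⟨i, rfl⟩))]
    rw [hS _ s hc hs, hval _ s hc hs]
    simp only [h1]
    simp only [TarskiStep, opair_inj, numeral_eq_iff, isAssignment_iff]
    simp

/-- The value of an assignment at `i` can be replaced by `x`. -/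
theorem exists_update {A s i x : M} (hs : IsFun s omega A) (hi : IsNat i) (hx : x ∈ₘ A) :
    ∃ t, IsFun t omega A ∧ ap t i = x ∧
      ∀ k y, k ≠ i → (opair k y ∈ₘ s ↔ opair k y ∈ₘ t) := by
  let t : M := sep (prod omega A) fun p => ∃ k y, p = opair k y ∧
    ((k = i ∧ y = x) ∨ (k ≠ i ∧ opair k y ∈ₘ s))
  have ht : ∀ k y, opair k y ∈ₘ t ↔ (k = i ∧ y = x) ∨ (k ≠ i ∧ opair k y ∈ₘ s) := by
    intro k y
    rw [mem_sep, opair_mem_prod]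
    constructor
    · rintro ⟨_, k', y', e, h⟩
      obtain ⟨rfl, rfl⟩ := opair_inj.1 e
      exact h
    · intro h
      refine ⟨?_, k, y, rfl, h⟩
      rcases h with ⟨rfl, rfl⟩ | ⟨_, h⟩
      · exact ⟨mem_omega.2 hi, hx⟩
      · obtain ⟨h1, rfl⟩ := hs.mem_iff.1 h
        exact ⟨h1, hs.ap_mem h1⟩
  refine ⟨t, isFun_of (fun p hp => mem_prod.1 (mem_sep.1 hp).1) fun k hk => ?_,
    ap_eq ((ht i x).2 (Or.inl ⟨rfl, rfl⟩)) fun z hz => ?_, fun k y hk => ?_⟩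
  · by_cases h : k = i
    · refine ⟨x, (ht _ _).2 (Or.inl ⟨h, rfl⟩), fun y hy => ?_⟩
      simpa [h] using (ht _ _).1 hy
    · refine ⟨ap s k, (ht _ _).2 (Or.inr ⟨h, hs.mem_iff.2 ⟨hk, rfl⟩⟩), fun y hy => ?_⟩
      rcases (ht _ _).1 hy with h1 | h1
      · exact absurd h1.1 h
      · exact (hs.mem_iff.1 h1.2).2
  · rcases (ht _ _).1 hz with h1 | h1
    · exact h1.2
    · exact absurd rfl h1.1
  · rw [ht]
    tauto

theorem exists_assignment {A : M} {a : M} (ha : a ∈ₘ A) :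
    ∀ {n : ℕ} (v : Fin n → M), (∀ i, v i ∈ₘ A) →
      ∃ s, IsFun s omega A ∧ ∀ i : Fin n, ap s (numeral i) = v i
  | 0, _, _ => ⟨lam omega fun _ => a, isFun_lam fun _ _ => ha, fun i => i.elim0⟩
  | n + 1, v, hv => by
    obtain ⟨s, hs, hsv⟩ := exists_assignment ha (fun i : Fin n => v i.castSucc) fun i => hv _
    obtain ⟨t, ht, hti, hts⟩ := exists_update hs (isNat_numeral n) (hv (Fin.last n))
    refine ⟨t, ht, fun i => ?_⟩
    refine Fin.lastCases ?_ (fun i => ?_) i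
    · simpa using hti
    · have hne : (numeral i : M) ≠ numeral n := fun h => i.2.ne (numeral_inj h)
      have h1 := (hts (numeral i) _ hne).1 (hs.mem_iff.2 ⟨mem_omega.2 (isNat_numeral _), rfl⟩)
      rw [← hsv i]
      exact (ht.mem_iff.1 h1).2.symm

/-- Any satisfaction relation of `M` agrees with actual satisfaction on standard formulas. -/
theorem app_code_iff {A S : M} (hS : IsSatRelation A S) (φ : Fm n) (v : Fin n → M)
    (s : M) (hs : IsFun s omega A) (hsv : ∀ i : Fin n, ap s (numeral i) = v i) :
    App S φ.code s ↔ φ.Real A v := by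
  have hnat : ∀ k : ℕ, (numeral k : M) ∈ₘ omega := fun k => mem_omega.2 (isNat_numeral k)
  induction φ generalizing s with
  | mem i k =>
    exact (hS s (isAssignment_iff.2 hs)).1 (numeral i) (numeral k) _ (v i) (v k)
      (isNat_numeral _) (isNat_numeral _) (isCode_iff.2 rfl) (hs.app_iff.2 ⟨hnat i, (hsv i).symm⟩)
      (hs.app_iff.2 ⟨hnat k, (hsv k).symm⟩)
  | eq i k =>
    exact (hS s (isAssignment_iff.2 hs)).2.1 (numeral i) (numeral k) _ (v i) (v k)
      (isNat_numeral _) (isNat_numeral _) (isCode_iff.2 rfl) (hs.app_iff.2 ⟨hnat i, (hsv i).symm⟩)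
      (hs.app_iff.2 ⟨hnat k, (hsv k).symm⟩)
  | neg φ ih =>
    exact ((hS s (isAssignment_iff.2 hs)).2.2.1 _ _ (isFormula_code φ) (isCode_iff.2 rfl)).trans
      (not_congr (ih v s hs hsv))
  | and φ ψ ih ih' =>
    exact ((hS s (isAssignment_iff.2 hs)).2.2.2.1 _ _ _ (isFormula_code φ) (isFormula_code ψ)
      (isCode_iff.2 rfl)).trans (and_congr (ih v s hs hsv) (ih' v s hs hsv))
  | @ex m φ ih =>
    refine ((hS s (isAssignment_iff.2 hs)).2.2.2.2 _ _ _ (isNat_numeral m) (isFormula_code φ)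
      (isCode_iff.2 rfl)).trans ?_
    have hne : ∀ i : Fin m, (numeral i : M) ≠ numeral m := fun i h => i.2.ne (numeral_inj h)
    constructor
    · rintro ⟨t, ht, hst, h⟩
      rw [isAssignment_iff] at ht
      refine ⟨ap t (numeral m), ht.ap_mem (hnat m), (ih _ t ht fun i => ?_).1 h⟩
      refine Fin.lastCases ?_ (fun i => ?_) i
      · simp
      · have h1 := (hst (numeral i) (v i) (isNat_numeral _) (hne i)).1
          (hs.app_iff.2 ⟨hnat i, (hsv i).symm⟩)
        simpa using (ht.app_iff.1 h1).2.symm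
    · rintro ⟨x, hx, h⟩
      obtain ⟨t, ht, hti, hts⟩ := exists_update hs (isNat_numeral m) hx
      refine ⟨t, isAssignment_iff.2 ht, fun k y _ hk => by simpa [app_iff] using hts k y hk,
        (ih _ t ht fun i => ?_).2 h⟩
      refine Fin.lastCases ?_ (fun i => ?_) i
      · simpa using hti
      · have h1 := (hts (numeral i) (v i) (hne i)).1 (hs.mem_iff.2 ⟨hnat i, (hsv i).symm⟩)
        simpa using (ht.mem_iff.1 h1).2.symm

theorem sat_code_iff {A : M} (φ : Fm n) (v : Fin n → M)
    (s : M) (hs : IsFun s omega A) (hsv : ∀ i : Fin n, ap s (numeral i) = v i) :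
    Sat A φ.code s ↔ φ.Real A v := by
  constructor
  · rintro ⟨S, hS, h⟩
    exact (app_code_iff hS φ v s hs hsv).1 h
  · intro h
    obtain ⟨S, hS⟩ := exists_isSatRelation A
    exact ⟨S, hS, (app_code_iff hS φ v s hs hsv).2 h⟩

/-- Elementarity in the sense of `M` entails elementarity for the standard formulas. -/
theorem IsElementaryEmbedding.dfnOver_iff {j A a : M} (hj : IsElementaryEmbedding j A A)
    (ha : a ∈ₘ A) (P : (Fin n → M) → Prop) [hP : DfnOver A P] (v : Fin n → M)
    (hv : ∀ i, v i ∈ₘ A) : P v ↔ P fun i => ap j (v i) := by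
  obtain ⟨φ, hφ⟩ := hP.out
  obtain ⟨s, hs, hsv⟩ := exists_assignment ha v hv
  have hjs : ∀ k, k ∈ₘ omega → ap j (ap s k) ∈ₘ A := fun k hk => hj.1.ap_mem (hs.ap_mem hk)
  have ht : IsFun (lam omega fun k => ap j (ap s k)) omega A := isFun_lam hjs
  rw [← hφ v hv, ← hφ _ fun i => hj.1.ap_mem (hv i), ← sat_code_iff φ v s hs hsv,
    ← sat_code_iff φ (fun i => ap j (v i)) _ ht fun i => ?_]
  · refine hj.2 _ _ _ (isFormula_code φ) (isAssignment_iff.2 hs) (isAssignment_iff.2 ht) ?_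
    intro i x y hx hy
    rw [hs.app_iff] at hx
    rw [hj.1.app_iff] at hy
    rw [app_iff, mem_lam, ← hx.2]
    exact ⟨hx.1, hy.2⟩
  · rw [ap_lam (mem_omega.2 (isNat_numeral _)), hsv]

end Formulas

section Pairing

variable {M : Type*} [Lset.Structure M] [hM : Fact (IsModelZF M)] {n : ℕ}

/-! ### Quine–Rosser pairs -/

open Classical in
/-- The successor operation on the natural numbers, the identity on all other sets. -/
noncomputable def sig (u : M) : M := if IsNat u then succ u else u

theorem eq_sig_iff {w u : M} : w = sig u ↔ (IsNat u ∧ w = succ u) ∨ (¬ IsNat u ∧ w = u) := by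
  unfold sig
  split_ifs with h <;> simp [h]

instance (f : (Fin n → M) → M) [hf : DfnFun f] : DfnFun fun v => sig (f v) := by
  refine DfnFun.comp₁ ⟨?_⟩ f
  exact Dfn.congr (P := fun w : Fin 2 → M =>
    (IsNat (w 0) ∧ w 1 = succ (w 0)) ∨ (¬ IsNat (w 0) ∧ w 1 = w 0))
    (fun w => eq_sig_iff.symm) (by infer_instance)

theorem sig_inj {u u' : M} (h : sig u = sig u') : u = u' := by
  rcases eq_sig_iff.1 h with ⟨h1, h2⟩ | ⟨h1, h2⟩ <;>
    rcases eq_sig_iff.1 (rfl : sig u = sig u) with ⟨h3, h4⟩ | ⟨h3, h4⟩ <;> rw [h4] at h2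
  · exact succ_inj h2
  · exact absurd (h2 ▸ isNat_succ h1) h3
  · exact absurd (h2 ▸ isNat_succ h3) h1
  · exact h2

theorem sig_ne_emp (u : M) : sig u ≠ emp := by
  intro h
  rcases eq_sig_iff.1 h.symm with ⟨_, h2⟩ | ⟨h1, h2⟩
  · exact succ_ne_emp _ h2.symm
  · exact h1 (h2 ▸ isNat_emp)

/-- The elements of `a` shifted by `sig`; the tag of the members of a first coordinate. -/
noncomputable def phi (a : M) : M := image a sig

/-- `phi a` with `0` adjoined; the tag of the members of a second coordinate. -/
noncomputable def psi (a : M) : M := union (phi a) (upair emp emp)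

/-- The Quine–Rosser pair. It exists in every infinite rank: two subsets of a set closed under
`phi` and `psi` have a pair that is again a subset of that set. -/
noncomputable def qpair (x y : M) : M := union (image x phi) (image y psi)

theorem mem_phi {a w : M} : w ∈ₘ phi a ↔ ∃ u, u ∈ₘ a ∧ w = sig u := mem_image

theorem mem_psi {a w : M} : w ∈ₘ psi a ↔ (∃ u, u ∈ₘ a ∧ w = sig u) ∨ w = emp := by
  simp [psi, mem_phi]

instance (f : (Fin n → M) → M) [DfnFun f] : DfnFun fun v => phi (f v) := by
  unfold phi; infer_instance

instance (f : (Fin n → M) → M) [DfnFun f] : DfnFun fun v => psi (f v) := by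
  unfold psi; infer_instance

instance (f g : (Fin n → M) → M) [DfnFun f] [DfnFun g] : DfnFun fun v => qpair (f v) (g v) := by
  unfold qpair; infer_instance

theorem mem_qpair {x y w : M} : w ∈ₘ qpair x y ↔
    (∃ a, a ∈ₘ x ∧ w = phi a) ∨ ∃ b, b ∈ₘ y ∧ w = psi b := by
  simp [qpair, mem_image]

theorem phi_inj {a b : M} (h : phi a = phi b) : a = b := by
  have key : ∀ {a b : M}, phi a = phi b → IsSubset a b := by
    intro a b h u hu
    obtain ⟨u', hu', e⟩ := mem_phi.1 (h ▸ mem_phi.2 ⟨u, hu, rfl⟩)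
    exact sig_inj e ▸ hu'
  exact (key h).antisymm (key h.symm)

theorem psi_inj {a b : M} (h : psi a = psi b) : a = b := by
  have key : ∀ {a b : M}, psi a = psi b → IsSubset a b := by
    intro a b h u hu
    rcases mem_psi.1 (h ▸ mem_psi.2 (Or.inl ⟨u, hu, rfl⟩)) with ⟨u', hu', e⟩ | e
    · exact sig_inj e ▸ hu'
    · exact absurd e (sig_ne_emp u)
  exact (key h).antisymm (key h.symm)

theorem phi_ne_psi (a b : M) : phi a ≠ psi b := by
  intro h
  obtain ⟨u, _, e⟩ := mem_phi.1 (h ▸ mem_psi.2 (Or.inr rfl) : (emp : M) ∈ₘ phi a)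
  exact sig_ne_emp u e.symm

theorem phi_mem_qpair {x y a : M} : phi a ∈ₘ qpair x y ↔ a ∈ₘ x := by
  rw [mem_qpair]
  constructor
  · rintro (⟨b, hb, e⟩ | ⟨b, _, e⟩)
    · exact phi_inj e ▸ hb
    · exact absurd e (phi_ne_psi a b)
  · exact fun h => Or.inl ⟨a, h, rfl⟩

theorem psi_mem_qpair {x y b : M} : psi b ∈ₘ qpair x y ↔ b ∈ₘ y := by
  rw [mem_qpair]
  constructor
  · rintro (⟨a, _, e⟩ | ⟨a, ha, e⟩)
    · exact absurd e.symm (phi_ne_psi a b)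
    · exact psi_inj e ▸ ha
  · exact fun h => Or.inr ⟨b, h, rfl⟩

@[simp] theorem qpair_inj {x y x' y' : M} : qpair x y = qpair x' y' ↔ x = x' ∧ y = y' := by
  refine ⟨fun h => ⟨set_ext fun a => ?_, set_ext fun b => ?_⟩, fun h => by rw [h.1, h.2]⟩
  · rw [← phi_mem_qpair (y := y), h, phi_mem_qpair]
  · rw [← psi_mem_qpair (x := x), h, psi_mem_qpair]

/-- Closure of `v` under the operations that constitute the Quine–Rosser pair. -/
def QClosed (v : M) : Prop := ∀ a, a ∈ₘ v → phi a ∈ₘ v ∧ psi a ∈ₘ v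

theorem QClosed.qpair_subset {v x y : M} (hv : QClosed v) (hx : IsSubset x v)
    (hy : IsSubset y v) : IsSubset (qpair x y) v := by
  intro w hw
  rcases mem_qpair.1 hw with ⟨a, ha, rfl⟩ | ⟨b, hb, rfl⟩
  · exact (hv a (hx a ha)).1
  · exact (hv b (hy b hb)).2

theorem qClosed_pow {v : M} (hv : IsSubset omega v) : QClosed (pow v) := by
  have hsig : ∀ u, u ∈ₘ v → sig u ∈ₘ v := by
    intro u hu
    rcases eq_sig_iff.1 (rfl : sig u = sig u) with ⟨h1, h2⟩ | ⟨h1, h2⟩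
    · rw [h2]
      exact hv _ (mem_omega.2 (isNat_succ h1))
    · rwa [h2]
  intro a ha
  rw [mem_pow] at ha
  simp only [mem_pow]
  constructor
  · intro w hw
    obtain ⟨u, hu, rfl⟩ := mem_phi.1 hw
    exact hsig u (ha u hu)
  · intro w hw
    rcases mem_psi.1 hw with ⟨u, hu, rfl⟩ | rfl
    · exact hsig u (ha u hu)
    · exact hv _ (mem_omega.2 isNat_emp)

/-! ### Notions that are absolute for transitive sets -/

namespace DfnOver

variable {A : M} [hA : Fact (IsTransitive A)] (i k l : Fin n)

instance ne : DfnOver A fun v => v i ≠ v k := DfnOver.not fun v => v i = v k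

instance : DfnOver A fun v => IsSubset (v i) (v k) := by unfold IsSubset; infer_instance

instance : DfnOver A fun v => v i = emp :=
  congr (P := fun v => ∀ x, x ∈ₘ v i → x ≠ x) (fun v _ => by
    rw [← isEmptySet_iff]; simp [IsEmptySet]) (by infer_instance)

instance : DfnOver A fun v => v k = succ (v i) :=
  congr (P := fun v => (∀ z, z ∈ₘ v k → z ∈ₘ v i ∨ z = v i) ∧ (∀ z, z ∈ₘ v i → z ∈ₘ v k) ∧
    v i ∈ₘ v k) (fun v _ => by
      constructor
      · rintro ⟨h1, h2, h3⟩
        refine set_ext fun z => ⟨fun hz => mem_succ.2 (h1 z hz), fun hz => ?_⟩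
        rcases mem_succ.1 hz with hz | rfl
        exacts [h2 z hz, h3]
      · intro h
        simp only [h, mem_succ]
        tauto) (by infer_instance)

instance : DfnOver A fun v => IsOrdinal (v i) := by
  unfold IsOrdinal IsTransitive; infer_instance

instance : DfnOver A fun v => IsNat (v i) :=
  congr (P := fun v => IsOrdinal (v i) ∧ (v i = emp ∨ ∃ z, z ∈ₘ v i ∧ v i = succ z) ∧
      ∀ y, y ∈ₘ v i → y = emp ∨ ∃ z, z ∈ₘ y ∧ y = succ z) (fun v _ => by
    have h : ∀ y : M, (y = emp ∨ ∃ z, z ∈ₘ y ∧ y = succ z) ↔ y = emp ∨ ∃ z, y = succ z :=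
      fun y => or_congr_right (exists_congr fun z =>
        ⟨fun h => h.2, fun h => ⟨h ▸ mem_succ.2 (Or.inr rfl), h⟩⟩)
    simp only [isNat_iff, h, mem_succ]
    refine and_congr_right fun _ => ⟨?_, fun h => ⟨h _ (Or.inr rfl), fun y hy => h y (Or.inl hy)⟩⟩
    rintro ⟨h1, h2⟩ y (hy | rfl)
    exacts [h2 y hy, h1]) (by infer_instance)

instance : DfnOver A fun v => v i = omega :=
  congr (P := fun v => IsOrdinal (v i) ∧ (∀ x, x ∈ₘ v i → IsNat x) ∧ (∃ x, x ∈ₘ v i ∧ x = emp) ∧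
      ∀ x, x ∈ₘ v i → ∃ y, y ∈ₘ v i ∧ y = succ x) (fun v _ => by
    constructor
    · rintro ⟨h1, h2, ⟨_, h3, rfl⟩, h4⟩
      refine set_ext fun x => ⟨fun h => mem_omega.2 (h2 x h), fun h => ?_⟩
      refine nat_induction (P := fun x => x ∈ₘ v i) h3 (fun x _ hx => ?_) (mem_omega.1 h)
      obtain ⟨_, h, rfl⟩ := h4 x hx
      exact h
    · intro h
      rw [h]
      exact ⟨isOrdinal_omega, fun x hx => mem_omega.1 hx, ⟨emp, mem_omega.2 isNat_emp, rfl⟩,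
        fun x hx => ⟨_, mem_omega.2 (isNat_succ (mem_omega.1 hx)), rfl⟩⟩) (by infer_instance)

instance : DfnOver A fun v => v k = sig (v i) :=
  congr (fun _ _ => eq_sig_iff.symm) (by infer_instance)

instance : DfnOver A fun v => v k = phi (v i) :=
  congr (P := fun v => (∀ w, w ∈ₘ v k → ∃ u, u ∈ₘ v i ∧ w = sig u) ∧
      ∀ u, u ∈ₘ v i → ∃ w, w ∈ₘ v k ∧ w = sig u) (fun v _ => by
    constructor
    · rintro ⟨h1, h2⟩
      refine set_ext fun w => ⟨fun h => mem_phi.2 (h1 w h), fun h => ?_⟩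
      obtain ⟨u, hu, rfl⟩ := mem_phi.1 h
      obtain ⟨_, hw, rfl⟩ := h2 u hu
      exact hw
    · intro h
      rw [h]
      exact ⟨fun w hw => mem_phi.1 hw, fun u hu => ⟨_, mem_phi.2 ⟨u, hu, rfl⟩, rfl⟩⟩)
    (by infer_instance)

instance : DfnOver A fun v => v k = psi (v i) :=
  congr (P := fun v => (∀ w, w ∈ₘ v k → (∃ u, u ∈ₘ v i ∧ w = sig u) ∨ w = emp) ∧
      (∀ u, u ∈ₘ v i → ∃ w, w ∈ₘ v k ∧ w = sig u) ∧ ∃ w, w ∈ₘ v k ∧ w = emp) (fun v _ => by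
    constructor
    · rintro ⟨h1, h2, ⟨_, h3, rfl⟩⟩
      refine set_ext fun w => ⟨fun h => mem_psi.2 (h1 w h), fun h => ?_⟩
      rcases mem_psi.1 h with ⟨u, hu, rfl⟩ | rfl
      · obtain ⟨_, hw, rfl⟩ := h2 u hu
        exact hw
      · exact h3
    · intro h
      rw [h]
      exact ⟨fun w hw => mem_psi.1 hw, fun u hu => ⟨_, mem_psi.2 (Or.inl ⟨u, hu, rfl⟩), rfl⟩,
        ⟨_, mem_psi.2 (Or.inr rfl), rfl⟩⟩) (by infer_instance)

instance : DfnOver A fun v => v k = qpair (v i) (v l) :=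
  congr (P := fun v =>
      (∀ w, w ∈ₘ v k → (∃ a, a ∈ₘ v i ∧ w = phi a) ∨ ∃ b, b ∈ₘ v l ∧ w = psi b) ∧
      (∀ a, a ∈ₘ v i → ∃ w, w ∈ₘ v k ∧ w = phi a) ∧
      ∀ b, b ∈ₘ v l → ∃ w, w ∈ₘ v k ∧ w = psi b) (fun v _ => by
    constructor
    · rintro ⟨h1, h2, h3⟩
      refine set_ext fun w => ⟨fun h => mem_qpair.2 (h1 w h), fun h => ?_⟩
      rcases mem_qpair.1 h with ⟨u, hu, rfl⟩ | ⟨u, hu, rfl⟩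
      · obtain ⟨_, hw, rfl⟩ := h2 u hu
        exact hw
      · obtain ⟨_, hw, rfl⟩ := h3 u hu
        exact hw
    · intro h
      rw [h]
      exact ⟨fun w hw => mem_qpair.1 hw,
        fun u hu => ⟨_, mem_qpair.2 (Or.inl ⟨u, hu, rfl⟩), rfl⟩,
        fun u hu => ⟨_, mem_qpair.2 (Or.inr ⟨u, hu, rfl⟩), rfl⟩⟩) (by infer_instance)

instance : DfnOver A fun v => qpair (v i) (v k) ∈ₘ v l :=
  congr (P := fun v => ∃ p, p ∈ₘ v l ∧ p = qpair (v i) (v k)) (fun _ _ => by simp)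
    (by infer_instance)

end DfnOver

/-! ### Elementary embeddings -/

section Embedding

variable {j A : M} (hj : IsElementaryEmbedding j A A)

include hj

theorem IsElementaryEmbedding.iff₁ (P : M → Prop) [DfnOver A fun v : Fin 1 → M => P (v 0)]
    {a : M} (ha : a ∈ₘ A) : P a ↔ P (ap j a) :=
  hj.dfnOver_iff ha (fun v : Fin 1 → M => P (v 0)) ![a] (by simp [*])

theorem IsElementaryEmbedding.iff₂ (P : M → M → Prop)
    [DfnOver A fun v : Fin 2 → M => P (v 0) (v 1)]
    {a b : M} (ha : a ∈ₘ A) (hb : b ∈ₘ A) : P a b ↔ P (ap j a) (ap j b) :=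
  hj.dfnOver_iff ha (fun v : Fin 2 → M => P (v 0) (v 1)) ![a, b]
    (by simp [Fin.forall_fin_succ, *])

theorem IsElementaryEmbedding.iff₃ (P : M → M → M → Prop)
    [DfnOver A fun v : Fin 3 → M => P (v 0) (v 1) (v 2)]
    {a b c : M} (ha : a ∈ₘ A) (hb : b ∈ₘ A) (hc : c ∈ₘ A) :
    P a b c ↔ P (ap j a) (ap j b) (ap j c) :=
  hj.dfnOver_iff ha (fun v : Fin 3 → M => P (v 0) (v 1) (v 2)) ![a, b, c]
    (by simp [Fin.forall_fin_succ, *])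

theorem IsElementaryEmbedding.iff₄ (P : M → M → M → M → Prop)
    [DfnOver A fun v : Fin 4 → M => P (v 0) (v 1) (v 2) (v 3)]
    {a b c d : M} (ha : a ∈ₘ A) (hb : b ∈ₘ A) (hc : c ∈ₘ A) (hd : d ∈ₘ A) :
    P a b c d ↔ P (ap j a) (ap j b) (ap j c) (ap j d) :=
  hj.dfnOver_iff ha (fun v : Fin 4 → M => P (v 0) (v 1) (v 2) (v 3)) ![a, b, c, d]
    (by simp [Fin.forall_fin_succ, *])

theorem IsElementaryEmbedding.iff₅ (P : M → M → M → M → M → Prop)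
    [DfnOver A fun v : Fin 5 → M => P (v 0) (v 1) (v 2) (v 3) (v 4)]
    {a b c d e : M} (ha : a ∈ₘ A) (hb : b ∈ₘ A) (hc : c ∈ₘ A) (hd : d ∈ₘ A) (he : e ∈ₘ A) :
    P a b c d e ↔ P (ap j a) (ap j b) (ap j c) (ap j d) (ap j e) :=
  hj.dfnOver_iff ha (fun v : Fin 5 → M => P (v 0) (v 1) (v 2) (v 3) (v 4)) ![a, b, c, d, e]
    (by simp [Fin.forall_fin_succ, *])

theorem IsElementaryEmbedding.mem_iff {a b : M} (ha : a ∈ₘ A) (hb : b ∈ₘ A) :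
    ap j a ∈ₘ ap j b ↔ a ∈ₘ b := (hj.iff₂ (fun x y => x ∈ₘ y) ha hb).symm

variable [hA : Fact (IsTransitive A)]

theorem IsElementaryEmbedding.subset {a b : M} (ha : a ∈ₘ A) (hb : b ∈ₘ A)
    (h : IsSubset a b) : IsSubset (ap j a) (ap j b) :=
  (hj.iff₂ (fun x y => IsSubset x y) ha hb).1 h

theorem IsElementaryEmbedding.ap_succ {a : M} (ha : a ∈ₘ A) (h : succ a ∈ₘ A) :
    ap j (succ a) = succ (ap j a) :=
  (hj.iff₂ (fun x y => y = succ x) ha h).1 rfl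

end Embedding

end Pairing

section Levels

variable {M : Type*} [Lset.Structure M] [hM : Fact (IsModelZF M)] {n : ℕ}

/-! ### The cumulative hierarchy -/

/-- `f` enumerates the levels `V_β` of the cumulative hierarchy for `β ≤ α`. -/
structure IsHierarchy (f α : M) : Prop where
  ord : IsOrdinal α
  mem_iff : ∀ β, β ∈ₘ succ α → ∀ x, x ∈ₘ ap f β ↔ ∃ γ, γ ∈ₘ β ∧ IsSubset x (ap f γ)

theorem IsVLevel.exists_hierarchy {α v : M} (h : IsVLevel α v) :
    ∃ f, IsHierarchy f α ∧ v = ap f α := by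
  obtain ⟨hα, α', b, f, hα', hf, hv, H⟩ := h
  rw [isSucc_iff] at hα'
  subst hα'
  refine ⟨f, ⟨hα, fun β hβ x => ?_⟩, (hf.app_iff.1 hv).2⟩
  rw [H β _ (hf.app_iff.2 ⟨hβ, rfl⟩) x]
  constructor
  · rintro ⟨γ, w, hγ, hw, hx⟩
    exact ⟨γ, hγ, (hf.app_iff.1 hw).2 ▸ hx⟩
  · rintro ⟨γ, hγ, hx⟩
    exact ⟨γ, _, hγ, hf.app_iff.2 ⟨(isOrdinal_succ hα).trans hβ hγ, rfl⟩, hx⟩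

namespace IsHierarchy

variable {f g α α' β γ x y : M} (hf : IsHierarchy f α)

include hf

theorem trans_succ (hβ : β ∈ₘ succ α) (hγ : γ ∈ₘ β) : γ ∈ₘ succ α :=
  (isOrdinal_succ hf.ord).trans hβ hγ

theorem ord_mem (hβ : β ∈ₘ succ α) : IsOrdinal β := (isOrdinal_succ hf.ord).mem hβ

theorem unique (hg : IsHierarchy g α') : β ∈ₘ succ α → β ∈ₘ succ α' → ap f β = ap g β := by
  intro hβ hβ'
  refine ordinal_induction (P := fun β => β ∈ₘ succ α → β ∈ₘ succ α' → ap f β = ap g β)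
    ?_ (hf.ord_mem hβ) hβ hβ'
  intro β _ ih hβ hβ'
  refine set_ext fun x => ?_
  rw [hf.mem_iff β hβ, hg.mem_iff β hβ']
  refine exists_congr fun γ => and_congr_right fun hγ => ?_
  rw [ih γ hγ (hf.trans_succ hβ hγ) (hg.trans_succ hβ' hγ)]

theorem level_mem (hβ : β ∈ₘ succ α) (hγ : γ ∈ₘ β) : ap f γ ∈ₘ ap f β :=
  (hf.mem_iff β hβ _).2 ⟨γ, hγ, IsSubset.refl _⟩

theorem mem_of_subset (hβ : β ∈ₘ succ α) (hy : y ∈ₘ ap f β) (h : IsSubset x y) :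
    x ∈ₘ ap f β := by
  rw [hf.mem_iff β hβ] at *
  obtain ⟨γ, hγ, hy⟩ := hy
  exact ⟨γ, hγ, h.trans hy⟩

theorem transitive (hβ : β ∈ₘ succ α) : IsTransitive (ap f β) := by
  intro y hy x hx
  obtain ⟨γ, hγ, hy⟩ := (hf.mem_iff β hβ y).1 hy
  obtain ⟨δ, hδ, hx⟩ := (hf.mem_iff γ (hf.trans_succ hβ hγ) x).1 (hy x hx)
  exact (hf.mem_iff β hβ x).2 ⟨δ, (hf.ord_mem hβ).trans hγ hδ, hx⟩

theorem level_subset (hβ : β ∈ₘ succ α) (hγ : γ ∈ₘ β) : IsSubset (ap f γ) (ap f β) :=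
  hf.transitive hβ _ (hf.level_mem hβ hγ)

theorem level_succ (hβ : succ β ∈ₘ succ α) : ap f (succ β) = pow (ap f β) := by
  have hβ' : β ∈ₘ succ α := hf.trans_succ hβ (mem_succ.2 (Or.inr rfl))
  refine set_ext fun x => ?_
  rw [hf.mem_iff _ hβ, mem_pow]
  constructor
  · rintro ⟨γ, hγ, hx⟩
    rcases mem_succ.1 hγ with hγ | rfl
    · exact hx.trans (hf.level_subset hβ' hγ)
    · exact hx
  · exact fun h => ⟨β, mem_succ.2 (Or.inr rfl), h⟩

theorem ordinal_subset (hβ : β ∈ₘ succ α) : IsSubset β (ap f β) := by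
  refine ordinal_induction (P := fun β => β ∈ₘ succ α → IsSubset β (ap f β)) ?_
    (hf.ord_mem hβ) hβ
  intro β _ ih hβ γ hγ
  exact (hf.mem_iff β hβ γ).2 ⟨γ, hγ, ih γ hγ (hf.trans_succ hβ hγ)⟩

theorem ordinal_mem (hβ : β ∈ₘ succ α) {ξ : M} (hξ : IsOrdinal ξ) (h : ξ ∈ₘ ap f β) :
    ξ ∈ₘ β := by
  refine ordinal_induction (P := fun β => β ∈ₘ succ α → ∀ ξ, IsOrdinal ξ → ξ ∈ₘ ap f β → ξ ∈ₘ β)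
    ?_ (hf.ord_mem hβ) hβ ξ hξ h
  intro β hβo ih hβ ξ hξ h
  obtain ⟨γ, hγ, hsub⟩ := (hf.mem_iff β hβ ξ).1 h
  have hγ' := hf.trans_succ hβ hγ
  exact hξ.mem_of_subset_of_mem hβo
    (fun η hη => ih γ hγ hγ' η (hξ.mem hη) (hsub η hη)) hγ

end IsHierarchy

end Levels

section Representation

variable {M : Type*} [Lset.Structure M] [hM : Fact (IsModelZF M)] {n : ℕ}

/-! ### Representing sets by functions and a single seed -/

/-- Every subset of `P(v)` has the form `j(g)(s)`, for one fixed `s ⊆ v`. Here the function `g` from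
`P(v)` to `P(P(v))` is coded by the set of all pairs `(e, a)` with `a ∈ g(e)`. -/
def Represents (j v : M) : Prop :=
  ∃ s, IsSubset s v ∧ ∀ x, IsSubset x (pow v) → ∃ g, IsSubset g (pow v) ∧
    ∀ a, IsSubset a v → (a ∈ₘ x ↔ qpair s a ∈ₘ ap j g)

/-- `b` is the union over `t ∈ v` of the values `e(a ∩ t)`, where `e` is a set of pairs. -/
def IsUnionExt (v e a b : M) : Prop :=
  ∀ u, u ∈ₘ v → (u ∈ₘ b ↔ ∃ t, t ∈ₘ v ∧ ∃ c, c ∈ₘ v ∧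
    (∀ z, z ∈ₘ v → (z ∈ₘ c ↔ z ∈ₘ a ∧ z ∈ₘ t)) ∧ ∃ w, w ∈ₘ v ∧ qpair c w ∈ₘ e ∧ u ∈ₘ w)

/-- `y = {a ∈ p : (e, a) ∈ h}`. -/
def IsFiber (p h e y : M) : Prop := ∀ a, a ∈ₘ p → (a ∈ₘ y ↔ qpair e a ∈ₘ h)

/-- `b = {e ∈ p : h_e ∈ a}`, where `h_e ∈ v` is the fiber of `h` at `e`. -/
def IsFiberPreimage (p v h a b : M) : Prop :=
  ∀ e, e ∈ₘ p → (e ∈ₘ b ↔ ∃ y, y ∈ₘ v ∧ IsFiber p h e y ∧ y ∈ₘ a)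

/-- `y` consists of the `x ∈ v` of the form `k(h)(t)` with `t ∈ k({e : h(e) ∈ a})`. If `k` is the
restriction to `v` of an elementary embedding `j` and `t` is the seed of a representation, then
`y = j(a)`. -/
def IsSeedExt (p v k t a y : M) : Prop :=
  ∀ x, x ∈ₘ v → (x ∈ₘ y ↔ ∃ h, h ∈ₘ v ∧ ∃ h', h' ∈ₘ v ∧ ∃ b, b ∈ₘ v ∧ ∃ b', b' ∈ₘ v ∧
    qpair h h' ∈ₘ k ∧ qpair b b' ∈ₘ k ∧ IsFiber p h' t x ∧ IsFiberPreimage p v h a b ∧ t ∈ₘ b')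

section Dfn

variable (f₁ f₂ f₃ f₄ f₅ f₆ : (Fin n → M) → M)
  [DfnFun f₁] [DfnFun f₂] [DfnFun f₃] [DfnFun f₄] [DfnFun f₅] [DfnFun f₆]

instance : Dfn fun v => Represents (f₁ v) (f₂ v) := by unfold Represents; infer_instance
instance : Dfn fun v => IsUnionExt (f₁ v) (f₂ v) (f₃ v) (f₄ v) := by
  unfold IsUnionExt; infer_instance
instance : Dfn fun v => IsFiber (f₁ v) (f₂ v) (f₃ v) (f₄ v) := by
  unfold IsFiber; infer_instance
instance : Dfn fun v => IsFiberPreimage (f₁ v) (f₂ v) (f₃ v) (f₄ v) (f₅ v) := by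
  unfold IsFiberPreimage; infer_instance
instance : Dfn fun v => IsSeedExt (f₁ v) (f₂ v) (f₃ v) (f₄ v) (f₅ v) (f₆ v) := by
  unfold IsSeedExt; infer_instance

variable {A : M} [hA : Fact (IsTransitive A)] (i₁ i₂ i₃ i₄ i₅ i₆ : Fin n)

instance : DfnOver A fun v => IsUnionExt (v i₁) (v i₂) (v i₃) (v i₄) := by
  unfold IsUnionExt; infer_instance
instance : DfnOver A fun v => IsFiber (v i₁) (v i₂) (v i₃) (v i₄) := by
  unfold IsFiber; infer_instance
instance : DfnOver A fun v => IsFiberPreimage (v i₁) (v i₂) (v i₃) (v i₄) (v i₅) := by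
  unfold IsFiberPreimage; infer_instance
instance : DfnOver A fun v => IsSeedExt (v i₁) (v i₂) (v i₃) (v i₄) (v i₅) (v i₆) := by
  unfold IsSeedExt; infer_instance

end Dfn

theorem pow_transitive {v : M} (hv : IsTransitive v) : IsTransitive (pow v) := by
  intro y hy x hx
  rw [mem_pow] at *
  exact hv x (hy x hx)

theorem subset_pow {v : M} (hv : IsTransitive v) : IsSubset v (pow v) :=
  fun x hx => mem_pow.2 (hv x hx)

/-- The set of pairs `(u, j(u))` for `u ∈ v`. -/
noncomputable def graph (j v : M) : M := image v fun u => qpair u (ap j u)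

theorem mem_graph {j v u w : M} : qpair u w ∈ₘ graph j v ↔ u ∈ₘ v ∧ w = ap j u := by
  rw [graph, mem_image]
  constructor
  · rintro ⟨u', hu, e⟩
    obtain ⟨rfl, rfl⟩ := qpair_inj.1 e
    exact ⟨hu, rfl⟩
  · rintro ⟨hu, rfl⟩
    exact ⟨u, hu, rfl⟩

theorem graph_subset {j v : M} (hq : ∀ u w, u ∈ₘ v → w ∈ₘ v → qpair u w ∈ₘ v)
    (h : ∀ u, u ∈ₘ v → ap j u ∈ₘ v) : IsSubset (graph j v) v := by
  intro p hp
  obtain ⟨u, hu, rfl⟩ := mem_image.1 hp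
  exact hq _ _ hu (h u hu)

/-- A transitive set that contains the subsets of its elements. -/
structure IsSuperTransitive (A : M) : Prop where
  trans : IsTransitive A
  subset : ∀ x y, y ∈ₘ A → IsSubset x y → x ∈ₘ A

variable {j A : M} (hj : IsElementaryEmbedding j A A) (hS : IsSuperTransitive A)

include hj hS

theorem ap_pow {v : M} (hv : v ∈ₘ A) (hp : pow v ∈ₘ A) (h : ap j v = v) :
    ap j (pow v) = pow v := by
  have : Fact (IsTransitive A) := ⟨hS.trans⟩
  have h1 := (hj.iff₂ (fun a p => ∀ y, y ∈ₘ A → (y ∈ₘ p ↔ IsSubset y a)) hv hp).1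
    fun y _ => mem_pow
  rw [h] at h1
  have hjp : ap j (pow v) ∈ₘ A := hj.1.ap_mem hp
  refine set_ext fun y => ⟨fun hy => ?_, fun hy => ?_⟩
  · exact mem_pow.2 ((h1 y (hS.trans _ hjp y hy)).1 hy)
  · exact (h1 y (hS.trans _ hp y hy)).2 (mem_pow.1 hy)

/-- At a limit level `v` fixed by `j` the seed is the graph of `j` on `v`. It determines `j` on the
subsets `a` of `v`, since `j(a)` is the union of the sets `j(a ∩ t)` for `t ∈ v`. -/
theorem represents_of_limit {v : M} (hp : pow (pow v) ∈ₘ A)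
    (hjv : ap j v = v) (hv' : ∀ x y, y ∈ₘ v → IsSubset x y → x ∈ₘ v)
    (hqc : QClosed v) (hq : ∀ u w, u ∈ₘ v → w ∈ₘ v → qpair u w ∈ₘ v)
    (hlim : ∀ u, u ∈ₘ v → ∃ t, t ∈ₘ v ∧ u ∈ₘ ap j t) : Represents j v := by
  have : Fact (IsTransitive A) := ⟨hS.trans⟩
  have hpA : pow v ∈ₘ A := hS.trans _ hp _ (mem_pow.2 (IsSubset.refl _))
  have hvA : v ∈ₘ A := hS.trans _ hpA _ (mem_pow.2 (IsSubset.refl _))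
  have hjp := ap_pow hj hS hvA hpA hjv
  have hvA' : ∀ {u}, u ∈ₘ v → u ∈ₘ A := fun hu => hS.trans _ hvA _ hu
  have hpA' : ∀ {u}, IsSubset u v → u ∈ₘ A := fun hu => hS.trans _ hpA _ (mem_pow.2 hu)
  have hju : ∀ u, u ∈ₘ v → ap j u ∈ₘ v := fun u hu => by
    have := (hj.mem_iff (hvA' hu) hvA).2 hu
    rwa [hjv] at this
  refine ⟨graph j v, graph_subset hq hju, fun x hx => ?_⟩
  have hxA : x ∈ₘ A := hS.trans _ hp _ (mem_pow.2 hx)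
  let g : M := sep (pow v) fun p => ∃ e a, p = qpair e a ∧ ∃ b, b ∈ₘ x ∧ IsUnionExt v e a b
  have hg : IsSubset g (pow v) := sep_subset
  have hgA : g ∈ₘ A := hS.trans _ hp _ (mem_pow.2 hg)
  have hgm : ∀ e, e ∈ₘ pow v → ∀ a, a ∈ₘ pow v →
      (qpair e a ∈ₘ g ↔ ∃ b, b ∈ₘ x ∧ IsUnionExt v e a b) := by
    intro e he a ha
    rw [mem_sep, mem_pow, and_iff_right (hqc.qpair_subset (mem_pow.1 he) (mem_pow.1 ha))]
    constructor
    · rintro ⟨e', a', h, h'⟩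
      obtain ⟨rfl, rfl⟩ := qpair_inj.1 h
      exact h'
    · exact fun h => ⟨e, a, rfl, h⟩
  refine ⟨g, hg, fun a ha => ?_⟩
  have key := (hj.iff₄ (fun v p g x => ∀ e, e ∈ₘ p → ∀ a, a ∈ₘ p →
      (qpair e a ∈ₘ g ↔ ∃ b, b ∈ₘ x ∧ IsUnionExt v e a b)) hvA hpA hgA hxA).1 hgm
  simp only [hjv, hjp] at key
  rw [key _ (mem_pow.2 (graph_subset hq hju)) a (mem_pow.2 ha), ← hj.mem_iff (hpA' ha) hxA]
  have hjx : IsSubset (ap j x) (pow v) := by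
    have := hj.subset hxA hpA hx
    rwa [hjp] at this
  have hja : IsSubset (ap j a) v := by
    have := hj.subset (hpA' ha) hvA ha
    rwa [hjv] at this
  -- the embedding is recovered from its restriction to `v` by `j(a) = ⋃_t j(a ∩ t)`
  have hext : ∀ u, u ∈ₘ v → (u ∈ₘ ap j a ↔ ∃ t, t ∈ₘ v ∧ ∃ c, c ∈ₘ v ∧
      (∀ z, z ∈ₘ v → (z ∈ₘ c ↔ z ∈ₘ a ∧ z ∈ₘ t)) ∧
      ∃ w, w ∈ₘ v ∧ qpair c w ∈ₘ graph j v ∧ u ∈ₘ w) := by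
    intro u hu
    have hinter : ∀ t, t ∈ₘ v → ∀ c, c ∈ₘ v → (∀ z, z ∈ₘ v → (z ∈ₘ c ↔ z ∈ₘ a ∧ z ∈ₘ t)) →
        (u ∈ₘ ap j c ↔ u ∈ₘ ap j a ∧ u ∈ₘ ap j t) := by
      intro t ht c hc h
      have := (hj.iff₄ (fun v a c t => ∀ z, z ∈ₘ v → (z ∈ₘ c ↔ z ∈ₘ a ∧ z ∈ₘ t))
        hvA (hpA' ha) (hvA' hc) (hvA' ht)).1 h
      rw [hjv] at this
      exact this u hu
    constructor
    · intro h
      obtain ⟨t, ht, hut⟩ := hlim u hu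
      have hc : sep t (fun z => z ∈ₘ a) ∈ₘ v := hv' _ t ht sep_subset
      have hc' : ∀ z, z ∈ₘ v → (z ∈ₘ sep t (fun z => z ∈ₘ a) ↔ z ∈ₘ a ∧ z ∈ₘ t) :=
        fun z _ => by rw [mem_sep, and_comm]
      exact ⟨t, ht, _, hc, hc', _, hju _ hc, mem_graph.2 ⟨hc, rfl⟩,
        (hinter t ht _ hc hc').2 ⟨h, hut⟩⟩
    · rintro ⟨t, ht, c, hc, hc', w, hw, hcw, huw⟩
      rw [(mem_graph.1 hcw).2] at huw
      exact ((hinter t ht c hc hc').1 huw).1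
  constructor
  · exact fun h => ⟨_, h, hext⟩
  · rintro ⟨b, hb, hb'⟩
    have : b = ap j a := by
      refine set_ext fun u => ⟨fun hu => ?_, fun hu => ?_⟩
      · have huv := mem_pow.1 (hjx b hb) u hu
        exact (hext u huv).2 ((hb' u huv).1 hu)
      · have huv := hja u hu
        exact (hb' u huv).2 ((hext u huv).1 hu)
    exact this ▸ hb

/-- Representability passes from `v` to `P(P(v))`. With `u = P(P(v))`, the new seed consists of the
graph of `j` on `u` and the old seed `s`. It determines `j` on the subsets `a` of `u`: an element
`j(h)(s)` of `u` belongs to `j(a)` if and only if `s ∈ j({e | h(e) ∈ a})`. -/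
theorem Represents.pow_pow {v : M} (hp : pow (pow (pow (pow v))) ∈ₘ A)
    (hjv : ap j v = v) (hv : IsTransitive v) (hω : IsSubset omega v) (hR : Represents j v) :
    Represents j (pow (pow v)) := by
  have : Fact (IsTransitive A) := ⟨hS.trans⟩
  obtain ⟨s, hs, hR⟩ := hR
  have down : ∀ {w}, pow w ∈ₘ A → w ∈ₘ A :=
    fun h => hS.trans _ h _ (mem_pow.2 (IsSubset.refl _))
  have htp := pow_transitive hv
  have hqp : QClosed (pow v) := qClosed_pow hω
  have hωp : IsSubset omega (pow v) := hω.trans (subset_pow hv)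
  have hA3 := down hp
  have hA2 := down hA3
  have hA1 := down hA2
  have hA0 := down hA1
  have hj1 := ap_pow hj hS hA0 hA1 hjv
  have hj2 := ap_pow hj hS hA1 hA2 hj1
  have hj3 := ap_pow hj hS hA2 hA3 hj2
  -- `p = P(v)` and `u = P(P(v))`
  set p := pow v with hpdef
  set u := pow p with hudef
  have hqu : QClosed u := qClosed_pow hωp
  have huA : ∀ {x}, x ∈ₘ u → x ∈ₘ A := fun h => hS.trans _ hA2 _ h
  have hpuA : ∀ {x}, IsSubset x u → x ∈ₘ A := fun h => hS.trans _ hA3 _ (mem_pow.2 h)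
  have hsp : s ∈ₘ p := mem_pow.2 hs
  have hju : ∀ x, x ∈ₘ u → ap j x ∈ₘ u := fun x hx => by
    have := (hj.mem_iff (huA hx) hA2).2 hx
    rwa [hj2] at this
  have hpu : IsSubset p u := subset_pow htp
  have hsu : IsSubset s u := hs.trans ((subset_pow hv).trans hpu)
  have hG : IsSubset (graph j u) u := graph_subset
    (fun x y hx hy => mem_pow.2 (hqp.qpair_subset (mem_pow.1 hx) (mem_pow.1 hy))) hju
  refine ⟨qpair (graph j u) s, hqu.qpair_subset hG hsu, fun x hx => ?_⟩
  have hxA : x ∈ₘ A := hS.trans _ hp _ (mem_pow.2 hx)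
  let g : M := sep (pow u) fun q => ∃ k t a, q = qpair (qpair k t) a ∧
    ∃ y, y ∈ₘ x ∧ IsSeedExt p u k t a y
  have hg : IsSubset g (pow u) := sep_subset
  have hgA : g ∈ₘ A := hS.trans _ hp _ (mem_pow.2 hg)
  have hgm : ∀ k, k ∈ₘ pow u → ∀ t, t ∈ₘ p → ∀ a, a ∈ₘ pow u → ∀ e, e ∈ₘ pow u →
      e = qpair k t → (qpair e a ∈ₘ g ↔ ∃ y, y ∈ₘ x ∧ IsSeedExt p u k t a y) := by
    rintro k hk t ht a ha e he rfl
    rw [mem_sep, mem_pow, and_iff_right (hqu.qpair_subset (mem_pow.1 he) (mem_pow.1 ha))]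
    constructor
    · rintro ⟨k', t', a', h, h'⟩
      obtain ⟨h1, rfl⟩ := qpair_inj.1 h
      obtain ⟨rfl, rfl⟩ := qpair_inj.1 h1
      exact h'
    · exact fun h => ⟨k, t, a, rfl, h⟩
  refine ⟨g, hg, fun a ha => ?_⟩
  have haA := hpuA ha
  have key := (hj.iff₅ (fun p u w g x => ∀ k, k ∈ₘ w → ∀ t, t ∈ₘ p → ∀ a, a ∈ₘ w →
      ∀ e, e ∈ₘ w → e = qpair k t → (qpair e a ∈ₘ g ↔ ∃ y, y ∈ₘ x ∧ IsSeedExt p u k t a y))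
    hA1 hA2 hA3 hgA hxA).1 hgm
  simp only [hj1, hj2, hj3] at key
  rw [key _ (mem_pow.2 hG) s hsp a (mem_pow.2 ha) _ (mem_pow.2 (hqu.qpair_subset hG hsu)) rfl,
    ← hj.mem_iff haA hxA]
  have hjx : IsSubset (ap j x) (pow u) := by
    have := hj.subset hxA hA3 hx
    rwa [hj3] at this
  have hja : IsSubset (ap j a) u := by
    have := hj.subset haA hA2 ha
    rwa [hj2] at this
  have hext : IsSeedExt p u (graph j u) s a (ap j a) := by
    intro z hz
    have hpre : ∀ h, h ∈ₘ u → ∀ b, b ∈ₘ u → IsFiber p (ap j h) s z →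
        IsFiberPreimage p u h a b → (s ∈ₘ ap j b ↔ z ∈ₘ ap j a) := by
      intro h hh b hb hz' hpre
      have := (hj.iff₅ (fun p u h a b => IsFiberPreimage p u h a b)
        hA1 hA2 (huA hh) haA (huA hb)).1 hpre
      rw [hj1, hj2] at this
      rw [this s hsp]
      constructor
      · rintro ⟨y, hy, hy', hya⟩
        have : y = z := by
          refine set_ext fun c => ⟨fun hc => ?_, fun hc => ?_⟩
          · have hcp := mem_pow.1 hy c hc
            exact (hz' c hcp).2 ((hy' c hcp).1 hc)
          · have hcp := mem_pow.1 hz c hc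
            exact (hy' c hcp).2 ((hz' c hcp).1 hc)
        exact this ▸ hya
      · exact fun hza => ⟨z, hz, hz', hza⟩
    constructor
    · intro hza
      obtain ⟨h, hh, hfib⟩ := hR z (mem_pow.1 hz)
      have hh := mem_pow.2 hh
      let b : M := sep p fun e => ∃ y, y ∈ₘ u ∧ IsFiber p h e y ∧ y ∈ₘ a
      have hb : b ∈ₘ u := mem_pow.2 sep_subset
      have hb' : IsFiberPreimage p u h a b := fun e he => by
        rw [mem_sep, and_iff_right he]
      have hz' : IsFiber p (ap j h) s z := fun c hc => hfib c (mem_pow.1 hc)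
      exact ⟨h, hh, _, hju h hh, b, hb, _, hju b hb, mem_graph.2 ⟨hh, rfl⟩,
        mem_graph.2 ⟨hb, rfl⟩, hz', hb', (hpre h hh b hb hz' hb').2 hza⟩
    · rintro ⟨h, hh, h', _, b, hb, b', _, hhk, hbk, hz', hb', hsb⟩
      rw [(mem_graph.1 hhk).2] at hz'
      rw [(mem_graph.1 hbk).2] at hsb
      exact (hpre h hh b hb hz' hb').1 hsb
  constructor
  · exact fun h => ⟨_, h, hext⟩
  · rintro ⟨y, hy, hy'⟩
    have : y = ap j a := by
      refine set_ext fun c => ⟨fun hc => ?_, fun hc => ?_⟩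
      · have hcu := mem_pow.1 (hjx y hy) c hc
        exact (hext c hcu).2 ((hy' c hcu).1 hc)
      · have hcu := hja c hc
        exact (hy' c hcu).2 ((hext c hcu).1 hc)
    exact this ▸ hy

end Representation

section Setup

variable {M : Type*} [Lset.Structure M] [hM : Fact (IsModelZF M)] {n : ℕ}

/-! ### Embeddings of an even level plus three -/

/-- The properties of an elementary embedding `j` of `A = V_{ε+3}` with critical point `κ`, for even
`ε`, on which the counting of regular cardinals is based. Here `V₁ = V_{ε+1}` and
`V₂ = V_{ε+2}`. -/
structure IsEvenEmbedding (j A V₁ V₂ κ : M) : Prop where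
  emb : IsElementaryEmbedding j A A
  super : IsSuperTransitive A
  pow₁ : pow V₁ = V₂
  pow₂ : pow V₂ = A
  super₂ : IsSuperTransitive V₂
  closed₁ : QClosed V₁
  omega_subset : IsSubset omega V₁
  fix₁ : ap j V₁ = V₁
  fix₂ : ap j V₂ = V₂
  ord : IsOrdinal κ
  crit_mem : κ ∈ₘ A
  crit : κ ∈ₘ ap j κ
  fix : ∀ β, β ∈ₘ κ → ap j β = β
  seed : ∃ s, s ∈ₘ V₁ ∧ ∀ x, x ∈ₘ V₂ → ∃ g, g ∈ₘ V₂ ∧ IsFiber V₁ (ap j g) s x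

theorem IsLimit.succ_mem {l β : M} (hl : IsLimit l) (hβ : β ∈ₘ l) : succ β ∈ₘ l := by
  rcases ordinal_trichotomy (isOrdinal_succ (hl.1.mem hβ)) hl.1 with h | h | h
  · exact h
  · exact absurd (isSucc_iff.2 h.symm) (hl.2 β)
  · rcases mem_succ.1 h with h | h
    · exact absurd h (not_mem_of_mem hβ)
    · exact absurd hβ (h ▸ not_mem_self _)

variable {j A : M} (hj : IsElementaryEmbedding j A A) (hS : IsSuperTransitive A)

include hj hS

/-- `w` is the largest element of its power set, so it is fixed if its power set is. -/
theorem ap_of_ap_pow {w : M} (hp : pow w ∈ₘ A) (h : ap j (pow w) = pow w) : ap j w = w := by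
  have : Fact (IsTransitive A) := ⟨hS.trans⟩
  have hw := hS.trans _ hp w (mem_pow.2 (IsSubset.refl _))
  obtain ⟨h1, h2⟩ := (hj.iff₂ (fun w p => w ∈ₘ p ∧ ∀ y, y ∈ₘ p → IsSubset y w) hw hp).1
    ⟨mem_pow.2 (IsSubset.refl _), fun y hy => mem_pow.1 hy⟩
  rw [h] at h1 h2
  exact (mem_pow.1 h1).antisymm (h2 w (mem_pow.2 (IsSubset.refl _)))

theorem ap_emp (h : emp ∈ₘ A) : ap j emp = emp := by
  have : Fact (IsTransitive A) := ⟨hS.trans⟩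
  exact (hj.iff₁ (fun x => x = emp) h).1 rfl

theorem mem_ap_crit {κ : M} (hκ : IsCriticalPoint j A κ) :
    κ ∈ₘ ap j κ ∧ ∀ β, β ∈ₘ κ → ap j β = β := by
  have : Fact (IsTransitive A) := ⟨hS.trans⟩
  obtain ⟨ho, hκA, hne, hfix⟩ := hκ
  have hfix' : ∀ β, β ∈ₘ κ → ap j β = β := fun β hβ =>
    ((hj.1.app_iff.1 (hfix β hβ (hS.trans _ hκA _ hβ))).2).symm
  refine ⟨?_, hfix'⟩
  have ho' : IsOrdinal (ap j κ) := (hj.iff₁ (fun x => IsOrdinal x) hκA).1 ho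
  have hsub : IsSubset κ (ap j κ) := fun β hβ => by
    have := (hj.mem_iff (hS.trans _ hκA _ hβ) hκA).2 hβ
    rwa [hfix' β hβ] at this
  rcases ordinal_trichotomy ho ho' with h | h | h
  · exact h
  · exact absurd (hj.1.app_iff.2 ⟨hκA, h⟩) hne
  · exact absurd (hsub _ h) (not_mem_self _)

/-- The critical point is a limit ordinal above `ω`. -/
theorem crit_isLimit {κ : M} (hκ : IsCriticalPoint j A κ) : IsLimit κ ∧ omega ∈ₘ κ := by
  have : Fact (IsTransitive A) := ⟨hS.trans⟩
  obtain ⟨hmem, hfix⟩ := mem_ap_crit hj hS hκ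
  have hκA := hκ.2.1
  have hne : ap j κ ≠ κ := fun h => not_mem_self κ (by rwa [h] at hmem)
  have hsucc : ∀ β, κ ≠ succ β := by
    rintro β rfl
    have hβ : β ∈ₘ succ β := mem_succ.2 (Or.inr rfl)
    rw [hj.ap_succ (hS.trans _ hκA _ hβ) hκA, hfix β hβ] at hne
    exact hne rfl
  refine ⟨⟨hκ.1, fun y hy => hsucc y (isSucc_iff.1 hy)⟩, ?_⟩
  rcases ordinal_trichotomy isOrdinal_omega hκ.1 with h | h | h
  · exact h
  · exact absurd ((hj.iff₁ (fun x => x = omega) hκA).1 h.symm) (by rw [h]; exact hne)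
  · rcases (mem_omega.1 h).cases with rfl | ⟨l, _, rfl⟩
    · exact absurd (ap_emp hj hS hκA) hne
    · exact absurd rfl (hsucc l)

/-- Every level of the hierarchy is a subset of its image. -/
theorem level_subset_ap {f α β : M} (hf : IsHierarchy f α) (hA : A = ap f α) (hβ : β ∈ₘ α) :
    IsSubset (ap f β) (ap j (ap f β)) := by
  have : Fact (IsTransitive A) := ⟨hS.trans⟩
  have hα : α ∈ₘ succ α := mem_succ.2 (Or.inr rfl)
  have hβA : ∀ β, β ∈ₘ α → ap f β ∈ₘ A := fun β hβ => hA ▸ hf.level_mem hα hβ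
  refine ordinal_induction (P := fun β => β ∈ₘ α → IsSubset (ap f β) (ap j (ap f β))) ?_
    (hf.ord.mem hβ) hβ
  intro β _ ih hβ u hu
  have hβ' : β ∈ₘ succ α := mem_succ.2 (Or.inl hβ)
  obtain ⟨γ, hγ, hsub⟩ := (hf.mem_iff β hβ' u).1 hu
  have hγα := hf.ord.trans hβ hγ
  have h1 := (hj.iff₁ (fun x => ∀ t, t ∈ₘ x → ∀ u, u ∈ₘ A → IsSubset u t → u ∈ₘ x)
    (hβA β hβ)).1 fun t ht u _ hu => hf.mem_of_subset hβ' ht hu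
  exact h1 _ ((hj.mem_iff (hβA γ hγα) (hβA β hβ)).2 (hf.level_mem hβ' hγ)) u
    (hS.trans _ (hβA β hβ) _ hu) (hsub.trans (ih γ hγ hγα))

theorem represents_limit_level {f α l : M} (hf : IsHierarchy f α) (hA : A = ap f α)
    (hl : IsLimit l) (hω : omega ∈ₘ l) (hlα : l ∈ₘ α) (hp : pow (pow (ap f l)) ∈ₘ A)
    (hfix : ap j (ap f l) = ap f l) : Represents j (ap f l) := by
  have hl' : l ∈ₘ succ α := mem_succ.2 (Or.inl hlα)
  have hmono : ∀ β, β ∈ₘ l → ∀ γ, γ ∈ₘ l → IsSubset γ β → IsSubset (ap f γ) (ap f β) := by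
    intro β hβ γ hγ h
    rcases ordinal_trichotomy (hl.1.mem hβ) (hl.1.mem hγ) with h1 | rfl | h1
    · exact absurd (h _ h1) (not_mem_self _)
    · exact IsSubset.refl _
    · exact hf.level_subset (hf.trans_succ hl' hβ) h1
  have hmax : ∀ β, β ∈ₘ l → ∀ γ, γ ∈ₘ l → ∃ δ, δ ∈ₘ l ∧ IsSubset β δ ∧ IsSubset γ δ := by
    intro β hβ γ hγ
    rcases (hl.1.mem hβ).mem_or_subset (hl.1.mem hγ) with h | h
    · exact ⟨β, hβ, IsSubset.refl _, (hl.1.mem hβ).1 _ h⟩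
    · exact ⟨γ, hγ, h, IsSubset.refl _⟩
  -- any two elements of `V_l` are subsets of some infinite `V_β` with `β < l`
  have hcof : ∀ u w, u ∈ₘ ap f l → w ∈ₘ ap f l → ∃ β, β ∈ₘ l ∧ IsSubset omega (ap f β) ∧
      IsSubset u (ap f β) ∧ IsSubset w (ap f β) := by
    intro u w hu hw
    obtain ⟨β, hβ, hu⟩ := (hf.mem_iff l hl' u).1 hu
    obtain ⟨γ, hγ, hw⟩ := (hf.mem_iff l hl' w).1 hw
    obtain ⟨δ, hδ, h1, h2⟩ := hmax β hβ γ hγ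
    obtain ⟨η, hη, h3, h4⟩ := hmax δ hδ omega hω
    exact ⟨η, hη, h4.trans (hf.ordinal_subset (hf.trans_succ hl' hη)),
      hu.trans (hmono η hη β hβ (h1.trans h3)), hw.trans (hmono η hη γ hγ (h2.trans h3))⟩
  have hpow : ∀ β, β ∈ₘ l → ap f (succ β) = pow (ap f β) := fun β hβ =>
    hf.level_succ (hf.trans_succ hl' (hl.succ_mem hβ))
  refine represents_of_limit hj hS hp hfix
    (fun x y hy hx => hf.mem_of_subset hl' hy hx) ?_ ?_ ?_
  · intro a ha
    obtain ⟨β, hβ, h1, h2, _⟩ := hcof a a ha ha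
    have := qClosed_pow h1 a (mem_pow.2 h2)
    simp only [mem_pow] at this
    exact ⟨(hf.mem_iff l hl' _).2 ⟨β, hβ, this.1⟩, (hf.mem_iff l hl' _).2 ⟨β, hβ, this.2⟩⟩
  · intro u w hu hw
    obtain ⟨β, hβ, h1, h2, h3⟩ := hcof u w hu hw
    refine (hf.mem_iff l hl' _).2 ⟨succ β, hl.succ_mem hβ, ?_⟩
    have ht := subset_pow (hf.transitive (hf.trans_succ hl' hβ))
    rw [hpow β hβ]
    exact (qClosed_pow h1).qpair_subset (h2.trans ht) (h3.trans ht)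
  · intro u hu
    obtain ⟨β, hβ, h⟩ := (hf.mem_iff l hl' u).1 hu
    have hsβ := hl.succ_mem hβ
    refine ⟨ap f (succ β), hf.level_mem hl' hsβ,
      level_subset_ap hj hS hf hA (hf.ord.trans hlα hsβ) u ?_⟩
    rw [hpow β hβ, mem_pow]
    exact h

omit hS in
/-- The evenness of `ε` enters through an induction along `l, l + 2, …, ε`, where `l` is the limit
ordinal below `ε`. All levels on this list are fixed, and the seed of `V_l` is transferred to
`V_ε` in steps of two power sets. -/
theorem isEvenEmbedding {f ε κ : M} (hf : IsHierarchy f (succ (succ (succ ε))))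
    (hA : A = ap f (succ (succ (succ ε)))) (hε : IsEven ε) (hκ : IsCriticalPoint j A κ) :
    IsEvenEmbedding j A (ap f (succ ε)) (ap f (succ (succ ε))) κ := by
  set ε₃ := succ (succ (succ ε)) with hε₃
  have h3 : ε₃ ∈ₘ succ ε₃ := mem_succ.2 (Or.inr rfl)
  have h2 : succ (succ ε) ∈ₘ ε₃ := mem_succ.2 (Or.inr rfl)
  have h1 : succ ε ∈ₘ ε₃ := mem_succ.2 (Or.inl (mem_succ.2 (Or.inr rfl)))
  have h0 : ε ∈ₘ ε₃ := mem_succ.2 (Or.inl (mem_succ.2 (Or.inl (mem_succ.2 (Or.inr rfl)))))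
  have up : ∀ {β}, β ∈ₘ ε₃ → β ∈ₘ succ ε₃ := fun h => mem_succ.2 (Or.inl h)
  have hS : IsSuperTransitive A :=
    ⟨hA ▸ hf.transitive h3, fun x y hy hx => by rw [hA] at *; exact hf.mem_of_subset h3 hy hx⟩
  have hp2 : pow (ap f (succ (succ ε))) = A := by rw [hA]; exact (hf.level_succ h3).symm
  have hp1 : pow (ap f (succ ε)) = ap f (succ (succ ε)) := (hf.level_succ (up h2)).symm
  have hp0 : pow (ap f ε) = ap f (succ ε) := (hf.level_succ (up h1)).symm
  have hV2 : ap f (succ (succ ε)) ∈ₘ A := hA ▸ hf.level_mem h3 h2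
  have hV1 : ap f (succ ε) ∈ₘ A := hA ▸ hf.level_mem h3 h1
  have : Fact (IsTransitive A) := ⟨hS.trans⟩
  obtain ⟨hcrit, hfix⟩ := mem_ap_crit hj hS hκ
  obtain ⟨hlim, hωκ⟩ := crit_isLimit hj hS hκ
  have hfix2 : ap j (ap f (succ (succ ε))) = ap f (succ (succ ε)) := by
    have h := (hj.iff₁ (fun x => ∀ y, y ∈ₘ A → IsSubset y x) hV2).1 fun y hy => by
      rw [← hp2] at hy; exact mem_pow.1 hy
    refine IsSubset.antisymm ?_ (h _ hV2)
    have := hj.1.ap_mem hV2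
    rw [← hp2] at this
    exact mem_pow.1 this
  have hfix1 : ap j (ap f (succ ε)) = ap f (succ ε) :=
    ap_of_ap_pow hj hS (by rwa [hp1]) (by rwa [hp1])
  have hfix0 : ap j (ap f ε) = ap f ε := ap_of_ap_pow hj hS (by rwa [hp0]) (by rwa [hp0])
  -- `F k` is the `k`-th ordinal in the list `l, l + 2, …, ε`
  obtain ⟨l, m, m', b, F, z, hl, hm, hm', hF, hz, hFz, hFm, hstep⟩ := hε
  rw [isSucc_iff] at hm'
  subst hm'
  rw [isEmptySet_iff] at hz
  subst hz
  rw [hF.app_iff] at hFz hFm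
  have hmo := isOrdinal_succ hm.1
  have hFs : ∀ k, succ k ∈ₘ succ m → ap F (succ k) = succ (succ (ap F k)) := by
    intro k hk
    have hk' : k ∈ₘ succ m := hmo.trans hk (mem_succ.2 (Or.inr rfl))
    have hkm : k ∈ₘ m := by
      rcases mem_succ.1 hk with h | h
      · exact hm.1.trans h (mem_succ.2 (Or.inr rfl))
      · exact h ▸ mem_succ.2 (Or.inr rfl)
    have := hstep k (succ k) _ _ hkm (isSucc_iff.2 rfl) (hF.app_iff.2 ⟨hk', rfl⟩)
      (hF.app_iff.2 ⟨hk, rfl⟩)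
    simpa [IsPlus, isSucc_iff] using this
  have pred : ∀ {k}, succ k ∈ₘ succ m → k ∈ₘ succ m :=
    fun hk => hmo.trans hk (mem_succ.2 (Or.inr rfl))
  have hF0 : ap F emp = l := hFz.2.symm
  have hFm' : ap F m = ε := hFm.2.symm
  have hmm : m ∈ₘ succ m := hFm.1
  have nat_of : ∀ {k}, k ∈ₘ succ m → IsNat k := by
    intro k hk
    rcases mem_succ.1 hk with h | rfl
    exacts [hm.mem h, hm]
  have hFord : ∀ k, k ∈ₘ succ m → IsOrdinal (ap F k) ∧ (ap F k = l ∨ l ∈ₘ ap F k) := by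
    intro k hk
    refine nat_induction (P := fun k => k ∈ₘ succ m → IsOrdinal (ap F k) ∧
      (ap F k = l ∨ l ∈ₘ ap F k)) (fun _ => ?_) (fun k _ ih hk => ?_) (nat_of hk) hk
    · rw [hF0]
      exact ⟨hl.1, Or.inl rfl⟩
    · rw [hFs k hk]
      obtain ⟨ho, h⟩ := ih (pred hk)
      refine ⟨isOrdinal_succ (isOrdinal_succ ho), Or.inr ?_⟩
      simp only [mem_succ]
      rcases h with h | h
      · exact Or.inl (Or.inr h.symm)
      · exact Or.inl (Or.inl h)
  have hFlt : ∀ i, i ∈ₘ succ m → ∀ k, k ∈ₘ i → ap F k ∈ₘ ap F i := by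
    intro i hi
    refine nat_induction (P := fun i => i ∈ₘ succ m → ∀ k, k ∈ₘ i → ap F k ∈ₘ ap F i)
      (fun _ k hk => absurd hk (not_mem_emp k)) (fun i _ ih hi k hk => ?_) (nat_of hi) hi
    rw [hFs i hi]
    simp only [mem_succ]
    rcases mem_succ.1 hk with h | rfl
    · exact Or.inl (Or.inl (ih (pred hi) k h))
    · exact Or.inl (Or.inr rfl)
  have hFle : ∀ k, k ∈ₘ succ m → ap F k ∈ₘ succ ε := by
    intro k hk
    rcases mem_succ.1 hk with h | rfl
    · exact mem_succ.2 (Or.inl (hFm' ▸ hFlt m hmm k h))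
    · exact mem_succ.2 (Or.inr hFm')
  have hFlt3 : ∀ k, k ∈ₘ succ m → ap F k ∈ₘ ε₃ := fun k hk => hf.ord.trans h1 (hFle k hk)
  have hpowF : ∀ k, succ k ∈ₘ succ m → ap f (ap F (succ k)) = pow (pow (ap f (ap F k))) := by
    intro k hk
    have h := up (hFlt3 _ hk)
    rw [hFs k hk] at h ⊢
    rw [hf.level_succ h, hf.level_succ (hf.trans_succ h (mem_succ.2 (Or.inr rfl)))]
  have hpp : ∀ k, k ∈ₘ succ m → pow (pow (ap f (ap F k))) ∈ₘ A := by
    intro k hk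
    refine hS.subset _ _ hV2 fun x hx => ?_
    rw [← hp1, ← hp0]
    rw [mem_pow] at hx ⊢
    intro y hy
    rw [mem_pow]
    refine (mem_pow.1 (hx y hy)).trans ?_
    rcases mem_succ.1 (hFle k hk) with h | h
    · exact hf.level_subset (up h0) h
    · rw [h]
      exact IsSubset.refl _
  have down : ∀ {w}, pow w ∈ₘ A → w ∈ₘ A :=
    fun h => hS.trans _ h _ (mem_pow.2 (IsSubset.refl _))
  -- if `V_l` were moved, so would be all levels on the list, among them `V_ε`
  have hfixl : ap j (ap f l) = ap f l := by
    by_contra hne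
    refine nat_induction (P := fun k => k ∈ₘ succ m → ap j (ap f (ap F k)) ≠ ap f (ap F k))
      (fun _ => by rwa [hF0]) (fun k _ ih hk h => ih (pred hk) ?_) hm hmm (by rwa [hFm'])
    rw [hpowF k hk] at h
    have hA2 := hpp k (pred hk)
    exact ap_of_ap_pow hj hS (down hA2) (ap_of_ap_pow hj hS hA2 h)
  -- a limit ordinal that is at most `F (k + 1) = F k + 2` is at most `F k`
  have hκl : κ ∈ₘ succ l := by
    have hns : ∀ β, κ ≠ succ β := fun β h => hlim.2 β (isSucc_iff.2 h)
    have hκε : κ ∈ₘ succ ε := by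
      have := hf.ordinal_mem h3 hκ.1 (hA ▸ hκ.2.1)
      rw [hε₃, mem_succ, mem_succ] at this
      rcases this with (h | h) | h
      · exact h
      · exact absurd h (hns _)
      · exact absurd h (hns _)
    refine nat_induction (P := fun k => k ∈ₘ succ m → κ ∈ₘ succ (ap F k) → κ ∈ₘ succ l)
      (fun _ h => by rwa [hF0] at h) (fun k _ ih hk h => ih (pred hk) ?_) hm hmm (by rwa [hFm'])
    rw [hFs k hk, mem_succ, mem_succ] at h
    rcases h with (h | h) | h
    · exact h
    · exact absurd h (hns _)
    · exact absurd h (hns _)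
  have hωl : omega ∈ₘ l := by
    rcases mem_succ.1 hκl with h | rfl
    · exact hl.1.trans h hωκ
    · exact hωκ
  have hωF : ∀ k, k ∈ₘ succ m → IsSubset omega (ap f (ap F k)) := by
    intro k hk
    refine IsSubset.trans ?_ (hf.ordinal_subset (up (hFlt3 k hk)))
    obtain ⟨ho, h | h⟩ := hFord k hk
    · exact ho.1 _ (h ▸ hωl)
    · exact ho.1 _ (ho.trans h hωl)
  have hrep : ∀ k, k ∈ₘ succ m →
      ap j (ap f (ap F k)) = ap f (ap F k) ∧ Represents j (ap f (ap F k)) := by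
    intro k hk
    refine nat_induction (P := fun k => k ∈ₘ succ m →
      ap j (ap f (ap F k)) = ap f (ap F k) ∧ Represents j (ap f (ap F k)))
      (fun h => ?_) (fun k _ ih hk => ?_) (nat_of hk) hk
    · have hp := hpp _ h
      have hlt := hFlt3 _ h
      rw [hF0] at *
      exact ⟨hfixl, represents_limit_level hj hS hf hA hl hωl hlt hp hfixl⟩
    · obtain ⟨ih1, ih2⟩ := ih (pred hk)
      have hp := hpp _ hk
      rw [hpowF k hk] at *
      have hA2 := hpp k (pred hk)
      exact ⟨ap_pow hj hS (down hA2) hA2 (ap_pow hj hS (down (down hA2)) (down hA2) ih1),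
        ih2.pow_pow hj hS hp ih1 (hf.transitive (up (hFlt3 k (pred hk)))) (hωF k (pred hk))⟩
  obtain ⟨s, hs, hR⟩ := (hrep m hmm).2
  have hωε := hωF m hmm
  rw [hFm'] at hs hR hωε
  rw [hp0] at hR
  refine ⟨hj, hS, hp1, hp2, ⟨hf.transitive (up h2),
    fun x y hy hx => hf.mem_of_subset (up h2) hy hx⟩, hp0 ▸ qClosed_pow hωε,
    hp0 ▸ hωε.trans (subset_pow (hf.transitive (up h0))), hfix1, hfix2, hκ.1, hκ.2.1, hcrit, hfix,
    s, hp0 ▸ mem_pow.2 hs, fun x hx => ?_⟩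
  rw [← hp1, mem_pow] at hx
  obtain ⟨g, hg, hga⟩ := hR x hx
  refine ⟨g, hp1 ▸ mem_pow.2 hg, fun a ha => hga a ?_⟩
  rw [← hp0] at ha
  exact mem_pow.1 ha

end Setup

section Codes

variable {M : Type*} [Lset.Structure M] [hM : Fact (IsModelZF M)] {n : ℕ}

/-! ### Ordinals that are not surjective images -/

/-- `θ` is the least ordinal that is not the surjective image of an element of `v`. -/
structure IsThetaFor (v θ : M) : Prop where
  ord : IsOrdinal θ
  not_surj : ∀ S f, S ∈ₘ v → ¬ IsSurjection f S θ
  surj : ∀ ξ, ξ ∈ₘ θ → ∃ S f, S ∈ₘ v ∧ IsSurjection f S ξ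

theorem IsThetaFor.mem_of_surj {v θ S f ξ : M} (hθ : IsThetaFor v θ) (hv : IsSuperTransitive v)
    (hξ : IsOrdinal ξ) (hS : S ∈ₘ v) (hf : IsSurjection f S ξ) : ξ ∈ₘ θ := by
  rcases hθ.ord.mem_or_subset hξ with h | h
  · exact h
  rw [isSurjection_iff] at hf
  refine absurd (isSurjection_iff.2 ⟨isFun_lam (F := fun t => ap f t) fun t ht => (mem_sep.1 ht).2,
    fun y hy => ?_⟩) (hθ.not_surj (sep S fun t => ap f t ∈ₘ θ) _ (hv.subset _ _ hS sep_subset))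
  obtain ⟨t, ht, rfl⟩ := hf.2 y (h y hy)
  have : t ∈ₘ sep S fun t => ap f t ∈ₘ θ := mem_sep.2 ⟨ht, hy⟩
  exact ⟨t, this, (ap_lam this).symm⟩

theorem IsThetaFor.mem_of_mem {v θ ξ : M} (hθ : IsThetaFor v θ) (hv : IsSuperTransitive v)
    (hξ : IsOrdinal ξ) (h : ξ ∈ₘ v) : ξ ∈ₘ θ :=
  hθ.mem_of_surj hv hξ h (isSurjection_iff.2 ⟨isFun_lam (F := fun x => x) fun _ h => h,
    fun y hy => ⟨y, hy, (ap_lam (F := fun x => x) hy).symm⟩⟩)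

/-- A function from a set `T ∈ v` to a regular cardinal above `θ` is bounded. -/
theorem IsThetaFor.exists_bound {v θ T g δ : M} (hθ : IsThetaFor v θ) (hv : IsSuperTransitive v)
    (hδ : IsRegularCardinal δ) (hθδ : θ ∈ₘ δ) (hT : T ∈ₘ v) (hg : IsFun g T δ) :
    ∃ ρ, ρ ∈ₘ δ ∧ ∀ t, t ∈ₘ T → ap g t ∈ₘ ρ := by
  have hδo := hδ.1.1
  let b : M := image T fun t => ap g t
  have hb : ∀ x, x ∈ₘ b ↔ ∃ t, t ∈ₘ T ∧ x = ap g t := fun x => mem_image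
  have hbδ : ∀ x, x ∈ₘ b → x ∈ₘ δ := by
    intro x hx
    obtain ⟨t, ht, rfl⟩ := (hb x).1 hx
    exact hg.ap_mem ht
  have hbo : ∀ x, x ∈ₘ b → IsOrdinal x := fun x hx => hδo.mem (hbδ x hx)
  obtain ⟨π, β, hβ, hπ, hπ'⟩ := (isPWO_mem hbo).exists_collapse inferInstance
  rw [isSurjection_iff] at hπ
  have hinj : ∀ x y, x ∈ₘ b → y ∈ₘ b → ap π x = ap π y → x = y := by
    intro x y hx hy e
    rcases ordinal_trichotomy (hbo x hx) (hbo y hy) with h | h | h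
    · exact absurd (e ▸ (hπ' x y hx hy).1 h) (not_mem_self _)
    · exact h
    · exact absurd (e ▸ (hπ' y x hy hx).1 h) (not_mem_self _)
  have hβδ : β ∈ₘ δ := by
    refine hδo.trans hθδ (hθ.mem_of_surj hv hβ hT (f := lam T fun t => ap π (ap g t))
      (isSurjection_iff.2 ⟨isFun_lam fun t ht => hπ.1.ap_mem ((hb _).2 ⟨t, ht, rfl⟩),
        fun y hy => ?_⟩))
    obtain ⟨x, hx, rfl⟩ := hπ.2 y hy
    obtain ⟨t, ht, rfl⟩ := (hb x).1 hx
    exact ⟨t, ht, (ap_lam (F := fun t => ap π (ap g t)) ht).symm⟩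
  -- the inverse of the collapse enumerates the range of `g` in order type `β < δ`
  let i : M := sep (prod β δ) fun p => ∃ x, x ∈ₘ b ∧ p = opair (ap π x) x
  have hi : ∀ x, x ∈ₘ b → opair (ap π x) x ∈ₘ i := fun x hx =>
    mem_sep.2 ⟨opair_mem_prod.2 ⟨hπ.1.ap_mem hx, hbδ x hx⟩, x, hx, rfl⟩
  have hif : IsFun i β δ := by
    refine isFun_of (fun p hp => mem_prod.1 (mem_sep.1 hp).1) fun y hy => ?_
    obtain ⟨x, hx, rfl⟩ := hπ.2 y hy
    refine ⟨x, hi x hx, fun z hz => ?_⟩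
    obtain ⟨_, x', hx', e⟩ := mem_sep.1 hz
    obtain ⟨e1, rfl⟩ := opair_inj.1 e
    exact (hinj _ _ hx hx' e1).symm
  obtain ⟨ρ, hρ, hbd⟩ := hδ.2.2 β i hβδ hif
  refine ⟨ρ, hρ, fun t ht => ?_⟩
  exact hbd _ _ (app_iff.2 (hi _ ((hb _).2 ⟨t, ht, rfl⟩)))

/-! ### Ordinals coded by prewellorders -/

/-- The relation coded by `W` is a prewellorder of `D`, as far as this can be seen in `A`. -/
def IsPWOCode (A W D : M) : Prop :=
  (∀ b, b ∈ₘ A → IsSubset b D → ¬ b = emp →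
    ∃ x, x ∈ₘ b ∧ ∀ y, y ∈ₘ b → ¬ qpair y x ∈ₘ W) ∧
  (∀ x, x ∈ₘ D → ∀ y, y ∈ₘ D → ∀ z, z ∈ₘ D →
    qpair x y ∈ₘ W → qpair y z ∈ₘ W → qpair x z ∈ₘ W) ∧
  ∀ x, x ∈ₘ D → ∀ y, y ∈ₘ D → ∀ z, z ∈ₘ D →
    qpair x z ∈ₘ W → qpair x y ∈ₘ W ∨ qpair y z ∈ₘ W

/-- The prewellorder coded by `W` on `D` has regular length: every function coded by some `F ∈ A`
from a proper initial segment to `D` is bounded. -/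
def IsRegularCode (A W D : M) : Prop :=
  ∀ c, c ∈ₘ D → ∀ F, F ∈ₘ A →
    (∀ x, x ∈ₘ D → ∀ y, y ∈ₘ D → ∀ x', x' ∈ₘ D → ∀ y', y' ∈ₘ D →
      qpair x y ∈ₘ F → qpair x' y' ∈ₘ F → ¬ qpair x x' ∈ₘ W → ¬ qpair x' x ∈ₘ W →
      ¬ qpair y y' ∈ₘ W ∧ ¬ qpair y' y ∈ₘ W) →
    ∃ y, y ∈ₘ D ∧ ∀ x, x ∈ₘ D → ∀ y', y' ∈ₘ D →
      qpair x c ∈ₘ W → qpair x y' ∈ₘ F → qpair y' y ∈ₘ W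

/-- Some proper initial segment of the prewellorder coded by `W` on `D` is not the surjective image
of any `T ∈ V₂`. -/
def IsBigCode (A V₂ W D : M) : Prop :=
  ∃ c, c ∈ₘ D ∧ ∀ T, T ∈ₘ V₂ → ∀ F, F ∈ₘ A →
    (∀ t, t ∈ₘ T → ∀ x, x ∈ₘ D → ∀ x', x' ∈ₘ D → qpair t x ∈ₘ F → qpair t x' ∈ₘ F →
      ¬ qpair x x' ∈ₘ W ∧ ¬ qpair x' x ∈ₘ W) →
    ∃ x, x ∈ₘ D ∧ qpair x c ∈ₘ W ∧ ∀ t, t ∈ₘ T → ¬ qpair t x ∈ₘ F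

/-- The set `H` codes a total injective relation from `α` to the proper initial segments of the
prewellorder coded by `W` on `D` whose lengths are regular cardinals above `θ`. -/
def IsInjCode (A V₂ W D α H : M) : Prop :=
  (∀ ξ, ξ ∈ₘ α → ∃ x, x ∈ₘ D ∧ qpair ξ x ∈ₘ H) ∧
  (∀ ξ, ξ ∈ₘ α → ∀ x, x ∈ₘ D → qpair ξ x ∈ₘ H → ∃ E, E ∈ₘ A ∧ IsSubset E D ∧
    (∀ y, y ∈ₘ D → (y ∈ₘ E ↔ qpair y x ∈ₘ W)) ∧ IsRegularCode A W E ∧ IsBigCode A V₂ W E) ∧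
  ∀ ξ, ξ ∈ₘ α → ∀ ξ', ξ' ∈ₘ α → ∀ x, x ∈ₘ D → ∀ x', x' ∈ₘ D →
    qpair ξ x ∈ₘ H → qpair ξ' x' ∈ₘ H → ¬ qpair x x' ∈ₘ W → ¬ qpair x' x ∈ₘ W → ξ = ξ'

section DfnOver

variable {A : M} [hA : Fact (IsTransitive A)] (i₁ i₂ i₃ i₄ i₅ : Fin n)

instance : DfnOver A fun v => IsPWOCode A (v i₁) (v i₂) := by
  unfold IsPWOCode; infer_instance
instance : DfnOver A fun v => IsRegularCode A (v i₁) (v i₂) := by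
  unfold IsRegularCode; infer_instance
instance : DfnOver A fun v => IsBigCode A (v i₁) (v i₂) (v i₃) := by
  unfold IsBigCode; infer_instance
instance : DfnOver A fun v => IsInjCode A (v i₁) (v i₂) (v i₃) (v i₄) (v i₅) := by
  unfold IsInjCode; infer_instance

end DfnOver

/-- The map `f` is an isomorphism from the prewellorder coded by `W` on `D`, modulo equivalence, to
the ordinal `δ`. -/
structure IsCollapse (W D f δ : M) : Prop where
  ord : IsOrdinal δ
  fn : IsFun f D δ
  surj : ∀ y, y ∈ₘ δ → ∃ x, x ∈ₘ D ∧ y = ap f x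
  lt_iff : ∀ x y, x ∈ₘ D → y ∈ₘ D → (qpair x y ∈ₘ W ↔ ap f x ∈ₘ ap f y)

namespace IsCollapse

variable {W D f δ x y : M} (hc : IsCollapse W D f δ)

include hc

theorem ord_ap (hx : x ∈ₘ D) : IsOrdinal (ap f x) := hc.ord.mem (hc.fn.ap_mem hx)

theorem eq_iff (hx : x ∈ₘ D) (hy : y ∈ₘ D) :
    ap f x = ap f y ↔ ¬ qpair x y ∈ₘ W ∧ ¬ qpair y x ∈ₘ W := by
  rw [hc.lt_iff x y hx hy, hc.lt_iff y x hy hx]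
  constructor
  · intro e
    rw [e]
    exact ⟨not_mem_self _, not_mem_self _⟩
  · rintro ⟨h1, h2⟩
    rcases ordinal_trichotomy (hc.ord_ap hx) (hc.ord_ap hy) with h | h | h
    exacts [absurd h h1, h, absurd h h2]

theorem segment {E : M} (hx : x ∈ₘ D) (hE : IsSubset E D)
    (h : ∀ y, y ∈ₘ D → (y ∈ₘ E ↔ qpair y x ∈ₘ W)) :
    IsCollapse W E (lam E fun y => ap f y) (ap f x) where
  ord := hc.ord_ap hx
  fn := isFun_lam fun y hy => (hc.lt_iff y x (hE y hy) hx).1 ((h y (hE y hy)).1 hy)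
  surj z hz := by
    obtain ⟨y, hy, rfl⟩ := hc.surj z (hc.ord.trans (hc.fn.ap_mem hx) hz)
    have hyE := (h y hy).2 ((hc.lt_iff y x hy hx).2 hz)
    exact ⟨y, hyE, (ap_lam hyE).symm⟩
  lt_iff y z hy hz := by
    rw [ap_lam hy, ap_lam hz]
    exact hc.lt_iff y z (hE y hy) (hE z hz)

theorem isPWOCode (A : M) : IsPWOCode A W D := by
  refine ⟨fun b _ hb hne => ?_, fun x hx y hy z hz hxy hyz => ?_, fun x hx y hy z hz hxz => ?_⟩
  · obtain ⟨x, hx⟩ := (eq_emp_or_exists_mem b).resolve_left hne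
    obtain ⟨α, _, ⟨x, hx, rfl⟩, hm⟩ := exists_least_ordinal
      (P := fun α => ∃ x, x ∈ₘ b ∧ α = ap f x) (hc.ord_ap (hb x hx)) ⟨x, hx, rfl⟩
    exact ⟨x, hx, fun y hy hyx => hm _ ((hc.lt_iff y x (hb y hy) (hb x hx)).1 hyx) ⟨y, hy, rfl⟩⟩
  · rw [hc.lt_iff _ _ hx hz]
    rw [hc.lt_iff _ _ hx hy] at hxy
    rw [hc.lt_iff _ _ hy hz] at hyz
    exact (hc.ord_ap hz).trans hyz hxy
  · rw [hc.lt_iff _ _ hx hz] at hxz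
    rw [hc.lt_iff _ _ hx hy, hc.lt_iff _ _ hy hz]
    rcases ordinal_trichotomy (hc.ord_ap hx) (hc.ord_ap hy) with h | h | h
    · exact Or.inl h
    · exact Or.inr (h ▸ hxz)
    · exact Or.inr ((hc.ord_ap hz).trans hxz h)

end IsCollapse

theorem IsPWOCode.exists_collapse {A W D : M} (hA : IsSuperTransitive A) (hD : D ∈ₘ A)
    (h : IsPWOCode A W D) : ∃ f δ, IsCollapse W D f δ := by
  have : IsPWO D fun x y => qpair x y ∈ₘ W := by
    refine ⟨fun b hb ⟨x, hx⟩ => h.1 b (hA.subset _ _ hD hb) hb ?_,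
      fun x y z hx hy hz => h.2.1 x hx y hy z hz, fun x y z hx hy hz => h.2.2 x hx y hy z hz⟩
    rintro rfl
    exact not_mem_emp _ hx
  obtain ⟨f, δ, hδ, hf, hlt⟩ := this.exists_collapse inferInstance
  rw [isSurjection_iff] at hf
  exact ⟨f, δ, hδ, hf.1, hf.2, hlt⟩

/-- The pairs in `v` whose coordinates are related by `R`. -/
noncomputable def qrel (v : M) (R : M → M → Prop) : M :=
  sep v fun p => ∃ x y, p = qpair x y ∧ R x y

theorem mem_qrel {v x y : M} {R : M → M → Prop} (hR : Dfn fun w : Fin 2 → M => R (w 0) (w 1)) :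
    qpair x y ∈ₘ qrel v R ↔ qpair x y ∈ₘ v ∧ R x y := by
  have := fun {n} (f g : (Fin n → M) → M) [DfnFun f] [DfnFun g] => hR.comp₂ f g
  rw [qrel, mem_sep]
  refine and_congr_right fun _ => ⟨?_, fun h => ⟨x, y, rfl, h⟩⟩
  rintro ⟨x', y', e, h⟩
  obtain ⟨rfl, rfl⟩ := qpair_inj.1 e
  exact h

theorem qrel_subset {v : M} {R : M → M → Prop}
    (hR : Dfn fun w : Fin 2 → M => R (w 0) (w 1)) : IsSubset (qrel v R) v := by
  have := fun {n} (f g : (Fin n → M) → M) [DfnFun f] [DfnFun g] => hR.comp₂ f g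
  exact sep_subset

/-! ### Counting the regular cardinals -/

namespace IsEvenEmbedding

variable {j A V₁ V₂ κ θ : M} (h : IsEvenEmbedding j A V₁ V₂ κ)

include h

theorem mem_iff_subset {x : M} : x ∈ₘ A ↔ IsSubset x V₂ := by rw [← h.pow₂, mem_pow]

theorem mem_of_mem {x : M} (hx : x ∈ₘ V₂) : x ∈ₘ A :=
  h.super.trans _ (h.mem_iff_subset.2 (IsSubset.refl _)) _ hx

theorem V₂_mem : V₂ ∈ₘ A := h.mem_iff_subset.2 (IsSubset.refl _)

theorem V₁_mem : V₁ ∈ₘ V₂ := by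
  rw [← h.pow₁, mem_pow]
  exact IsSubset.refl _

theorem qpair_mem {x y : M} (hx : x ∈ₘ V₂) (hy : y ∈ₘ V₂) : qpair x y ∈ₘ V₂ := by
  rw [← h.pow₁, mem_pow] at *
  exact h.closed₁.qpair_subset hx hy

/-- Every definable relation on `V_{ε+2}` is coded by an element of `V_{ε+3}`. -/
theorem exists_code_rel (R : M → M → Prop) (hR : Dfn fun w : Fin 2 → M => R (w 0) (w 1)) :
    ∃ q, q ∈ₘ A ∧ ∀ x y, x ∈ₘ V₂ → y ∈ₘ V₂ → (qpair x y ∈ₘ q ↔ R x y) :=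
  ⟨qrel V₂ R, h.mem_iff_subset.2 (qrel_subset hR), fun x y hx hy => by
    rw [mem_qrel hR, and_iff_right (h.qpair_mem hx hy)]⟩

/-- The length of a coded prewellorder is a regular cardinal above `θ` if and only if `V_{ε+3}`
sees this. -/
theorem isRegular_iff (hθ : IsThetaFor V₂ θ) {W D f δ : M} (hD : D ∈ₘ A)
    (hc : IsCollapse W D f δ) :
    IsRegularCode A W D ∧ IsBigCode A V₂ W D ↔ IsRegularCardinal δ ∧ θ ∈ₘ δ := by
  have hDV : ∀ {x}, x ∈ₘ D → x ∈ₘ V₂ := fun hx => h.mem_iff_subset.1 hD _ hx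
  have hTV : ∀ {T t}, T ∈ₘ V₂ → t ∈ₘ T → t ∈ₘ V₂ := fun hT ht => h.super₂.trans _ hT _ ht
  constructor
  · rintro ⟨hreg, c, hcD, hbig⟩
    have hθδ : θ ∈ₘ δ := by
      have hle : ¬ ap f c ∈ₘ θ := by
        intro hcθ
        obtain ⟨S, g, hS, hg⟩ := hθ.surj _ hcθ
        rw [isSurjection_iff] at hg
        obtain ⟨q, hqA, hq⟩ := h.exists_code_rel (fun a b => ap g a = ap f b)
          inferInstance
        obtain ⟨x, hx, hxc, hno⟩ := hbig S hS _ hqA fun t ht x hx x' hx' e e' => by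
          rw [hq _ _ (hTV hS ht) (hDV hx)] at e
          rw [hq _ _ (hTV hS ht) (hDV hx')] at e'
          exact (hc.eq_iff hx hx').1 (e.symm.trans e')
        obtain ⟨t, ht, e⟩ := hg.2 _ ((hc.lt_iff x c hx hcD).1 hxc)
        exact hno t ht ((hq _ _ (hTV hS ht) (hDV hx)).2 e.symm)
      exact hθ.ord.mem_of_subset_of_mem hc.ord ((hθ.ord.subset_iff (hc.ord_ap hcD)).2 hle)
        (hc.fn.ap_mem hcD)
    refine ⟨⟨⟨hc.ord, fun α hα => ?_⟩, fun k hk => ?_, fun α g hα hg => ?_⟩, hθδ⟩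
    · rintro ⟨i, hi⟩
      rw [isInjection_iff] at hi
      obtain ⟨c, hcD, rfl⟩ := hc.surj α hα
      obtain ⟨q, hqA, hq⟩ := h.exists_code_rel (fun a b => ap i (ap f b) = ap f a)
        inferInstance
      obtain ⟨y, hy, hbd⟩ := hreg c hcD _ hqA
        fun x hx y hy x' hx' y' hy' e e' h1 h2 => by
          rw [hq _ _ (hDV hx) (hDV hy)] at e
          rw [hq _ _ (hDV hx') (hDV hy')] at e'
          refine (hc.eq_iff hy hy').1 (hi.2 _ _ (hc.fn.ap_mem hy) (hc.fn.ap_mem hy') ?_)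
          rw [e, e']
          exact (hc.eq_iff hx hx').2 ⟨h1, h2⟩
      have hiy := hi.1.ap_mem (hc.fn.ap_mem hy)
      obtain ⟨x, hx, e⟩ := hc.surj _ (hc.ord.trans hα hiy)
      have := hbd x hx y hy ((hc.lt_iff x c hx hcD).2 (e ▸ hiy))
        ((hq _ _ (hDV hx) (hDV hy)).2 e)
      exact not_mem_self _ ((hc.lt_iff y y hy hy).1 this)
    · refine hc.ord.trans hθδ (hθ.mem_of_mem h.super₂ hk.1 ?_)
      exact h.super₂.trans _ h.V₁_mem _ (h.omega_subset _ (mem_omega.2 hk))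
    · obtain ⟨c, hcD, rfl⟩ := hc.surj α hα
      obtain ⟨q, hqA, hq⟩ := h.exists_code_rel (fun a b => ap f b = ap g (ap f a))
        inferInstance
      obtain ⟨y, hy, hbd⟩ := hreg c hcD _ hqA
        fun x hx y hy x' hx' y' hy' e e' h1 h2 => by
          rw [hq _ _ (hDV hx) (hDV hy)] at e
          rw [hq _ _ (hDV hx') (hDV hy')] at e'
          refine (hc.eq_iff hy hy').1 ?_
          rw [e, e', (hc.eq_iff hx hx').2 ⟨h1, h2⟩]
      refine ⟨ap f y, hc.fn.ap_mem hy, fun ξ z hz => ?_⟩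
      obtain ⟨hξ, rfl⟩ := hg.app_iff.1 hz
      obtain ⟨x, hx, rfl⟩ := hc.surj ξ (hc.ord.trans hα hξ)
      obtain ⟨y', hy', e⟩ := hc.surj _ (hg.ap_mem hξ)
      rw [e, ← hc.lt_iff y' y hy' hy]
      exact hbd x hx y' hy' ((hc.lt_iff x c hx hcD).2 hξ)
        ((hq _ _ (hDV hx) (hDV hy')).2 e.symm)
  · rintro ⟨hδ, hθδ⟩
    constructor
    · intro c hcD F hF hfn
      have h0 : (emp : M) ∈ₘ δ := hδ.2.1 _ isNat_emp
      -- the function induced by `F`, extended by the value `0`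
      let val : M → M := fun ξ =>
        sUnion (image (sep D fun y => ∃ x, x ∈ₘ D ∧ ap f x = ξ ∧ qpair x y ∈ₘ F) fun y => ap f y)
      have hval : ∀ x, x ∈ₘ D → ∀ y, y ∈ₘ D → qpair x y ∈ₘ F → val (ap f x) = ap f y := by
        intro x hx y hy hxy
        refine set_ext fun z => ?_
        simp only [val, mem_sUnion, mem_image, mem_sep]
        constructor
        · rintro ⟨_, ⟨y', ⟨hy', x', hx', e, hxy'⟩, rfl⟩, hz⟩
          obtain ⟨h1, h2⟩ := (hc.eq_iff hx' hx).1 e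
          rwa [← (hc.eq_iff hy' hy).2 (hfn x' hx' y' hy' x hx y hy hxy' hxy h1 h2)]
        · exact fun hz => ⟨_, ⟨y, ⟨hy, x, hx, rfl, hxy⟩, rfl⟩, hz⟩
      have hvδ : ∀ ξ, ξ ∈ₘ ap f c → val ξ ∈ₘ δ := by
        intro ξ _
        by_cases hex : ∃ x y, x ∈ₘ D ∧ y ∈ₘ D ∧ ap f x = ξ ∧ qpair x y ∈ₘ F
        · obtain ⟨x, y, hx, hy, rfl, hxy⟩ := hex
          rw [hval x hx y hy hxy]
          exact hc.fn.ap_mem hy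
        · have : val ξ = emp := by
            refine isEmptySet_iff.1 fun z hz => hex ?_
            simp only [val, mem_sUnion, mem_image, mem_sep] at hz
            obtain ⟨_, ⟨y, ⟨hy, x, hx, e, hxy⟩, _⟩, _⟩ := hz
            exact ⟨x, y, hx, hy, e, hxy⟩
          rwa [this]
      have hv : DfnFun fun w : Fin 1 → M => val (w 0) := by
        simp only [val]; infer_instance
      obtain ⟨ρ, hρ, hbd⟩ := hδ.2.2 _ (lam (ap f c) val) (hc.fn.ap_mem hcD) (isFun_lam hvδ)
      obtain ⟨y, hy, rfl⟩ := hc.surj ρ hρ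
      refine ⟨y, hy, fun x hx y' hy' hxc hxy' => ?_⟩
      rw [hc.lt_iff _ _ hy' hy, ← hval x hx y' hy' hxy']
      exact hbd (ap f x) _ (app_iff.2 (mem_lam.2 ⟨(hc.lt_iff _ _ hx hcD).1 hxc, rfl⟩))
    · obtain ⟨c, hcD, hcθ⟩ := hc.surj θ hθδ
      refine ⟨c, hcD, fun T hT F hF hfn => ?_⟩
      by_contra hno
      push Not at hno
      let T' : M := sep T fun t => ∃ x, x ∈ₘ D ∧ qpair t x ∈ₘ F ∧ ap f x ∈ₘ θ
      let G : M := sep (prod T' θ) fun p => ∃ t x, x ∈ₘ D ∧ p = opair t (ap f x) ∧ qpair t x ∈ₘ F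
      have hG : ∀ t, t ∈ₘ T → ∀ x, x ∈ₘ D → qpair t x ∈ₘ F → ap f x ∈ₘ θ →
          t ∈ₘ T' ∧ opair t (ap f x) ∈ₘ G := by
        intro t ht x hx htx hxθ
        have ht' : t ∈ₘ T' := mem_sep.2 ⟨ht, x, hx, htx, hxθ⟩
        exact ⟨ht', mem_sep.2 ⟨opair_mem_prod.2 ⟨ht', hxθ⟩, t, x, hx, rfl, htx⟩⟩
      have hGf : IsFun G T' θ := by
        refine isFun_of (fun p hp => mem_prod.1 (mem_sep.1 hp).1) fun t ht => ?_
        obtain ⟨ht, x, hx, htx, hxθ⟩ := mem_sep.1 ht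
        refine ⟨ap f x, (hG t ht x hx htx hxθ).2, fun z hz => ?_⟩
        obtain ⟨_, t', x', hx', e, htx'⟩ := mem_sep.1 hz
        obtain ⟨rfl, rfl⟩ := opair_inj.1 e
        exact (hc.eq_iff hx' hx).2 (hfn t ht x' hx' x hx htx' htx)
      refine hθ.not_surj T' G (h.super₂.subset _ _ hT sep_subset)
        (isSurjection_iff.2 ⟨hGf, fun y hy => ?_⟩)
      obtain ⟨x, hx, rfl⟩ := hc.surj y (hc.ord.trans hθδ hy)
      obtain ⟨t, ht, htx⟩ := hno x hx ((hc.lt_iff x c hx hcD).2 (hcθ ▸ hy))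
      obtain ⟨h1, h2⟩ := hG t ht x hx htx hy
      exact ⟨t, h1, (hGf.mem_iff.1 h2).2⟩

/-- Every ordinal below `θ_{ε+3}` is the length of a prewellorder coded in `V_{ε+3}`. -/
theorem exists_code {θ₃ δ : M} (hθ : IsThetaFor A θ₃) (hδ : δ ∈ₘ θ₃) :
    ∃ W D f, W ∈ₘ A ∧ D ∈ₘ A ∧ IsCollapse W D f δ := by
  obtain ⟨D, f, hD, hf⟩ := hθ.surj δ hδ
  rw [isSurjection_iff] at hf
  obtain ⟨q, hqA, hq⟩ := h.exists_code_rel (fun a b => ap f a ∈ₘ ap f b)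
    inferInstance
  have hDV := h.mem_iff_subset.1 hD
  exact ⟨_, D, f, hqA, hD, hθ.ord.mem hδ, hf.1, hf.2, fun x y hx hy =>
    hq _ _ (hDV x hx) (hDV y hy)⟩

theorem exists_collapse_ap {W D f δ : M} (hW : W ∈ₘ A) (hD : D ∈ₘ A)
    (hc : IsCollapse W D f δ) : ∃ f' δ', IsCollapse (ap j W) (ap j D) f' δ' := by
  have : Fact (IsTransitive A) := ⟨h.super.trans⟩
  exact ((h.emb.iff₂ (fun W D => IsPWOCode A W D) hW hD).1 (hc.isPWOCode A)).exists_collapse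
    h.super (h.emb.1.ap_mem hD)

/-- The embedding induced by `j` on the coded ordinals fixes every regular cardinal above `θ`. It is
continuous at such a cardinal `δ`: each element of the image has the form `j(g)(s)` for a function
`g` on `V_{ε+1}` with values below `δ`, and `g` is bounded in `δ`. As the image of `δ` is a regular
cardinal with a cofinal subset of type `δ`, it equals `δ`. -/
theorem collapse_ap_eq (hθ : IsThetaFor V₂ θ) {W D f δ f' δ' : M} (hW : W ∈ₘ A) (hD : D ∈ₘ A)
    (hc : IsCollapse W D f δ) (hδ : IsRegularCardinal δ) (hθδ : θ ∈ₘ δ)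
    (hc' : IsCollapse (ap j W) (ap j D) f' δ') : δ' = δ := by
  have : Fact (IsTransitive A) := ⟨h.super.trans⟩
  have hj := h.emb
  have hDV : ∀ {x}, x ∈ₘ D → x ∈ₘ V₂ := fun hx => h.mem_iff_subset.1 hD _ hx
  have hDA : ∀ {x}, x ∈ₘ D → x ∈ₘ A := fun hx => h.mem_of_mem (hDV hx)
  have hjD : ap j D ∈ₘ A := hj.1.ap_mem hD
  have hjx : ∀ {x}, x ∈ₘ D → ap j x ∈ₘ ap j D := fun hx => (hj.mem_iff (hDA hx) hD).2 hx
  have hV1 := h.mem_of_mem h.V₁_mem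
  have hδ' : IsRegularCardinal δ' := by
    have h1 := (hj.iff₃ (fun V W D => IsRegularCode A W D ∧ IsBigCode A V W D) h.V₂_mem hW hD).1
      ((h.isRegular_iff hθ hD hc).2 ⟨hδ, hθδ⟩)
    rw [h.fix₂] at h1
    exact ((h.isRegular_iff hθ hjD hc').1 h1).1
  have hlt : ∀ x y, x ∈ₘ D → y ∈ₘ D →
      (ap f' (ap j x) ∈ₘ ap f' (ap j y) ↔ ap f x ∈ₘ ap f y) := by
    intro x y hx hy
    rw [← hc.lt_iff x y hx hy, ← hc'.lt_iff _ _ (hjx hx) (hjx hy)]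
    exact (hj.iff₃ (fun x y W => qpair x y ∈ₘ W) (hDA hx) (hDA hy) hW).symm
  -- the map `f x ↦ f' (j x)` from `δ` to `δ'`
  let φ : M := sep (prod δ δ') fun p => ∃ x, x ∈ₘ D ∧ p = opair (ap f x) (ap f' (ap j x))
  have hφm : ∀ x, x ∈ₘ D → opair (ap f x) (ap f' (ap j x)) ∈ₘ φ := fun x hx =>
    mem_sep.2 ⟨opair_mem_prod.2 ⟨hc.fn.ap_mem hx, hc'.fn.ap_mem (hjx hx)⟩, x, hx, rfl⟩
  have hφ : IsFun φ δ δ' := by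
    refine isFun_of (fun p hp => mem_prod.1 (mem_sep.1 hp).1) fun ξ hξ => ?_
    obtain ⟨x, hx, rfl⟩ := hc.surj ξ hξ
    refine ⟨_, hφm x hx, fun z hz => ?_⟩
    obtain ⟨_, y, hy, e⟩ := mem_sep.1 hz
    obtain ⟨e₁, rfl⟩ := opair_inj.1 e
    rw [hc'.eq_iff (hjx hy) (hjx hx), hc'.lt_iff _ _ (hjx hy) (hjx hx),
      hc'.lt_iff _ _ (hjx hx) (hjx hy), hlt _ _ hx hy, hlt _ _ hy hx, e₁]
    exact ⟨not_mem_self _, not_mem_self _⟩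
  have hφx : ∀ x, x ∈ₘ D → ap φ (ap f x) = ap f' (ap j x) := fun x hx =>
    (hφ.mem_iff.1 (hφm x hx)).2.symm
  rcases ordinal_trichotomy hc'.ord hc.ord with hlt' | e | hlt'
  · refine absurd (hφ.ap_mem hlt') (not_mem_of_strictMono hc.ord (fun x y hy hxy => ?_) δ' hlt')
    obtain ⟨x, hx, rfl⟩ := hc.surj x (hc.ord.trans hy hxy)
    obtain ⟨y, hyD, rfl⟩ := hc.surj y hy
    rw [hφx x hx, hφx y hyD, hlt x y hx hyD]
    exact hxy
  · exact e
  · -- the range of `φ` is bounded by `f' z`, where `z` is represented by `g`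
    obtain ⟨ρ, hρ, hbd⟩ := hδ'.2.2 δ φ hlt' hφ
    obtain ⟨z, hz, rfl⟩ := hc'.surj ρ hρ
    obtain ⟨s, hs, hseed⟩ := h.seed
    have hzV : z ∈ₘ V₂ := h.mem_iff_subset.1 hjD z hz
    obtain ⟨g, hg, hgz⟩ := hseed z hzV
    let val : M → M := fun e => sep V₁ fun a => qpair e a ∈ₘ g
    let T : M := sep V₁ fun e => val e ∈ₘ D
    have hTV : T ∈ₘ V₂ := by
      rw [← h.pow₁, mem_pow]
      exact sep_subset
    obtain ⟨ρ, hρ, hbg⟩ := hθ.exists_bound h.super₂ hδ hθδ hTV (g := lam T fun e => ap f (val e))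
      (isFun_lam fun e he => hc.fn.ap_mem (mem_sep.1 he).2)
    obtain ⟨c, hcD, rfl⟩ := hc.surj ρ hρ
    have hbound : ∀ e, e ∈ₘ V₁ → ∀ y, y ∈ₘ D → IsFiber V₁ g e y → qpair y c ∈ₘ W := by
      intro e he y hy hfib
      have hyV : IsSubset y V₁ := by
        have := hDV hy
        rwa [← h.pow₁, mem_pow] at this
      have hye : val e = y := by
        refine set_ext fun a => ?_
        simp only [val, mem_sep]
        exact ⟨fun ha => (hfib a ha.1).2 ha.2, fun ha => ⟨hyV a ha, (hfib a (hyV a ha)).1 ha⟩⟩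
      have heT : e ∈ₘ T := mem_sep.2 ⟨he, hye ▸ hy⟩
      have := hbg e heT
      rw [ap_lam heT, hye] at this
      exact (hc.lt_iff y c hy hcD).2 this
    have hbound' := (hj.iff₅ (fun V g D W c => ∀ e, e ∈ₘ V → ∀ y, y ∈ₘ D → IsFiber V g e y →
      qpair y c ∈ₘ W) hV1 (h.mem_of_mem hg) hD hW (hDA hcD)).1 hbound
    rw [h.fix₁] at hbound'
    have h1 := (hc'.lt_iff _ _ hz (hjx hcD)).1 (hbound' s hs z hz hgz)
    have h2 := hbd _ _ (hφ.app_iff.2 ⟨hc.fn.ap_mem hcD, rfl⟩)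
    rw [hφx c hcD] at h2
    exact absurd h1 (not_mem_of_mem h2)

/-- Below a regular cardinal above `θ` there are not `κ` many others: the `κ`-th member of the image
under `j` of an enumeration would be fixed by `j`, hence in the range of the enumeration. -/
theorem not_isInjCode_crit (hθ : IsThetaFor V₂ θ) {W D f δ H : M} (hW : W ∈ₘ A) (hD : D ∈ₘ A)
    (hc : IsCollapse W D f δ) (hδ : IsRegularCardinal δ) (hθδ : θ ∈ₘ δ) (hH : H ∈ₘ A) :
    ¬ IsInjCode A V₂ W D κ H := by
  have : Fact (IsTransitive A) := ⟨h.super.trans⟩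
  have hj := h.emb
  have hDA : ∀ {x}, x ∈ₘ D → x ∈ₘ A := fun hx => h.super.trans _ hD _ hx
  have hjx : ∀ {x}, x ∈ₘ D → ap j x ∈ₘ ap j D := fun hx => (hj.mem_iff (hDA hx) hD).2 hx
  intro hinj
  have hinj' := (hj.iff₅ (fun V W D α H => IsInjCode A V W D α H) h.V₂_mem hW hD h.crit_mem hH).1
    hinj
  rw [h.fix₂] at hinj'
  obtain ⟨f', δ', hc'⟩ := h.exists_collapse_ap hW hD hc
  obtain rfl := h.collapse_ap_eq hθ hW hD hc hδ hθδ hc'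
  obtain ⟨x', hx', hκx'⟩ := hinj'.1 κ h.crit
  obtain ⟨E, hE, hED, hEx', hreg⟩ := hinj'.2.1 κ h.crit x' hx' hκx'
  rw [h.isRegular_iff hθ hE (hc'.segment hx' hED hEx')] at hreg
  obtain ⟨x, hx, e⟩ := hc.surj _ (hc'.fn.ap_mem hx')
  -- the initial segment below `x` has the length of that below `x'`, which is regular
  let E₀ : M := sep D fun y => qpair y x ∈ₘ W
  have hE₀A : E₀ ∈ₘ A := h.super.subset _ _ hD sep_subset
  have hE₀x : ∀ y, y ∈ₘ D → (y ∈ₘ E₀ ↔ qpair y x ∈ₘ W) := fun y hy => by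
    rw [mem_sep, and_iff_right hy]
  have hE₀x' := (hj.iff₄ (fun D E x W => ∀ y, y ∈ₘ D → (y ∈ₘ E ↔ qpair y x ∈ₘ W))
    hD hE₀A (hDA hx) hW).1 hE₀x
  have hseg := hc.segment hx sep_subset hE₀x
  have hseg' := hc'.segment (hjx hx) (hj.subset hE₀A hD sep_subset) hE₀x'
  rw [e] at hreg
  have heq := h.collapse_ap_eq hθ hW hE₀A hseg hreg.1 hreg.2 hseg'
  rw [← e] at heq
  obtain ⟨ξ, hξ, y, hy, h1, h2, hξy⟩ := (hj.iff₅ (fun κ D x W H => ∃ ξ, ξ ∈ₘ κ ∧ ∃ y, y ∈ₘ D ∧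
    ¬ qpair x y ∈ₘ W ∧ ¬ qpair y x ∈ₘ W ∧ qpair ξ y ∈ₘ H) h.crit_mem hD (hDA hx) hW hH).2
    ⟨κ, h.crit, x', hx', ((hc'.eq_iff (hjx hx) hx').1 heq).1,
      ((hc'.eq_iff (hjx hx) hx').1 heq).2, hκx'⟩
  have hξA := h.super.trans _ h.crit_mem _ hξ
  have hξκ : ξ ∈ₘ ap j κ := by
    have := (hj.mem_iff hξA h.crit_mem).2 hξ
    rwa [h.fix ξ hξ] at this
  have hjξy := (hj.iff₃ (fun ξ y H => qpair ξ y ∈ₘ H) hξA (hDA hy) hH).1 hξy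
  rw [h.fix ξ hξ] at hjξy
  have hyx := (hj.iff₃ (fun x y W => ¬ qpair x y ∈ₘ W ∧ ¬ qpair y x ∈ₘ W) (hDA hx) (hDA hy)
    hW).1 ⟨h1, h2⟩
  have heq' := ((hc'.eq_iff (hjx hx) (hjx hy)).2 hyx).symm.trans heq
  obtain ⟨h3, h4⟩ := (hc'.eq_iff (hjx hy) hx').1 heq'
  have := hinj'.2.2 ξ hξκ κ h.crit _ (hjx hy) x' hx' hjξy hκx' h3 h4
  exact not_mem_self κ (this ▸ hξ)

/-- The critical point is a cardinal. -/
theorem not_isInjection_crit {ρ f : M} (hρ : ρ ∈ₘ κ) : ¬ IsInjection f κ ρ := by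
  have : Fact (IsTransitive A) := ⟨h.super.trans⟩
  have hj := h.emb
  intro hf
  rw [isInjection_iff] at hf
  have hκV := h.mem_iff_subset.1 h.crit_mem
  have hρA := h.super.trans _ h.crit_mem _ hρ
  have hρV := h.mem_iff_subset.1 hρA
  obtain ⟨q, hqA, hq⟩ := h.exists_code_rel (fun a b => b = ap f a)
    inferInstance
  have key := (hj.iff₃ (fun κ ρ H => (∀ ξ, ξ ∈ₘ κ → ∃ η, η ∈ₘ ρ ∧ qpair ξ η ∈ₘ H) ∧
    ∀ ξ, ξ ∈ₘ κ → ∀ ξ', ξ' ∈ₘ κ → ∀ η, η ∈ₘ ρ → qpair ξ η ∈ₘ H → qpair ξ' η ∈ₘ H → ξ = ξ')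
    h.crit_mem hρA hqA).1
    ⟨fun ξ hξ => ⟨ap f ξ, hf.1.ap_mem hξ,
      (hq _ _ (hκV ξ hξ) (hρV _ (hf.1.ap_mem hξ))).2 rfl⟩,
      fun ξ hξ ξ' hξ' η hη e e' => hf.2 ξ ξ' hξ hξ' (by
        rw [hq _ _ (hκV ξ hξ) (hρV η hη)] at e
        rw [hq _ _ (hκV ξ' hξ') (hρV η hη)] at e'
        exact e.symm.trans e')⟩
  rw [h.fix ρ hρ] at key
  obtain ⟨η, hη, hκη⟩ := key.1 κ h.crit
  have hηA := h.super.trans _ hρA _ hη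
  have hηκ : η ∈ₘ κ := h.ord.trans hρ hη
  have hκη' : qpair κ (ap j η) ∈ₘ ap j q := by
    rwa [h.fix η hηκ]
  obtain ⟨ξ, hξ, hξη⟩ := (hj.iff₃ (fun κ η H => ∃ ξ, ξ ∈ₘ κ ∧ qpair ξ η ∈ₘ H)
    h.crit_mem hηA hqA).2 ⟨κ, h.crit, hκη'⟩
  have hξA := h.super.trans _ h.crit_mem _ hξ
  have h1 := (hj.iff₃ (fun ξ η H => qpair ξ η ∈ₘ H) hξA hηA hqA).1 hξη
  rw [h.fix ξ hξ, h.fix η hηκ] at h1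
  have hξκ : ξ ∈ₘ ap j κ := by
    have := (hj.mem_iff hξA h.crit_mem).2 hξ
    rwa [h.fix ξ hξ] at this
  have := key.2 ξ hξκ κ h.crit η hη h1 hκη
  exact not_mem_self κ (this ▸ hξ)

/-- The regular cardinals strictly between the two values of `θ` form a set of order type less than
`κ`. -/
theorem cardLT_regular {θ₃ R : M} (hθ : IsThetaFor V₂ θ) (hθ₃ : IsThetaFor A θ₃)
    (hR : ∀ δ, δ ∈ₘ R ↔ IsRegularCardinal δ ∧ θ ∈ₘ δ ∧ δ ∈ₘ θ₃) : CardLT R κ := by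
  have : Fact (IsTransitive A) := ⟨h.super.trans⟩
  have hj := h.emb
  have hRo : ∀ δ, δ ∈ₘ R → IsOrdinal δ := fun δ hδ => ((hR δ).1 hδ).1.1.1
  obtain ⟨π, ρ, hρ, hπ, hlt⟩ := (isPWO_mem hRo).exists_collapse inferInstance
  rw [isSurjection_iff] at hπ
  have hπinj : ∀ x y, x ∈ₘ R → y ∈ₘ R → ap π x = ap π y → x = y := by
    intro x y hx hy e
    rcases ordinal_trichotomy (hRo x hx) (hRo y hy) with h | h | h
    · exact absurd (e ▸ (hlt x y hx hy).1 h) (not_mem_self _)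
    · exact h
    · exact absurd (e ▸ (hlt y x hy hx).1 h) (not_mem_self _)
  have hκV := h.mem_iff_subset.1 h.crit_mem
  -- the `α`-th element of `R` has a code, and `α` many regular cardinals below it
  have hcode : ∀ α, α ∈ₘ ρ → IsSubset α V₂ → ∃ W, W ∈ₘ A ∧ ∃ D, D ∈ₘ A ∧ IsPWOCode A W D ∧
      (IsRegularCode A W D ∧ IsBigCode A V₂ W D) ∧ ∃ H, H ∈ₘ A ∧ IsInjCode A V₂ W D α H := by
    intro α hα hαV
    obtain ⟨δ, hδ, rfl⟩ := hπ.2 α hα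
    obtain ⟨hreg, hθδ, hδ₃⟩ := (hR δ).1 hδ
    obtain ⟨W, D, f, hW, hD, hc⟩ := h.exists_code hθ₃ hδ₃
    have hDV : ∀ {x}, x ∈ₘ D → x ∈ₘ V₂ := fun hx => h.mem_iff_subset.1 hD _ hx
    refine ⟨W, hW, D, hD, hc.isPWOCode A, (h.isRegular_iff hθ hD hc).2 ⟨hreg, hθδ⟩, ?_⟩
    obtain ⟨q, hqA, hq⟩ := h.exists_code_rel (fun a b => ap f b ∈ₘ R ∧ ap π (ap f b) = a)
      inferInstance
    refine ⟨_, hqA, fun ξ hξ => ?_, fun ξ hξ x hx hξx => ?_,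
      fun ξ hξ ξ' hξ' x hx x' hx' e e' h1 h2 => ?_⟩
    · obtain ⟨δ', hδ', rfl⟩ := hπ.2 ξ (hρ.trans hα hξ)
      obtain ⟨x, hx, rfl⟩ := hc.surj δ' ((hlt _ _ hδ' hδ).2 hξ)
      exact ⟨x, hx, (hq _ _ (hαV _ hξ) (hDV hx)).2 ⟨hδ', rfl⟩⟩
    · rw [hq _ _ (hαV _ hξ) (hDV hx), hR] at hξx
      have hE : sep D (fun y => qpair y x ∈ₘ W) ∈ₘ A := h.super.subset _ _ hD sep_subset
      have hEx : ∀ y, y ∈ₘ D → (y ∈ₘ sep D (fun y => qpair y x ∈ₘ W) ↔ qpair y x ∈ₘ W) :=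
        fun y hy => by rw [mem_sep, and_iff_right hy]
      exact ⟨_, hE, sep_subset, hEx, (h.isRegular_iff hθ hE (hc.segment hx sep_subset hEx)).2
        ⟨hξx.1.1, hξx.1.2.1⟩⟩
    · rw [hq _ _ (hαV _ hξ) (hDV hx)] at e
      rw [hq _ _ (hαV _ hξ') (hDV hx')] at e'
      rw [← e.2, ← e'.2, (hc.eq_iff hx hx').2 ⟨h1, h2⟩]
  have hno : ∀ W, W ∈ₘ A → ∀ D, D ∈ₘ A → IsPWOCode A W D →
      IsRegularCode A W D ∧ IsBigCode A V₂ W D → ∀ H, H ∈ₘ A → ¬ IsInjCode A V₂ W D κ H := by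
    intro W hW D hD hpwo hreg H hH
    obtain ⟨f, δ, hc⟩ := hpwo.exists_collapse h.super hD
    rw [h.isRegular_iff hθ hD hc] at hreg
    exact h.not_isInjCode_crit hθ hW hD hc hreg.1 hreg.2 hH
  -- for `ρ = κ` the statement `hcode` for all `α < κ` is reflected to `κ < j(κ)`
  have hρκ : ρ ∈ₘ κ := by
    rcases ordinal_trichotomy hρ h.ord with h1 | rfl | h1
    · exact h1
    · have key := (hj.iff₂ (fun κ V => ∀ α, α ∈ₘ κ → ∃ W, W ∈ₘ A ∧ ∃ D, D ∈ₘ A ∧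
        IsPWOCode A W D ∧ (IsRegularCode A W D ∧ IsBigCode A V W D) ∧
        ∃ H, H ∈ₘ A ∧ IsInjCode A V W D α H) h.crit_mem h.V₂_mem).1 fun α hα =>
          hcode α hα (h.mem_iff_subset.1 (h.super.trans _ h.crit_mem _ hα))
      rw [h.fix₂] at key
      obtain ⟨W, hW, D, hD, hpwo, hreg, H, hH, hinj⟩ := key _ h.crit
      exact absurd hinj (hno W hW D hD hpwo hreg H hH)
    · obtain ⟨W, hW, D, hD, hpwo, hreg, H, hH, hinj⟩ := hcode κ h1 hκV
      exact absurd hinj (hno W hW D hD hpwo hreg H hH)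
  refine ⟨⟨π, isInjection_iff.2 ⟨hπ.1.mono fun x hx => h.ord.trans hρκ (hπ.1.ap_mem hx), ?_⟩⟩, ?_⟩
  · exact fun x x' hx hx' => hπinj x x' hx hx'
  · rintro ⟨g, hg⟩
    rw [isInjection_iff] at hg
    refine h.not_isInjection_crit hρκ (f := lam κ fun ξ => ap π (ap g ξ)) (isInjection_iff.2
      ⟨isFun_lam fun ξ hξ => hπ.1.ap_mem (hg.1.ap_mem hξ), fun x x' hx hx' e => ?_⟩)
    rw [ap_lam hx, ap_lam hx'] at e
    exact hg.2 x x' hx hx' (hπinj _ _ (hg.1.ap_mem hx) (hg.1.ap_mem hx') e)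

end IsEvenEmbedding

theorem IsTheta.isThetaFor {f α β θ : M} (hf : IsHierarchy f α) (hβ : β ∈ₘ succ α)
    (h : IsTheta β θ) : IsThetaFor (ap f β) θ := by
  obtain ⟨v, hv, ho, hn, hs⟩ := h
  obtain ⟨g, hg, rfl⟩ := hv.exists_hierarchy
  rw [hf.unique hg hβ (mem_succ.2 (Or.inr rfl))]
  exact ⟨ho, fun S f hS hf => hn ⟨S, f, hS, hf⟩, hs⟩

end Codes

end ZFModel

theorem mainTheorem2 {M : Type*} [Lset.Structure M] (hM : IsModelZF M)
    (ε ε₂ ε₃ V₃ θ₂ θ₃ j κ : M)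
    (hε : IsEven ε) (hε₂ : IsPlus ε 2 ε₂) (hε₃ : IsPlus ε 3 ε₃)
    (hV₃ : IsVLevel ε₃ V₃) (hθ₂ : IsTheta ε₂ θ₂) (hθ₃ : IsTheta ε₃ θ₃)
    (hj : IsElementaryEmbedding j V₃ V₃) (hκ : IsCriticalPoint j V₃ κ) :
    ∃ R : M, (∀ δ, δ ∈ₘ R ↔ IsRegularCardinal δ ∧ θ₂ ∈ₘ δ ∧ δ ∈ₘ θ₃) ∧ CardLT R κ := by
  have : Fact (IsModelZF M) := ⟨hM⟩
  obtain rfl : ε₂ = succ (succ ε) := by simpa [IsPlus, isSucc_iff] using hε₂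
  obtain rfl : ε₃ = succ (succ (succ ε)) := by simpa [IsPlus, isSucc_iff] using hε₃
  obtain ⟨f, hf, hA⟩ := hV₃.exists_hierarchy
  have hR : ∀ δ, δ ∈ₘ sep θ₃ (fun δ => IsRegularCardinal δ ∧ θ₂ ∈ₘ δ) ↔
      IsRegularCardinal δ ∧ θ₂ ∈ₘ δ ∧ δ ∈ₘ θ₃ := by
    intro δ
    rw [mem_sep]
    tauto
  refine ⟨_, hR, (isEvenEmbedding hj hf hA hε hκ).cardLT_regular ?_ ?_ hR⟩
  · exact hθ₂.isThetaFor hf (mem_succ.2 (Or.inl (mem_succ.2 (Or.inr rfl))))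
  · rw [hA]
    exact hθ₃.isThetaFor hf (mem_succ.2 (Or.inr rfl))
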